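/- **Model.** Let $N,K,d,n\ge 1$ and write $[N]=\{1,\dots,N\}$. For an item with feature $x\in\mathbb R^d$ and price $p\in\mathbb R$ put $\tilde x(p)=(x,-p\,x)\in\mathbb R^{2d}$. For features $X=(x_1,\dots,x_N)$, a parameter $\vartheta\in\mathbb R^{2d}$, an assortment $S\subseteq[N]$ and prices $\mathbf p\in\mathbb R^N$, the MNL choice probabilities and the expected revenue are $$q_j(S,\mathbf p|\vartheta)=\frac{e^{\tilde x_j(p_j)^\top\vartheta}}{1+\sum_{k\in S}e^{\tilde x_k(p_k)^\top\vartheta}}\ (j\in S),\qquad q_0(S,\mathbf p|\vartheta)=\frac{1}{1+\sum_{k\in S}e^{\tilde x_k(p_k)^\top\vartheta}},\qquad R(S,\mathbf p|\vartheta)=\sum_{j\in S}p_j\,q_j(S,\mathbf p|\vartheta).$$ Fix target features $X$ with $\|x_i\|_2\le 1$ for all $i\in[N]$, and a true parameter $\vartheta^\star=(\psi^\star,\phi^\star)$ with $\|\vartheta^\star\|_2\le W$, $W>0$, such that $\langle\phi^\star,x_i\rangle\ge L_0>0$ for all $i\in[N]$. Put $P=(3+W+\log K)/L_0$, $\mathcal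 P=[0,P]$ and $\mathcal S_K=\{S\subseteq[N]:|S|\le K\}$. **Data.** The dataset is $\mathcal D=\{(i_m,S_m,\mathbf p_m,X_m)\}_{m\le n}$. Conditionally on the assortments $S_m$ and the augmented features $\tilde x_{mj}(p_{mj})$, the choices $i_m$ are independent and $i_m$ has the MNL law with parameter $\vartheta^\star$, assortment $S_m$, prices $\mathbf p_m$ and features $X_m$. Let $\ell_{\mathcal D}$ be the negative log-likelihood of the choices, $H(\vartheta)=\nabla^2\ell_{\mathcal D}(\vartheta)$, and $\|x\|_A=\sqrt{x^\top Ax}$. An MLE is a minimizer $\hat\vartheta$ of $\ell_{\mathcal D}$ over $\mathbb R^{2d}$. **Algorithm (LCB-MNL-Pricing).** Given $\delta$ and an MLE $\hat\vartheta$, put $$u_i^{\rm LCB}(p)=\tilde x_i(p)^\top\hat\vartheta-16\sqrt3\,\|\tilde x_i(p)\|_{H(\hat\vartheta)^{-1}}\sqrt{\log(N/\delta)}$$ and output an arbitrary maximizer $(S^{\rm LCB},\mathbf p^{\rm LCB})$ over $\mathcal S_K\times\mathcal P^N$ of $$R^{\rm LCB}(S,\mathbf p)=\frac{\sum_{i\in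 S}p_i e^{u_i^{\rm LCB}(p_i)}}{1+\sum_{i\in S}e^{u_i^{\rm LCB}(p_i)}}.$$ **Theorem.** There is a universal constant $C>0$ such that the following holds. In the setting above let $\delta\in(0,1)$ with $N/\delta\ge 2$ (automatic if $N\ge2$). Suppose that almost surely $H(\vartheta^\star)$ is invertible and the burn-in condition $$144\max_{m\le n,\ j\in S_m}\|\tilde x_{mj}(p_{mj})\|_{H(\vartheta^\star)^{-1}}\le\bigl(2d\log(N/\delta)\bigr)^{-1/2}$$ holds. Let $(S^\star,\mathbf p^\star)$ be any maximizer of $R(\cdot,\cdot|\vartheta^\star)$ over $\mathcal S_K\times\mathcal P^N$, and let $$\mathrm{SubOpt}(S,\mathbf p)=\max_{S'\in\mathcal S_K,\ \mathbf p'\in\mathbb R^N}R(S',\mathbf p'|\vartheta^\star)-R(S,\mathbf p|\vartheta^\star).$$ Then with probability at least $1-\delta$ the algorithm has an output, and for every possible output $$\mathrm{SubOpt}(S^{\rm LCB},\mathbf p^{\rm LCB})\le C\,(1+\log K)\log(N/\delta)\left(\frac{W\vee1}{L_0}\sqrt{\sum_{j\in S^\star}q_j^\star q_0^\star\,\|\tilde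 x_j(p_j^\star)\|^2_{H(\vartheta^\star)^{-1}}}+\frac{W\vee1}{L_0}\max_{j\in S^\star}\|\tilde x_j(p_j^\star)\|^2_{H(\vartheta^\star)^{-1}}\right),$$ where $q_j^\star=q_j(S^\star,\mathbf p^\star|\vartheta^\star)$ and $q_0^\star=q_0(S^\star,\mathbf p^\star|\vartheta^\star)$. -/

import Mathlib

open MeasureTheory ProbabilityTheory
open scoped Matrix

noncomputable section

namespace MNLPricing

/-- Feature vectors of items, with the Euclidean norm. -/
abbrev Feat (d : ℕ) := EuclideanSpace ℝ (Fin d)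

/-- The space `ℝ^{2d}` of augmented features and of parameters, with the Euclidean norm. -/
abbrev Aug (d : ℕ) := EuclideanSpace ℝ (Fin d ⊕ Fin d)

/-- The concatenation `(a, b) ∈ ℝ^{2d}` of two vectors of `ℝ^d`. -/
def stack {d : ℕ} (a b : Feat d) : Aug d :=
  WithLp.toLp 2 (Sum.elim (fun k => a k) (fun k => b k))

/-- The augmented feature `x̃(p) = (x, -p x)` of an item with feature `x` and price `p`. -/
def augment {d : ℕ} (x : Feat d) (p : ℝ) : Aug d := stack x (-(p • x))

/-- The weighted norm `‖x‖_A = √(xᵀ A x)`. -/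
def wnorm {ι : Type*} [Fintype ι] (A : Matrix ι ι ℝ) (x : EuclideanSpace ℝ ι) : ℝ :=
  Real.sqrt (WithLp.ofLp x ⬝ᵥ (A *ᵥ WithLp.ofLp x))

/-- MNL choice probabilities for utilities `u` and offered assortment `S`.
`none` is the no-purchase option (item `0`, of attraction value `1`); items that are not offered
are never chosen. -/
def choiceProb {N : ℕ} (u : Fin N → ℝ) (S : Finset (Fin N)) : Option (Fin N) → ℝ
  | none => 1 / (1 + ∑ j ∈ S, Real.exp (u j))
  | some i => if i ∈ S then Real.exp (u i) / (1 + ∑ j ∈ S, Real.exp (u j)) else 0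

/-- Expected revenue of the assortment `S` at prices `p` when the utilities are `u`. -/
def revenue {N : ℕ} (u : Fin N → ℝ) (S : Finset (Fin N)) (p : Fin N → ℝ) : ℝ :=
  ∑ i ∈ S, p i * choiceProb u S (some i)

/-- The utility `x̃_i(p)ᵀ ϑ`, under parameter `θ`, of item `i` with features `X` at price `p`. -/
def utility {N d : ℕ} (X : Fin N → Feat d) (θ : Aug d) (i : Fin N) (p : ℝ) : ℝ :=
  inner ℝ (augment (X i) p) θ

/-- The choice probabilities `q(S, p | θ)` of the price-based linear MNL model. -/
def modelProb {N d : ℕ} (X : Fin N → Feat d) (θ : Aug d) (S : Finset (Fin N))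
    (p : Fin N → ℝ) : Option (Fin N) → ℝ :=
  choiceProb (fun i => utility X θ i (p i)) S

/-- One observation: the choice made, the assortment offered, and the prices and item features in
force. -/
structure Observation (N d : ℕ) where
  choice : Option (Fin N)
  assortment : Finset (Fin N)
  price : Fin N → ℝ
  feature : Fin N → Feat d

/-- The MNL choice probabilities of the price-based model with parameter `θ` in the situation
(assortment, prices, features) of an observation. -/
def Observation.prob {N d : ℕ} (o : Observation N d) (θ : Aug d) : Option (Fin N) → ℝ :=
  modelProb o.feature θ o.assortment o.price

/-- The negative log-likelihood of a dataset. -/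
def negLogLik {n N d : ℕ} (D : Fin n → Observation N d) (θ : Aug d) : ℝ :=
  -∑ m, Real.log ((D m).prob θ (D m).choice)

/-- The Hessian matrix of the negative log-likelihood. -/
def hessian {n N d : ℕ} (D : Fin n → Observation N d) (θ : Aug d) :
    Matrix (Fin d ⊕ Fin d) (Fin d ⊕ Fin d) ℝ :=
  Matrix.of fun a b =>
    iteratedFDeriv ℝ 2 (negLogLik D) θ ![EuclideanSpace.single a 1, EuclideanSpace.single b 1]

/-- `θ` is a maximum likelihood estimate. -/
def IsMLE {n N d : ℕ} (D : Fin n → Observation N d) (θ : Aug d) : Prop :=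
  ∀ θ' : Aug d, negLogLik D θ ≤ negLogLik D θ'

/-- The bound `P = (3 + W + log K) / L₀` defining the price domain `[0, P]`. -/
def priceBound (W L₀ : ℝ) (K : ℕ) : ℝ := (3 + W + Real.log K) / L₀

/-- `(S, p)` maximizes the revenue over assortments of at most `K` items and price vectors with
all entries in `I`, when item `i` at price `p` has utility `u i p`. -/
def IsOptimalPair {N : ℕ} (u : Fin N → ℝ → ℝ) (K : ℕ) (I : Set ℝ)
    (S : Finset (Fin N)) (p : Fin N → ℝ) : Prop :=
  (S.card ≤ K ∧ ∀ i, p i ∈ I) ∧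
    ∀ (S' : Finset (Fin N)) (p' : Fin N → ℝ), S'.card ≤ K → (∀ i, p' i ∈ I) →
      revenue (fun i => u i (p' i)) S' p' ≤ revenue (fun i => u i (p i)) S p

/-- The pessimistic utility `u_i^LCB(p)` built from the estimate `θ`. -/
def lcbUtility {n N d : ℕ} (D : Fin n → Observation N d) (X : Fin N → Feat d) (δ : ℝ)
    (θ : Aug d) (i : Fin N) (p : ℝ) : ℝ :=
  inner ℝ (augment (X i) p) θ
    - 16 * Real.sqrt 3 * wnorm (hessian D θ)⁻¹ (augment (X i) p) * Real.sqrt (Real.log (N / δ))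

/-- `(S, p)` is a possible output of LCB-MNL-Pricing on the dataset `D` with target features `X`:
an arbitrary maximizer of the pessimistic revenue over `[0, P]`, for a maximum likelihood
estimate. -/
def IsLCBOutput {n N d : ℕ} (D : Fin n → Observation N d) (X : Fin N → Feat d) (δ : ℝ)
    (K : ℕ) (P : ℝ) (S : Finset (Fin N)) (p : Fin N → ℝ) : Prop :=
  ∃ θ : Aug d, IsMLE D θ ∧ IsOptimalPair (lcbUtility D X δ θ) K (Set.Icc 0 P) S p

/-- The expected revenue of `(S, p)` for target features `X` under the parameter `θ`. -/
def trueRevenue {N d : ℕ} (X : Fin N → Feat d) (θ : Aug d)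
    (S : Finset (Fin N)) (p : Fin N → ℝ) : ℝ :=
  revenue (fun i => utility X θ i (p i)) S p

/-- The σ-algebra generated by the offered assortments and the augmented features
`x̃_{mj}(p_{mj})` of a random dataset. -/
@[reducible] def designSigma {Ω : Type*} {n N d : ℕ} (D : Ω → Fin n → Observation N d) : MeasurableSpace Ω :=
  ⨆ m : Fin n,
    (MeasurableSpace.comap (fun ω => (D ω m).assortment) ⊤ ⊔
      ⨆ j : Fin N, MeasurableSpace.comap
        (fun ω => augment ((D ω m).feature j) ((D ω m).price j)) (borel (Aug d)))

/-- A random dataset from the price-based MNL model with parameter `θ`: conditionally on the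
offered assortments and augmented features, the choices are independent, each with the MNL law. -/
structure IsMNLSample {Ω : Type*} [mΩ : MeasurableSpace Ω] (μ : Measure Ω) {n N d : ℕ}
    (D : Ω → Fin n → Observation N d) (θ : Aug d) : Prop where
  measurableSet_choice : ∀ (m : Fin n) (c : Option (Fin N)),
    MeasurableSet {ω | (D ω m).choice = c}
  designSigma_le : designSigma D ≤ mΩ
  condLaw : ∀ c : Fin n → Option (Fin N),
    μ⟦{ω | ∀ m, (D ω m).choice = c m} | designSigma D⟧
      =ᵐ[μ] fun ω => ∏ m, (D ω m).prob θ (c m)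

end MNLPricing

end

/-!
The proof has a statistical half, a fixed-design analysis of the maximum likelihood estimate, and
an economic half, the comparison of the pessimistic and the true revenue.

*Likelihood.* Choice probabilities are exponential tilts (`tilt`, `prob_eq_tilt`) of the indicator
of the available options, and shifting the parameter tilts them further (`prob_add`). All
estimates on the likelihood reduce to inequalities for tilts of one finite distribution: a
quantitative Jensen inequality (`wmean_add_wcov_le_log`), a second-order expansion with remainder
controlled by a fourth moment (`sq_tilt_expansion_error_le`), and comparability of variances
(`wcov_self_le_mul`). The Hessian is the Fisher information `H` (`hessian_eq`), which does not
depend on the choices.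

*Concentration.* Let `z` be the noise, the negative gradient of the negative log-likelihood at the
true parameter, and `L = log (N / δ)`. The burn-in condition makes each summand of `z` small in
the norm of `H⁻¹`, so `z` is sub-Gaussian with covariance `H` in all directions of moderate length
(`mgf_noise_le`). Hence, up to probability `δ`, the dual norm of `z` is `O(√(d L))` (`tail_norm`),
and `H⁻¹ z` is `O(√L)` in the plane spanned by `(xᵢ, 0)` and `(0, xᵢ)` for each of the `N` items,
which contains `x̃ᵢ(p)` for all prices `p` (`tail_direction`, `abs_inner_plane_le`).

*The estimate.* Strong convexity and the bound on the dual norm confine every minimizer to a ball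
on which the Hessian varies by a constant factor (`excess_pos`, `fisher_tilt_comparable`). The
naive bound for the deviation of the estimation error from the Newton step `H⁻¹ z` is of order
`√(d L)`, too large by a factor `√d`. It is improved by noting that the deviation is governed by
the fourth moments `∑ₘ E ⟨ξₘ, ·⟩⁴` of the error along the centred features `ξₘ`. At `H⁻¹ z` these
are at most `L` with high probability, because a moment of order `L` can be averaged over the
directions `ξₘ` (`tail_quartic`), and the contribution of the deviation itself can be absorbed
(`newton_error_le`). So the width used by the algorithm is a valid confidence bound, and the
pessimistic utilities lie below the true ones by at most `50 √L ‖x̃‖`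
(`Favourable.lcbUtility_mem`).

*Revenue.* An optimal assortment only contains items priced at least at the optimal revenue
(`IsOptimalPair.revenue_le_price`), so raising utilities raises its revenue, and the true revenue
of the output is at least the pessimistic revenue of `(S⋆, p⋆)`. The loss at `(S⋆, p⋆)` is a sum
of margins times attraction values times widths. As the margins weighted by the attraction values
add up to the revenue, the Cauchy–Schwarz inequality gives the factors `q_j q_0`
(`revenue_sub_le`). Finally, no item of an unconstrained optimum gains from a price above `P`
(`exists_capped_prices`).
-/

set_option linter.unusedSectionVars false

open MeasureTheory ProbabilityTheory
open scoped Matrix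

noncomputable section

namespace MNLPricing

/-! ### Finite distributions and exponential tilting -/

section Tilt

variable {J : Type*} [Fintype J]

/-- The mean `∑ q_c f_c` of `f` under the weights `q`. -/
def wmean (q f : J → ℝ) : ℝ := ∑ c, q c * f c

/-- The deviation of `f` from its mean under `q`. -/
def dev (q f : J → ℝ) (c : J) : ℝ := f c - wmean q f

/-- The covariance of `f` and `h` under the weights `q`. -/
def wcov (q f h : J → ℝ) : ℝ := wmean q fun c => dev q f c * dev q h c

/-- The exponential tilt of the weights `a` by `f`, normalized to total mass one. -/
def tilt (a f : J → ℝ) (c : J) : ℝ := a c * Real.exp (f c) / wmean a fun c => Real.exp (f c)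

lemma wmean_add (q f h : J → ℝ) : (wmean q fun c => f c + h c) = wmean q f + wmean q h := by
  simp [wmean, mul_add, Finset.sum_add_distrib]

lemma wmean_sub (q f h : J → ℝ) : (wmean q fun c => f c - h c) = wmean q f - wmean q h := by
  simp [wmean, mul_sub, Finset.sum_sub_distrib]

lemma wmean_const_mul (q f : J → ℝ) (r : ℝ) : (wmean q fun c => r * f c) = r * wmean q f := by
  simp only [wmean, Finset.mul_sum]
  exact Finset.sum_congr rfl fun c _ => by ring

lemma wmean_const {q : J → ℝ} (hq : q ∈ stdSimplex ℝ J) (r : ℝ) : (wmean q fun _ => r) = r := by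
  rw [wmean, ← Finset.sum_mul, hq.2, one_mul]

lemma wmean_mono {q f h : J → ℝ} (hq : ∀ c, 0 ≤ q c) (hfh : ∀ c, q c ≠ 0 → f c ≤ h c) :
    wmean q f ≤ wmean q h := by
  refine Finset.sum_le_sum fun c _ => ?_
  by_cases hc : q c = 0
  · simp [hc]
  · exact mul_le_mul_of_nonneg_left (hfh c hc) (hq c)

lemma wmean_congr {q f h : J → ℝ} (hfh : ∀ c, q c ≠ 0 → f c = h c) : wmean q f = wmean q h := by
  refine Finset.sum_congr rfl fun c _ => ?_
  by_cases hc : q c = 0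
  · simp [hc]
  · rw [hfh c hc]

lemma wmean_nonneg {q f : J → ℝ} (hq : ∀ c, 0 ≤ q c) (hf : ∀ c, q c ≠ 0 → 0 ≤ f c) :
    0 ≤ wmean q f := by
  simpa [wmean] using wmean_mono (f := fun _ => 0) hq hf

lemma wmean_dev {q : J → ℝ} (hq : q ∈ stdSimplex ℝ J) (f : J → ℝ) : wmean q (dev q f) = 0 := by
  unfold dev
  rw [wmean_sub, wmean_const hq, sub_self]

lemma wcov_self_nonneg {q : J → ℝ} (hq : ∀ c, 0 ≤ q c) (f : J → ℝ) : 0 ≤ wcov q f f :=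
  wmean_nonneg hq fun _ _ => mul_self_nonneg _

lemma wcov_eq {q : J → ℝ} (hq : q ∈ stdSimplex ℝ J) (f h : J → ℝ) :
    wcov q f h = wmean q fun c => dev q f c * h c := by
  have h1 : (wmean q fun c => dev q f c * h c)
      = wmean q fun c => dev q f c * dev q h c + wmean q h * dev q f c :=
    wmean_congr fun c _ => by simp only [dev]; ring
  rw [h1, wmean_add, wmean_const_mul, wmean_dev hq, mul_zero, add_zero, wcov]

/-- Cauchy–Schwarz under the weights `q`. -/
lemma wmean_mul_sq_le {q : J → ℝ} (hq : ∀ c, 0 ≤ q c) (f h : J → ℝ) :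
    (wmean q fun c => f c * h c) ^ 2 ≤ (wmean q fun c => f c ^ 2) * wmean q fun c => h c ^ 2 := by
  have h1 := Finset.sum_mul_sq_le_sq_mul_sq Finset.univ (fun c => √(q c) * f c)
    (fun c => √(q c) * h c)
  have e : ∀ x y c, √(q c) * x * (√(q c) * y) = q c * (x * y) := fun x y c => by
    linear_combination (x * y) * Real.mul_self_sqrt (hq c)
  simpa only [wmean, mul_pow, Real.sq_sqrt (hq _), e] using h1

lemma sq_wmean_le {q : J → ℝ} (hq : q ∈ stdSimplex ℝ J) (f : J → ℝ) :
    wmean q f ^ 2 ≤ wmean q fun c => f c ^ 2 := by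
  have := wmean_mul_sq_le hq.1 (fun _ => 1) f
  simpa [wmean_const hq] using this

lemma abs_wmean_le {q : J → ℝ} (hq : q ∈ stdSimplex ℝ J) {f : J → ℝ} {b : ℝ}
    (hf : ∀ c, q c ≠ 0 → |f c| ≤ b) : |wmean q f| ≤ b := by
  rw [abs_le]
  constructor
  · rw [← wmean_const hq (-b)]
    exact wmean_mono hq.1 fun c hc => (abs_le.mp (hf c hc)).1
  · rw [← wmean_const hq b]
    exact wmean_mono hq.1 fun c hc => (abs_le.mp (hf c hc)).2

lemma abs_dev_le {q : J → ℝ} (hq : q ∈ stdSimplex ℝ J) {f : J → ℝ} {b : ℝ}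
    (hf : ∀ c, q c ≠ 0 → |f c| ≤ b) {c : J} (hc : q c ≠ 0) : |dev q f c| ≤ 2 * b := by
  have h1 := abs_le.mp (hf c hc)
  have h2 := abs_le.mp (abs_wmean_le hq hf)
  rw [dev, abs_le]
  constructor <;> linarith

lemma wmean_exp_pos {a : J → ℝ} (ha : ∀ c, 0 ≤ a c) (ha' : 0 < ∑ c, a c) (f : J → ℝ) :
    0 < wmean a fun c => Real.exp (f c) := by
  obtain ⟨c, -, hc⟩ := Finset.exists_ne_zero_of_sum_ne_zero ha'.ne'
  have hc' : 0 < a c := lt_of_le_of_ne (ha c) (Ne.symm hc)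
  exact Finset.sum_pos' (fun c _ => mul_nonneg (ha c) (Real.exp_pos _).le)
    ⟨c, Finset.mem_univ c, mul_pos hc' (Real.exp_pos _)⟩

lemma tilt_mem {a : J → ℝ} (ha : ∀ c, 0 ≤ a c) (ha' : 0 < ∑ c, a c) (f : J → ℝ) :
    tilt a f ∈ stdSimplex ℝ J := by
  have h0 := wmean_exp_pos ha ha' f
  refine ⟨fun c => div_nonneg (mul_nonneg (ha c) (Real.exp_pos _).le) h0.le, ?_⟩
  simp only [tilt, ← Finset.sum_div]
  exact div_self h0.ne'

lemma tilt_ne_zero {a : J → ℝ} (ha : ∀ c, 0 ≤ a c) (ha' : 0 < ∑ c, a c) (f : J → ℝ) {c : J} :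
    tilt a f c ≠ 0 ↔ a c ≠ 0 := by
  simp [tilt, (wmean_exp_pos ha ha' f).ne', Real.exp_ne_zero]

lemma wmean_tilt (a f h : J → ℝ) :
    wmean (tilt a f) h
      = (wmean a fun c => Real.exp (f c) * h c) / wmean a fun c => Real.exp (f c) := by
  simp only [wmean, tilt, Finset.sum_div]
  refine Finset.sum_congr rfl fun c _ => by ring

/-- Tilting twice is tilting by the sum. -/
lemma tilt_tilt {a : J → ℝ} (ha : ∀ c, 0 ≤ a c) (ha' : 0 < ∑ c, a c) (f h : J → ℝ) :
    tilt (tilt a f) h = tilt a fun c => f c + h c := by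
  have h0 := (wmean_exp_pos ha ha' f).ne'
  have h1 := (wmean_exp_pos ha ha' fun c => f c + h c).ne'
  have e : (wmean (tilt a f) fun c => Real.exp (h c))
      = (wmean a fun c => Real.exp (f c + h c)) / wmean a fun c => Real.exp (f c) := by
    rw [wmean_tilt]
    simp only [Real.exp_add]
  funext c
  rw [tilt, e, tilt, tilt, Real.exp_add]
  field_simp

lemma sum_pos_of_mem {q : J → ℝ} (hq : q ∈ stdSimplex ℝ J) : 0 < ∑ c, q c := by
  rw [hq.2]; exact one_pos

/-- Jensen's inequality for the exponential. -/
lemma wmean_le_log_wmean_exp {q : J → ℝ} (hq : q ∈ stdSimplex ℝ J) (f : J → ℝ) :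
    wmean q f ≤ Real.log (wmean q fun c => Real.exp (f c)) := by
  rw [Real.le_log_iff_exp_le (wmean_exp_pos hq.1 (sum_pos_of_mem hq) f)]
  have h1 : (wmean q fun c => Real.exp (wmean q f) * (1 + dev q f c)) = Real.exp (wmean q f) := by
    rw [wmean_const_mul, wmean_add, wmean_const hq, wmean_dev hq, add_zero, mul_one]
  rw [← h1]
  refine wmean_mono hq.1 fun c _ => ?_
  have h2 : Real.exp (f c) = Real.exp (wmean q f) * Real.exp (dev q f c) := by
    rw [← Real.exp_add, dev]; ring_nf
  rw [h2, add_comm]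
  exact mul_le_mul_of_nonneg_left (Real.add_one_le_exp _) (Real.exp_pos _).le

lemma exp_quadratic_lower {x : ℝ} (hx : |x| ≤ 1 / 4) : 1 + x + 0.44 * x ^ 2 ≤ Real.exp x := by
  have h := Real.exp_bound (x := x) (by linarith) (n := 3) (by norm_num)
  have h2 := (abs_le.mp h).1
  simp only [Finset.sum_range_succ, Finset.sum_range_zero, Nat.factorial] at h2
  norm_num at h2
  have h3 : |x| ^ 3 ≤ 1 / 4 * x ^ 2 := by
    rw [pow_succ, sq_abs, mul_comm]
    exact mul_le_mul_of_nonneg_right hx (sq_nonneg x)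
  nlinarith [sq_nonneg x]

lemma wmean_exp_eq {q f : J → ℝ} :
    (wmean q fun c => Real.exp (f c))
      = Real.exp (wmean q f) * wmean q fun c => Real.exp (dev q f c) := by
  rw [← wmean_const_mul]
  refine wmean_congr fun c _ => ?_
  rw [← Real.exp_add, dev]; ring_nf

/-- Strong convexity of the log-partition function: a quantitative Jensen inequality for functions
of small oscillation. -/
lemma wmean_add_wcov_le_log {q f : J → ℝ} (hq : q ∈ stdSimplex ℝ J)
    (hf : ∀ c, q c ≠ 0 → |dev q f c| ≤ 1 / 4) :
    wmean q f + 0.4 * wcov q f f ≤ Real.log (wmean q fun c => Real.exp (f c)) := by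
  have hZ := wmean_exp_pos hq.1 (sum_pos_of_mem hq) (dev q f)
  rw [wmean_exp_eq, Real.log_mul (Real.exp_ne_zero _) hZ.ne', Real.log_exp]
  have hV0 := wcov_self_nonneg hq.1 f
  have hV1 : wcov q f f ≤ 1 / 16 := by
    rw [← wmean_const hq (1 / 16)]
    refine wmean_mono hq.1 fun c hc => ?_
    have := abs_le.mp (hf c hc)
    nlinarith
  have hlow : 1 + 0.44 * wcov q f f ≤ wmean q fun c => Real.exp (dev q f c) := by
    have e : (wmean q fun c => 1 + dev q f c + 0.44 * (dev q f c * dev q f c))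
        = 1 + 0.44 * wcov q f f := by
      rw [wmean_add, wmean_add, wmean_const hq, wmean_dev hq, wmean_const_mul, add_zero, wcov]
    rw [← e]
    refine wmean_mono hq.1 fun c hc => ?_
    have := exp_quadratic_lower (hf c hc)
    rwa [sq] at this
  have h1 := Real.log_le_log (by linarith) hlow
  have h2 := Real.one_sub_inv_le_log_of_pos (x := 1 + 0.44 * wcov q f f) (by linarith)
  have h3 : 0.4 * wcov q f f ≤ 1 - (1 + 0.44 * wcov q f f)⁻¹ := by
    have hp : 0 < 1 + 0.44 * wcov q f f := by linarith
    have : 1 - (1 + 0.44 * wcov q f f)⁻¹ = 0.44 * wcov q f f / (1 + 0.44 * wcov q f f) := by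
      field_simp; ring
    rw [this, le_div_iff₀ hp]
    nlinarith
  linarith

/-- The error of the first-order expansion of a tilted mean is controlled by the fourth central
moment of the tilting function. -/
lemma sq_tilt_expansion_error_le {q f : J → ℝ} (hq : q ∈ stdSimplex ℝ J)
    (hf : ∀ c, q c ≠ 0 → |dev q f c| ≤ 1 / 4) (h : J → ℝ) :
    (wmean (tilt q f) h - wmean q h - wcov q h f) ^ 2
      ≤ wcov q h h * (5.125 * wmean q fun c => dev q f c ^ 4) := by
  set x := dev q f with hx
  set Z := wmean q fun c => Real.exp (x c) with hZdef
  have hZ : 0 < Z := wmean_exp_pos hq.1 (sum_pos_of_mem hq) x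
  set v := wcov q f f with hv
  have hv0 : 0 ≤ v := wcov_self_nonneg hq.1 f
  have hZ1 : 1 ≤ Z := by
    have e : (wmean q fun c => 1 + x c) = 1 := by
      rw [wmean_add, wmean_const hq, wmean_dev hq, add_zero]
    rw [← e]
    exact wmean_mono hq.1 fun c _ => by linarith [Real.add_one_le_exp (x c)]
  have habs : ∀ c, q c ≠ 0 → |Real.exp (x c) - 1 - x c| ≤ x c ^ 2 := fun c hc =>
    Real.abs_exp_sub_one_sub_id_le ((hf c hc).trans (by norm_num))
  have hZ2 : Z - 1 ≤ v := by
    have e : (wmean q fun c => (1 + x c) + x c * x c) = 1 + v := by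
      rw [wmean_add, wmean_add, wmean_const hq, wmean_dev hq, add_zero, hv, wcov]
    have : Z ≤ 1 + v := by
      rw [← e]
      exact wmean_mono hq.1 fun c hc => by nlinarith [(abs_le.mp (habs c hc)).2]
    linarith
  -- the second-order remainder of the likelihood ratio of the tilt
  set r : J → ℝ := fun c => Real.exp (x c) / Z - 1 - x c with hr
  have hrep : wmean (tilt q f) h - wmean q h - wcov q h f = wmean q fun c => dev q h c * r c := by
    have h1 : wmean (tilt q f) h
        = wmean q h + wmean q fun c => dev q h c * (Real.exp (x c) / Z) := by
      have ht := tilt_mem hq.1 (sum_pos_of_mem hq) f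
      have h2 : wmean (tilt q f) (dev q h) = wmean (tilt q f) h - wmean q h := by
        unfold dev
        rw [wmean_sub, wmean_const ht]
      have h3 : wmean (tilt q f) (dev q h) = wmean q fun c => dev q h c * (Real.exp (x c) / Z) := by
        rw [wmean_tilt, wmean_exp_eq, ← hZdef]
        have : ∀ c, Real.exp (f c) = Real.exp (wmean q f) * Real.exp (x c) := fun c => by
          rw [← Real.exp_add, hx, dev]; ring_nf
        simp only [this, wmean, Finset.sum_div]
        refine Finset.sum_congr rfl fun c _ => ?_
        field_simp
      linarith
    have h4 : (wmean q fun c => dev q h c * r c)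
        = ((wmean q fun c => dev q h c * (Real.exp (x c) / Z)) - wmean q (dev q h))
          - wcov q h f := by
      rw [wcov, ← wmean_sub, ← wmean_sub]
      exact wmean_congr fun c _ => by simp only [hr]; ring
    rw [h1, h4, wmean_dev hq]; ring
  have hrle : ∀ c, q c ≠ 0 → r c ^ 2 ≤ 2 * x c ^ 4 + 3.125 * v ^ 2 := by
    intro c hc
    have e : r c = (Real.exp (x c) - 1 - x c) / Z - (1 + x c) * ((Z - 1) / Z) := by
      simp only [hr]; field_simp; ring
    have b1 : |(Real.exp (x c) - 1 - x c) / Z| ≤ x c ^ 2 := by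
      rw [abs_div, abs_of_pos hZ, div_le_iff₀ hZ]
      nlinarith [habs c hc, sq_nonneg (x c)]
    have b2 : |(1 + x c) * ((Z - 1) / Z)| ≤ 5 / 4 * v := by
      rw [abs_mul]
      refine mul_le_mul ?_ ?_ (abs_nonneg _) (by norm_num)
      · exact (abs_add_le _ _).trans (by rw [abs_one]; linarith [hf c hc])
      · rw [abs_div, abs_of_pos hZ, abs_of_nonneg (by linarith), div_le_iff₀ hZ]
        nlinarith
    rw [e]
    have c1 : ((Real.exp (x c) - 1 - x c) / Z) ^ 2 ≤ (x c ^ 2) ^ 2 := by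
      rw [← sq_abs]; exact pow_le_pow_left₀ (abs_nonneg _) b1 2
    have c2 : ((1 + x c) * ((Z - 1) / Z)) ^ 2 ≤ (5 / 4 * v) ^ 2 := by
      rw [← sq_abs]; exact pow_le_pow_left₀ (abs_nonneg _) b2 2
    nlinarith [sq_nonneg ((Real.exp (x c) - 1 - x c) / Z + (1 + x c) * ((Z - 1) / Z))]
  have hv4 : v ^ 2 ≤ wmean q fun c => x c ^ 4 := by
    have := sq_wmean_le hq fun c => x c * x c
    refine this.trans (le_of_eq (wmean_congr fun c _ => by ring))
  have hr2 : (wmean q fun c => r c ^ 2) ≤ 5.125 * wmean q fun c => x c ^ 4 := by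
    calc (wmean q fun c => r c ^ 2) ≤ wmean q fun c => 2 * x c ^ 4 + 3.125 * v ^ 2 :=
          wmean_mono hq.1 hrle
      _ = 2 * (wmean q fun c => x c ^ 4) + 3.125 * v ^ 2 := by
          rw [wmean_add, wmean_const_mul, wmean_const hq]
      _ ≤ _ := by linarith
  rw [hrep]
  refine (wmean_mul_sq_le hq.1 _ _).trans ?_
  have e : (wmean q fun c => dev q h c ^ 2) = wcov q h h := wmean_congr fun c _ => sq _
  rw [e]
  exact mul_le_mul_of_nonneg_left hr2 (wcov_self_nonneg hq.1 h)

/-- The mean minimizes the mean squared deviation. -/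
lemma wcov_self_le {q : J → ℝ} (hq : q ∈ stdSimplex ℝ J) (h : J → ℝ) (r : ℝ) :
    wcov q h h ≤ wmean q fun c => (h c - r) ^ 2 := by
  have e : (wmean q fun c => (h c - r) ^ 2) = wcov q h h + (wmean q h - r) ^ 2 := by
    have : (wmean q fun c => (h c - r) ^ 2) = wmean q fun c =>
        (dev q h c * dev q h c + 2 * (wmean q h - r) * dev q h c) + (wmean q h - r) ^ 2 :=
      wmean_congr fun c _ => by simp only [dev]; ring
    rw [this, wmean_add, wmean_add, wmean_const_mul, wmean_dev hq, wmean_const hq, wcov]; ring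
  rw [e]; linarith [sq_nonneg (wmean q h - r)]

/-- Variances under comparable weights are comparable. -/
lemma wcov_self_le_mul {q p : J → ℝ} (hq : q ∈ stdSimplex ℝ J) {s : ℝ}
    (hqp : ∀ c, q c ≤ s * p c) (h : J → ℝ) : wcov q h h ≤ s * wcov p h h := by
  refine (wcov_self_le hq h (wmean p h)).trans ?_
  rw [wcov, ← wmean_const_mul]
  refine Finset.sum_le_sum fun c _ => ?_
  have := mul_le_mul_of_nonneg_right (hqp c) (mul_self_nonneg (h c - wmean p h))
  simp only [dev]
  nlinarith

lemma tilt_le {q f : J → ℝ} (hq : q ∈ stdSimplex ℝ J) {b s : ℝ}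
    (hf : ∀ c, q c ≠ 0 → |f c| ≤ b) (hs : Real.exp (2 * b) ≤ s) (c : J) :
    tilt q f c ≤ s * q c ∧ q c ≤ s * tilt q f c := by
  by_cases hc : q c = 0
  · simp [tilt, hc]
  have hZ := wmean_exp_pos hq.1 (sum_pos_of_mem hq) f
  have hZu : (wmean q fun c => Real.exp (f c)) ≤ Real.exp b := by
    rw [← wmean_const hq (Real.exp b)]
    exact wmean_mono hq.1 fun c hc => Real.exp_le_exp.mpr (abs_le.mp (hf c hc)).2
  have hZl : Real.exp (-b) ≤ wmean q fun c => Real.exp (f c) := by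
    rw [← wmean_const hq (Real.exp (-b))]
    exact wmean_mono hq.1 fun c hc => Real.exp_le_exp.mpr (abs_le.mp (hf c hc)).1
  have hfu := Real.exp_le_exp.mpr (abs_le.mp (hf c hc)).2
  have hfl := Real.exp_le_exp.mpr (abs_le.mp (hf c hc)).1
  have hs0 : 0 < s := (Real.exp_pos _).trans_le hs
  have k1 : Real.exp b ≤ s * Real.exp (-b) := by
    calc Real.exp b = Real.exp (2 * b) * Real.exp (-b) := by rw [← Real.exp_add]; ring_nf
      _ ≤ _ := mul_le_mul_of_nonneg_right hs (Real.exp_pos _).le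
  have hq0 := hq.1 c
  constructor
  · rw [tilt, div_le_iff₀ hZ]
    calc q c * Real.exp (f c) ≤ q c * (s * Real.exp (-b)) :=
          mul_le_mul_of_nonneg_left (hfu.trans k1) hq0
      _ = s * q c * Real.exp (-b) := by ring
      _ ≤ _ := mul_le_mul_of_nonneg_left hZl (by positivity)
  · rw [tilt, ← mul_div_assoc, le_div_iff₀ hZ]
    calc q c * (wmean q fun c => Real.exp (f c)) ≤ q c * (s * Real.exp (f c)) :=
          mul_le_mul_of_nonneg_left
            (hZu.trans (k1.trans (mul_le_mul_of_nonneg_left hfl hs0.le))) hq0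
      _ = _ := by ring

end Tilt

/-! ### Weighted norms of positive definite matrices -/

section Matrices

variable {ι : Type*} [Fintype ι] [DecidableEq ι]

/-- The action of a square matrix on Euclidean space. -/
abbrev act (A : Matrix ι ι ℝ) (x : EuclideanSpace ℝ ι) : EuclideanSpace ℝ ι :=
  Matrix.toEuclideanCLM (𝕜 := ℝ) A x

variable {A : Matrix ι ι ℝ}

lemma wnorm_eq (A : Matrix ι ι ℝ) (x : EuclideanSpace ℝ ι) :
    wnorm A x = √(inner ℝ x (act A x)) := by
  rw [wnorm, act, Matrix.inner_toEuclideanCLM]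

lemma wnorm_nonneg (A : Matrix ι ι ℝ) (x : EuclideanSpace ℝ ι) : 0 ≤ wnorm A x :=
  Real.sqrt_nonneg _

lemma wnorm_sq (hA : A.PosSemidef) (x : EuclideanSpace ℝ ι) :
    wnorm A x ^ 2 = inner ℝ x (act A x) := by
  rw [wnorm_eq, Real.sq_sqrt]
  rw [act, Matrix.inner_toEuclideanCLM]
  simpa using hA.dotProduct_mulVec_nonneg x.ofLp

lemma wnorm_smul (A : Matrix ι ι ℝ) (r : ℝ) (x : EuclideanSpace ℝ ι) :
    wnorm A (r • x) = |r| * wnorm A x := by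
  rw [wnorm_eq, wnorm_eq, act, map_smul, inner_smul_left, inner_smul_right,
    ← Real.sqrt_sq_eq_abs, ← Real.sqrt_mul (sq_nonneg r)]
  congr 1
  simp
  ring

lemma wnorm_zero (A : Matrix ι ι ℝ) : wnorm A 0 = 0 := by
  have := wnorm_smul A 0 0
  simpa using this

lemma wnorm_pos (hA : A.PosDef) {x : EuclideanSpace ℝ ι} (hx : x ≠ 0) : 0 < wnorm A x := by
  rw [wnorm_eq, act, Matrix.inner_toEuclideanCLM]
  refine Real.sqrt_pos.mpr ?_
  have : x.ofLp ≠ 0 := fun h => hx (by ext i; simp [h])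
  simpa using hA.dotProduct_mulVec_pos this

lemma act_act_inv (hA : A.PosDef) (x : EuclideanSpace ℝ ι) : act A (act A⁻¹ x) = x := by
  rw [act, act, ← mul_apply_eq_comp, ← map_mul,
    Matrix.mul_nonsing_inv _ ((Matrix.isUnit_iff_isUnit_det A).mp hA.isUnit), map_one]
  rfl

lemma act_inv_act (hA : A.PosDef) (x : EuclideanSpace ℝ ι) : act A⁻¹ (act A x) = x := by
  rw [act, act, ← mul_apply_eq_comp, ← map_mul,
    Matrix.nonsing_inv_mul _ ((Matrix.isUnit_iff_isUnit_det A).mp hA.isUnit), map_one]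
  rfl

lemma inner_act_comm (hA : A.IsHermitian) (x y : EuclideanSpace ℝ ι) :
    inner ℝ (act A x) y = inner ℝ x (act A y) :=
  (Matrix.isSymmetric_toEuclideanLin_iff.mpr hA) x y

/-- A positive definite matrix `A` has an `A`-orthonormal basis, and `A⁻¹` is the sum of the rank
one forms of its vectors. -/
lemma exists_orthonormal (hA : A.PosDef) : ∃ e : ι → EuclideanSpace ℝ ι,
    (∀ a : ι → ℝ, wnorm A (∑ k, a k • e k) ^ 2 = ∑ k, a k ^ 2) ∧
    (∀ x, wnorm A⁻¹ x ^ 2 = ∑ k, inner ℝ x (e k) ^ 2) ∧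
    ∀ x, act A⁻¹ x = ∑ k, inner ℝ x (e k) • e k := by
  set b := hA.1.eigenvectorBasis
  set l := hA.1.eigenvalues
  have hl : ∀ k, 0 < l k := hA.eigenvalues_pos
  have hb : ∀ k, act A (b k) = l k • b k := fun k => by
    ext i
    exact congrFun (hA.1.mulVec_eigenvectorBasis k) i
  have hs : ∀ k, √(l k) ≠ 0 := fun k => (Real.sqrt_pos.mpr (hl k)).ne'
  have hAe : ∀ k, act A ((√(l k))⁻¹ • b k) = √(l k) • b k := fun k => by
    rw [act, map_smul, ← act, hb, smul_smul]
    congr 1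
    rw [inv_mul_eq_iff_eq_mul₀ (hs k), Real.mul_self_sqrt (hl k).le]
  have horth : ∀ j k, inner ℝ (b j) (b k) = if j = k then (1 : ℝ) else 0 :=
    orthonormal_iff_ite.mp b.orthonormal
  have hinv : ∀ x, act A⁻¹ x = ∑ k, inner ℝ x ((√(l k))⁻¹ • b k) • ((√(l k))⁻¹ • b k) := by
    intro x
    have : x = act A (∑ k, inner ℝ x ((√(l k))⁻¹ • b k) • ((√(l k))⁻¹ • b k)) := by
      rw [act, map_sum]
      conv_lhs => rw [← b.sum_repr' x]
      refine Finset.sum_congr rfl fun k _ => ?_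
      rw [map_smul, ← act, hAe, inner_smul_right, smul_smul, real_inner_comm]
      congr 1
      have := hs k
      field_simp
    conv_lhs => rw [this]
    rw [act_inv_act hA]
  refine ⟨fun k => (√(l k))⁻¹ • b k, fun a => ?_, fun x => ?_, hinv⟩
  · rw [wnorm_sq hA.posSemidef, act, map_sum, sum_inner]
    refine Finset.sum_congr rfl fun k _ => ?_
    rw [inner_sum, Finset.sum_eq_single k]
    · rw [map_smul, ← act, hAe]
      simp only [inner_smul_left, inner_smul_right, horth, RCLike.conj_to_real, if_true]
      have := hs k
      field_simp
    · intro j _ hj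
      rw [map_smul, ← act, hAe]
      simp only [inner_smul_left, inner_smul_right, horth, if_neg hj.symm, mul_zero]
    · simp
  · rw [wnorm_sq hA.inv.posSemidef, hinv, inner_sum]
    refine Finset.sum_congr rfl fun k _ => ?_
    rw [inner_smul_right, sq]

/-- Duality between the norms of `A` and of `A⁻¹`. -/
lemma inner_sq_le (hA : A.PosDef) (x v : EuclideanSpace ℝ ι) :
    inner ℝ x v ^ 2 ≤ wnorm A⁻¹ x ^ 2 * wnorm A v ^ 2 := by
  obtain ⟨e, he1, he2, he3⟩ := exists_orthonormal hA
  have hv : v = ∑ k, inner ℝ (act A v) (e k) • e k := by rw [← he3, act_inv_act hA]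
  conv_lhs => rw [hv]
  conv_rhs => rw [hv]
  rw [he1, he2, inner_sum]
  simp only [inner_smul_right]
  refine (le_of_eq ?_).trans (Finset.sum_mul_sq_le_sq_mul_sq Finset.univ _ _)
  congr 1
  exact Finset.sum_congr rfl fun k _ => mul_comm _ _

lemma abs_inner_le (hA : A.PosDef) (x v : EuclideanSpace ℝ ι) :
    |inner ℝ x v| ≤ wnorm A⁻¹ x * wnorm A v := by
  refine abs_le_of_sq_le_sq' ?_ (mul_nonneg (wnorm_nonneg _ _) (wnorm_nonneg _ _)) |> abs_le.mpr
  rw [mul_pow]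
  exact inner_sq_le hA x v

lemma wnorm_act_inv (hA : A.PosDef) (x : EuclideanSpace ℝ ι) :
    wnorm A (act A⁻¹ x) = wnorm A⁻¹ x := by
  rw [wnorm_eq, wnorm_eq, act_act_inv hA, real_inner_comm]

/-- A linear form dominated by a multiple of the `A`-norm has small `A⁻¹`-norm. -/
lemma wnorm_inv_le (hA : A.PosDef) {x : EuclideanSpace ℝ ι} {b : ℝ} (hb : 0 ≤ b)
    (hx : ∀ v, |inner ℝ x v| ≤ b * wnorm A v) : wnorm A⁻¹ x ≤ b := by
  have h := hx (act A⁻¹ x)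
  rw [wnorm_act_inv hA, ← wnorm_sq hA.inv.posSemidef, abs_of_nonneg (sq_nonneg _), sq] at h
  rcases (wnorm_nonneg A⁻¹ x).eq_or_lt with h0 | h0
  · rw [← h0]; exact hb
  · exact le_of_mul_le_mul_right h h0

/-- Taking inverses reverses the order of positive definite forms. -/
lemma wnorm_inv_sq_le {B : Matrix ι ι ℝ} (hA : A.PosDef) (hB : B.PosDef) {s : ℝ}
    (h : ∀ v, wnorm A v ^ 2 ≤ s * wnorm B v ^ 2) (x : EuclideanSpace ℝ ι) :
    wnorm B⁻¹ x ^ 2 ≤ s * wnorm A⁻¹ x ^ 2 := by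
  have h1 := inner_sq_le hA x (act B⁻¹ x)
  have h2 := h (act B⁻¹ x)
  rw [wnorm_act_inv hB] at h2
  rw [← wnorm_sq hB.inv.posSemidef] at h1
  have h3 : (wnorm B⁻¹ x ^ 2) ^ 2 ≤ (s * wnorm A⁻¹ x ^ 2) * wnorm B⁻¹ x ^ 2 := by
    refine h1.trans ((mul_le_mul_of_nonneg_left h2 (sq_nonneg _)).trans (le_of_eq (by ring)))
  rcases (sq_nonneg (wnorm B⁻¹ x)).eq_or_lt with h0 | h0
  · rw [← h0]
    by_contra hneg
    rw [not_le] at hneg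
    rcases (wnorm_nonneg A⁻¹ x).eq_or_lt with h4 | h4
    · simp [← h4] at hneg
    · have hx : x ≠ 0 := fun hx => by simp [hx, wnorm_zero] at h4
      have := wnorm_pos hB.inv hx
      exact absurd h0 (by positivity)
  · rw [sq] at h3
    exact le_of_mul_le_mul_right h3 h0

variable {T J : Type*} [Fintype T] [Fintype J]

/-- The Fisher information matrix: the sum over the trials of the covariance matrices of the feature
of the random choice. -/
def fisher (q : T → J → ℝ) (y : T → J → EuclideanSpace ℝ ι) : Matrix ι ι ℝ :=
  Matrix.of fun a b => ∑ m, wcov (q m) (fun c => y m c a) fun c => y m c b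

lemma dev_inner (q : J → ℝ) (y : J → EuclideanSpace ℝ ι) (v : EuclideanSpace ℝ ι) (c : J) :
    dev q (fun c => inner ℝ (y c) v) c = ∑ a, v a * dev q (fun c => y c a) c := by
  simp only [dev, wmean, PiLp.inner_apply, RCLike.inner_apply, RCLike.conj_to_real, mul_sub,
    Finset.sum_sub_distrib, Finset.mul_sum]
  congr 1
  rw [Finset.sum_comm]
  exact Finset.sum_congr rfl fun a _ => Finset.sum_congr rfl fun c _ => by ring

lemma wcov_inner (q : J → ℝ) (y : J → EuclideanSpace ℝ ι) (u v : EuclideanSpace ℝ ι) :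
    (wcov q (fun c => inner ℝ (y c) u) fun c => inner ℝ (y c) v)
      = ∑ a, ∑ b, u a * (wcov q (fun c => y c a) fun c => y c b) * v b := by
  simp only [wcov, wmean, dev_inner, Finset.sum_mul_sum]
  simp only [Finset.mul_sum, Finset.sum_mul]
  rw [Finset.sum_comm]
  refine Finset.sum_congr rfl fun a _ => ?_
  rw [Finset.sum_comm]
  refine Finset.sum_congr rfl fun b _ => Finset.sum_congr rfl fun c _ => ?_
  ring

lemma inner_act_fisher (q : T → J → ℝ) (y : T → J → EuclideanSpace ℝ ι)
    (u v : EuclideanSpace ℝ ι) : inner ℝ u (act (fisher q y) v)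
      = ∑ m, wcov (q m) (fun c => inner ℝ (y m c) u) fun c => inner ℝ (y m c) v := by
  rw [act, Matrix.inner_toEuclideanCLM]
  simp only [dotProduct, Matrix.mulVec, fisher, Matrix.of_apply, wcov_inner, Finset.mul_sum,
    Finset.sum_mul]
  conv_rhs => rw [Finset.sum_comm]
  refine Finset.sum_congr rfl fun a _ => ?_
  conv_rhs => rw [Finset.sum_comm]
  refine Finset.sum_congr rfl fun b _ => Finset.sum_congr rfl fun m _ => ?_
  ring

lemma fisher_posSemidef {q : T → J → ℝ} (hq : ∀ m c, 0 ≤ q m c)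
    (y : T → J → EuclideanSpace ℝ ι) : (fisher q y).PosSemidef := by
  refine Matrix.PosSemidef.of_dotProduct_mulVec_nonneg ?_ fun x => ?_
  · ext a b
    simp only [fisher, Matrix.conjTranspose_apply, Matrix.of_apply, star_trivial, wcov, mul_comm]
  · have h := inner_act_fisher q y (WithLp.toLp 2 x) (WithLp.toLp 2 x)
    rw [act, Matrix.inner_toEuclideanCLM] at h
    simp only [star_trivial] at *
    rw [h]
    exact Finset.sum_nonneg fun m _ => wcov_self_nonneg (hq m) _

lemma wnorm_fisher_sq {q : T → J → ℝ} (hq : ∀ m c, 0 ≤ q m c)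
    (y : T → J → EuclideanSpace ℝ ι) (v : EuclideanSpace ℝ ι) :
    wnorm (fisher q y) v ^ 2
      = ∑ m, wcov (q m) (fun c => inner ℝ (y m c) v) fun c => inner ℝ (y m c) v := by
  rw [wnorm_sq (fisher_posSemidef hq y), inner_act_fisher]

lemma fisher_posDef {q : T → J → ℝ} (hq : ∀ m c, 0 ≤ q m c)
    {y : T → J → EuclideanSpace ℝ ι} (h : IsUnit (fisher q y)) : (fisher q y).PosDef :=
  (fisher_posSemidef hq y).posDef_iff_isUnit.mpr h

/-- The deviation of the feature of the option `c` from the mean feature. -/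
def devVec (q : J → ℝ) (y : J → EuclideanSpace ℝ ι) (c : J) : EuclideanSpace ℝ ι :=
  y c - ∑ c', q c' • y c'

lemma inner_devVec (q : J → ℝ) (y : J → EuclideanSpace ℝ ι) (v : EuclideanSpace ℝ ι) (c : J) :
    inner ℝ (devVec q y c) v = dev q (fun c => inner ℝ (y c) v) c := by
  simp only [devVec, dev, wmean, inner_sub_left, sum_inner, inner_smul_left, RCLike.conj_to_real]

lemma wcov_eq_devVec (q : J → ℝ) (y : J → EuclideanSpace ℝ ι) (u v : EuclideanSpace ℝ ι) :
    (wcov q (fun c => inner ℝ (y c) u) fun c => inner ℝ (y c) v)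
      = wmean q fun c => inner ℝ (devVec q y c) u * inner ℝ (devVec q y c) v := by
  simp only [inner_devVec, wcov]

/-- If every feature has small `A⁻¹`-norm, then so has every centred feature. -/
lemma wnorm_devVec_le (hA : A.PosDef) {q : J → ℝ} (hq : q ∈ stdSimplex ℝ J)
    {y : J → EuclideanSpace ℝ ι} {b : ℝ} (hb : 0 ≤ b) (hy : ∀ c, q c ≠ 0 → wnorm A⁻¹ (y c) ≤ b)
    {c : J} (hc : q c ≠ 0) : wnorm A⁻¹ (devVec q y c) ≤ 2 * b := by
  refine wnorm_inv_le hA (by linarith) fun v => ?_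
  rw [inner_devVec, mul_assoc]
  exact abs_dev_le hq (fun c hc => (abs_inner_le hA _ _).trans
    (mul_le_mul_of_nonneg_right (hy c hc) (wnorm_nonneg _ _))) hc

/-- The centred features have total squared `H⁻¹`-norm equal to the dimension, `H` being the Fisher
information. -/
lemma sum_wnorm_devVec_sq {q : T → J → ℝ} (hq : ∀ m c, 0 ≤ q m c)
    {y : T → J → EuclideanSpace ℝ ι} (hH : (fisher q y).PosDef) :
    ∑ m, (wmean (q m) fun c => wnorm (fisher q y)⁻¹ (devVec (q m) (y m) c) ^ 2)
      = Fintype.card ι := by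
  obtain ⟨e, he1, he2, -⟩ := exists_orthonormal hH
  have h1 : ∀ k, wnorm (fisher q y) (e k) ^ 2 = 1 := fun k => by
    have := he1 (Pi.single k 1)
    simpa [Pi.single_apply, ite_pow] using this
  have h2 : ∑ k, wnorm (fisher q y) (e k) ^ 2 = Fintype.card ι := by simp [h1]
  rw [← h2]
  simp only [wnorm_fisher_sq hq, he2, wcov_eq_devVec]
  rw [Finset.sum_comm]
  refine Finset.sum_congr rfl fun m _ => ?_
  simp only [wmean, Finset.mul_sum]
  rw [Finset.sum_comm]
  exact Finset.sum_congr rfl fun a _ => Finset.sum_congr rfl fun c _ => by ring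

end Matrices

/-! ### Tail bounds for the score of independent choices -/

section Tails

variable {ι T J : Type*} [Fintype ι] [DecidableEq ι] [Fintype T] [DecidableEq T] [Fintype J]

/-- The joint law of independent choices with marginal laws `q m`. -/
def pathLaw (q : T → J → ℝ) (c : T → J) : ℝ := ∏ m, q m (c m)

lemma pathLaw_nonneg {q : T → J → ℝ} (hq : ∀ m, q m ∈ stdSimplex ℝ J) (c : T → J) :
    0 ≤ pathLaw q c := Finset.prod_nonneg fun m _ => (hq m).1 _

/-- Expectations of products of functions of independent choices factor. -/
lemma wmean_pathLaw_prod (q f : T → J → ℝ) :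
    (wmean (pathLaw q) fun c => ∏ m, f m (c m)) = ∏ m, wmean (q m) (f m) := by
  simp only [wmean, pathLaw, ← Finset.prod_mul_distrib]
  rw [Finset.prod_univ_sum, Fintype.piFinset_univ]

lemma pathLaw_mem {q : T → J → ℝ} (hq : ∀ m, q m ∈ stdSimplex ℝ J) :
    pathLaw q ∈ stdSimplex ℝ (T → J) := by
  refine ⟨pathLaw_nonneg hq, ?_⟩
  have := wmean_pathLaw_prod q fun _ _ => 1
  simpa [wmean, (hq _).2] using this

/-- Markov's inequality in indicator form. -/
lemma wmean_indicator_le {p : (T → J) → ℝ} (hp : ∀ c, 0 ≤ p c) {s : Set (T → J)}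
    {F : (T → J) → ℝ} (hF : ∀ c, 0 ≤ F c) (hs : ∀ c ∈ s, 1 ≤ F c) :
    wmean p (s.indicator fun _ => 1) ≤ wmean p F := by
  refine wmean_mono hp fun c _ => ?_
  by_cases hc : c ∈ s
  · rw [Set.indicator_of_mem hc]; exact hs c hc
  · rw [Set.indicator_of_notMem hc]; exact hF c

/-- The noise of the choices `c`: the sum over the trials of the centred features chosen. It is the
negative of the gradient of the negative log-likelihood at the true parameter. -/
def noise (q : T → J → ℝ) (y : T → J → EuclideanSpace ℝ ι) (c : T → J) : EuclideanSpace ℝ ι :=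
  ∑ m, devVec (q m) (y m) (c m)

/-- The noise is sub-Gaussian in every direction of moderate length. -/
lemma mgf_noise_le {q : T → J → ℝ} (hq : ∀ m, q m ∈ stdSimplex ℝ J)
    {y : T → J → EuclideanSpace ℝ ι} {w : EuclideanSpace ℝ ι}
    (hw : ∀ m c, q m c ≠ 0 → |inner ℝ (devVec (q m) (y m) c) w| ≤ 1) :
    (wmean (pathLaw q) fun c => Real.exp (inner ℝ (noise q y c) w))
      ≤ Real.exp (wnorm (fisher q y) w ^ 2) := by
  rw [wnorm_fisher_sq (fun m => (hq m).1), Real.exp_sum]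
  have e : (wmean (pathLaw q) fun c => Real.exp (inner ℝ (noise q y c) w))
      = ∏ m, wmean (q m) fun c => Real.exp (inner ℝ (devVec (q m) (y m) c) w) := by
    rw [← wmean_pathLaw_prod]
    refine wmean_congr fun c _ => ?_
    rw [noise, sum_inner, Real.exp_sum]
  rw [e]
  refine Finset.prod_le_prod
    (fun m _ => wmean_nonneg (hq m).1 fun c _ => (Real.exp_pos _).le) fun m _ => ?_
  refine le_trans ?_ (Real.add_one_le_exp _)
  set f : J → ℝ := fun c => inner ℝ (y m c) w with hf
  have h1 : (wmean (q m) fun c => (1 + dev (q m) f c) + dev (q m) f c * dev (q m) f c)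
      = wcov (q m) f f + 1 := by
    rw [wmean_add, wmean_add, wmean_const (hq m), wmean_dev (hq m), wcov]; ring
  rw [← h1]
  refine wmean_mono (hq m).1 fun c hc => ?_
  rw [inner_devVec, ← hf]
  have h2 := hw m c hc
  rw [inner_devVec, ← hf] at h2
  have := (abs_le.mp (Real.abs_exp_sub_one_sub_id_le h2)).2
  nlinarith

variable {q : T → J → ℝ} {y : T → J → EuclideanSpace ℝ ι} {b : ℝ}

lemma abs_inner_devVec_le (hq : ∀ m, q m ∈ stdSimplex ℝ J) (hH : (fisher q y).PosDef) (hb : 0 ≤ b)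
    (hy : ∀ m c, q m c ≠ 0 → wnorm (fisher q y)⁻¹ (y m c) ≤ b) (w : EuclideanSpace ℝ ι) {m : T}
    {c : J} (hc : q m c ≠ 0) :
    |inner ℝ (devVec (q m) (y m) c) w| ≤ 2 * b * wnorm (fisher q y) w :=
  (abs_inner_le hH _ _).trans
    (mul_le_mul_of_nonneg_right (wnorm_devVec_le hH (hq m) hb (hy m) hc) (wnorm_nonneg _ _))

lemma mgf_noise_le_of_wnorm_le (hq : ∀ m, q m ∈ stdSimplex ℝ J) (hH : (fisher q y).PosDef)
    (hb : 0 ≤ b) (hy : ∀ m c, q m c ≠ 0 → wnorm (fisher q y)⁻¹ (y m c) ≤ b)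
    {w : EuclideanSpace ℝ ι} {r : ℝ} (hr : 2 * b * r ≤ 1) (hw : wnorm (fisher q y) w ≤ r) :
    (wmean (pathLaw q) fun c => Real.exp (inner ℝ (noise q y c) w)) ≤ Real.exp (r ^ 2) := by
  refine (mgf_noise_le hq fun m c hc => ?_).trans
    (Real.exp_le_exp.mpr (pow_le_pow_left₀ (wnorm_nonneg _ _) hw 2))
  refine (abs_inner_devVec_le hq hH hb hy w hc).trans (le_trans ?_ hr)
  exact mul_le_mul_of_nonneg_left hw (by positivity)

/-- The sub-Gaussian bound for the coordinates of the one-step estimation error. -/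
lemma mgf_dual_le (hq : ∀ m, q m ∈ stdSimplex ℝ J) (hH : (fisher q y).PosDef)
    (hb : 0 ≤ b) (hy : ∀ m c, q m c ≠ 0 → wnorm (fisher q y)⁻¹ (y m c) ≤ b)
    {s : ℝ} (hs : 2 * b * |s| ≤ 1) (a : EuclideanSpace ℝ ι) :
    (wmean (pathLaw q) fun c =>
      Real.exp (s * (inner ℝ a (act (fisher q y)⁻¹ (noise q y c)) / wnorm (fisher q y)⁻¹ a)))
      ≤ Real.exp (s ^ 2) := by
  have h := mgf_noise_le_of_wnorm_le hq hH hb hy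
    (w := (s / wnorm (fisher q y)⁻¹ a) • act (fisher q y)⁻¹ a) hs ?_
  · rw [sq_abs] at h
    refine (le_of_eq (wmean_congr fun c _ => ?_)).trans h
    rw [inner_smul_right, ← inner_act_comm hH.inv.1, real_inner_comm]
    ring_nf
  · rw [wnorm_smul, wnorm_act_inv hH, abs_div, abs_of_nonneg (wnorm_nonneg _ _)]
    rcases eq_or_ne (wnorm (fisher q y)⁻¹ a) 0 with h | h
    · simp [h]
    · rw [div_mul_cancel₀ _ h]

/-- Tail bound for a single direction. -/
lemma tail_direction (hq : ∀ m, q m ∈ stdSimplex ℝ J) (hH : (fisher q y).PosDef)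
    (hb : 0 ≤ b) (hy : ∀ m c, q m c ≠ 0 → wnorm (fisher q y)⁻¹ (y m c) ≤ b)
    {s : ℝ} (hs0 : 0 ≤ s) (hs : b * s ≤ 1) (a : EuclideanSpace ℝ ι) :
    wmean (pathLaw q) ({c | s * wnorm (fisher q y)⁻¹ a
      < |inner ℝ a (act (fisher q y)⁻¹ (noise q y c))|}.indicator fun _ => 1)
      ≤ 2 * Real.exp (-(s ^ 2 / 4)) := by
  set X : (T → J) → ℝ :=
    fun c => inner ℝ a (act (fisher q y)⁻¹ (noise q y c)) / wnorm (fisher q y)⁻¹ a with hX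
  have h1 : (wmean (pathLaw q) fun c => Real.exp (s / 2 * X c)) ≤ Real.exp ((s / 2) ^ 2) :=
    mgf_dual_le hq hH hb hy (by rw [abs_of_nonneg (by linarith)]; linarith) a
  have h2 : (wmean (pathLaw q) fun c => Real.exp (-(s / 2) * X c)) ≤ Real.exp ((-(s / 2)) ^ 2) :=
    mgf_dual_le hq hH hb hy (by rw [abs_neg, abs_of_nonneg (by linarith)]; linarith) a
  refine (wmean_indicator_le (pathLaw_nonneg hq) (F := fun c =>
    Real.exp (-(s ^ 2 / 2)) * (Real.exp (s / 2 * X c) + Real.exp (-(s / 2) * X c)))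
    (fun c => by positivity) fun c hc => ?_).trans ?_
  · have hlt : s * wnorm (fisher q y)⁻¹ a < |inner ℝ a (act (fisher q y)⁻¹ (noise q y c))| := hc
    have hXs : s ≤ |X c| := by
      have hpos : 0 < wnorm (fisher q y)⁻¹ a := by
        refine wnorm_pos hH.inv fun h => ?_
        simp [h, wnorm_zero] at hlt
      rw [hX, abs_div, abs_of_pos hpos, le_div_iff₀ hpos]
      exact hlt.le
    rw [mul_add, ← Real.exp_add, ← Real.exp_add]
    rcases le_abs.mp hXs with h | h
    · have : 1 ≤ Real.exp (-(s ^ 2 / 2) + s / 2 * X c) := Real.one_le_exp (by nlinarith)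
      linarith [Real.exp_pos (-(s ^ 2 / 2) + -(s / 2) * X c)]
    · have : 1 ≤ Real.exp (-(s ^ 2 / 2) + -(s / 2) * X c) := Real.one_le_exp (by nlinarith)
      linarith [Real.exp_pos (-(s ^ 2 / 2) + s / 2 * X c)]
  · rw [wmean_const_mul, wmean_add]
    have e : Real.exp (-(s ^ 2 / 4)) = Real.exp (-(s ^ 2 / 2)) * Real.exp ((s / 2) ^ 2) := by
      rw [← Real.exp_add]; ring_nf
    have h3 : (-(s / 2)) ^ 2 = (s / 2) ^ 2 := by ring
    rw [h3] at h2
    rw [e]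
    nlinarith [Real.exp_pos (-(s ^ 2 / 2))]

lemma exp_sqrt_sub_one_le_cosh (t : ℝ) : Real.exp (√(1 + t ^ 2) - 1) ≤ Real.cosh t := by
  wlog ht : 0 ≤ t generalizing t
  · have := this (-t) (by linarith)
    rwa [neg_sq, Real.cosh_neg] at this
  set f : ℝ → ℝ := fun t => Real.cosh t * Real.exp (1 - √(1 + t ^ 2)) with hf
  have hd : ∀ t : ℝ, HasDerivAt f (Real.sinh t * Real.exp (1 - √(1 + t ^ 2))
      + Real.cosh t * (Real.exp (1 - √(1 + t ^ 2)) * -(2 * t / (2 * √(1 + t ^ 2))))) t := by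
    intro t
    have h1 : HasDerivAt (fun t : ℝ => 1 + t ^ 2) (2 * t) t := by
      simpa using (hasDerivAt_pow 2 t).const_add 1
    exact (Real.hasDerivAt_cosh t).mul ((h1.sqrt (by positivity)).const_sub 1).exp
  have hmono : MonotoneOn f (Set.Ici 0) := by
    refine monotoneOn_of_deriv_nonneg (convex_Ici 0)
      (fun t _ => (hd t).continuousAt.continuousWithinAt)
      (fun t _ => (hd t).differentiableAt.differentiableWithinAt) fun t ht => ?_
    rw [interior_Ici] at ht
    have ht0 : 0 < t := ht
    rw [(hd t).deriv]
    have hs : 0 < √(1 + t ^ 2) := Real.sqrt_pos.mpr (by positivity)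
    have hkey : Real.cosh t * t ≤ Real.sinh t * √(1 + t ^ 2) := by
      have hsin : t ≤ Real.sinh t := Real.self_le_sinh_iff.mpr ht0.le
      refine abs_le_of_sq_le_sq' ?_ (mul_nonneg (ht0.le.trans hsin) hs.le) |>.2
      rw [mul_pow, mul_pow, Real.sq_sqrt (by positivity), Real.cosh_sq]
      nlinarith
    have : Real.sinh t * Real.exp (1 - √(1 + t ^ 2))
        + Real.cosh t * (Real.exp (1 - √(1 + t ^ 2)) * -(2 * t / (2 * √(1 + t ^ 2))))
        = Real.exp (1 - √(1 + t ^ 2)) / √(1 + t ^ 2)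
          * (Real.sinh t * √(1 + t ^ 2) - Real.cosh t * t) := by
      field_simp
      ring
    rw [this]
    exact mul_nonneg (by positivity) (by linarith)
  have h := hmono (Set.mem_Ici.mpr le_rfl) (Set.mem_Ici.mpr ht) ht
  simp only [hf] at h
  norm_num at h
  have e : Real.exp (√(1 + t ^ 2) - 1) * Real.exp (1 - √(1 + t ^ 2)) = 1 := by
    rw [← Real.exp_add]; simp
  nlinarith [Real.exp_pos (√(1 + t ^ 2) - 1)]

/-- `√(1 + u) - 1` is subadditive, so that a product of hyperbolic cosines dominates the
exponential of the Euclidean norm. -/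
lemma exp_sqrt_sum_le_prod_cosh {κ : Type*} (s : Finset κ) (a : κ → ℝ) :
    Real.exp (√(1 + ∑ k ∈ s, a k ^ 2) - 1) ≤ ∏ k ∈ s, Real.cosh (a k) := by
  classical
  induction s using Finset.induction_on with
  | empty => simp
  | insert k s hk ih =>
    rw [Finset.sum_insert hk, Finset.prod_insert hk]
    refine le_trans ?_ (mul_le_mul (exp_sqrt_sub_one_le_cosh (a k)) ih (Real.exp_pos _).le
      (Real.cosh_pos _).le)
    rw [← Real.exp_add, Real.exp_le_exp]
    set u := a k ^ 2
    set v := ∑ k ∈ s, a k ^ 2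
    have hu : 0 ≤ u := sq_nonneg _
    have hv : 0 ≤ v := Finset.sum_nonneg fun k _ => sq_nonneg _
    have h1 := Real.sq_sqrt (show 0 ≤ 1 + u by linarith)
    have h2 := Real.sq_sqrt (show 0 ≤ 1 + v by linarith)
    have h3 := Real.sq_sqrt (show 0 ≤ 1 + (u + v) by linarith)
    have h4 : √(1 + (u + v)) ≤ √(1 + u) * √(1 + v) := by
      rw [← Real.sqrt_mul (by linarith)]
      exact Real.sqrt_le_sqrt (by nlinarith)
    have : (√(1 + (u + v)) + 1) ^ 2 ≤ (√(1 + u) + √(1 + v)) ^ 2 := by nlinarith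
    have := abs_le_of_sq_le_sq' this (by positivity) |>.2
    linarith

/-- Tail bound for the dual norm of the noise, by mixing the exponential bounds over the vertices
of a cube. -/
lemma tail_norm (hq : ∀ m, q m ∈ stdSimplex ℝ J) (hH : (fisher q y).PosDef)
    (hb : 0 ≤ b) (hy : ∀ m c, q m c ≠ 0 → wnorm (fisher q y)⁻¹ (y m c) ≤ b)
    {s : ℝ} (hs0 : 0 ≤ s) (hs : 2 * b * (s * √(Fintype.card ι)) ≤ 1) (R : ℝ) :
    wmean (pathLaw q) ({c | R < wnorm (fisher q y)⁻¹ (noise q y c)}.indicator fun _ => 1)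
      ≤ Real.exp (s ^ 2 * Fintype.card ι - s * R + 1) := by
  obtain ⟨e, he1, he2, -⟩ := exists_orthonormal hH
  let sgn : Bool → ℝ := fun β => cond β 1 (-1)
  have hsgn : ∀ β, sgn β ^ 2 = 1 := by intro β; cases β <;> simp [sgn]
  let coin : ι → Bool → ℝ := fun _ _ => 1 / 2
  have hcoin : ∀ k, coin k ∈ stdSimplex ℝ Bool := fun k => ⟨fun _ => by norm_num [coin], by
    norm_num [coin]⟩
  let w : (ι → Bool) → EuclideanSpace ℝ ι := fun σ => ∑ k, (s * sgn (σ k)) • e k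
  have hw : ∀ σ, wnorm (fisher q y) (w σ) ≤ s * √(Fintype.card ι) := fun σ => by
    refine abs_le_of_sq_le_sq' ?_ (by positivity) |>.2
    rw [he1, mul_pow, Real.sq_sqrt (by positivity)]
    simp only [mul_pow, hsgn, mul_one, Finset.sum_const, Finset.card_univ, nsmul_eq_mul]
    rw [mul_comm]
  -- averaging over the signs `σ` produces a product of hyperbolic cosines
  have hcosh : ∀ c, Real.exp (s * wnorm (fisher q y)⁻¹ (noise q y c) - 1)
      ≤ wmean (pathLaw coin) fun σ => Real.exp (inner ℝ (noise q y c) (w σ)) := by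
    intro c
    have h1 : (wmean (pathLaw coin) fun σ => Real.exp (inner ℝ (noise q y c) (w σ)))
        = ∏ k, Real.cosh (s * inner ℝ (noise q y c) (e k)) := by
      let f : ι → Bool → ℝ := fun k β => Real.exp (sgn β * (s * inner ℝ (noise q y c) (e k)))
      have h2 : ∀ σ, Real.exp (inner ℝ (noise q y c) (w σ)) = ∏ k, f k (σ k) := by
        intro σ
        simp only [w, f, inner_sum, inner_smul_right, Real.exp_sum]
        refine Finset.prod_congr rfl fun k _ => by ring_nf
      rw [wmean_congr fun σ _ => h2 σ, wmean_pathLaw_prod coin f]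
      refine Finset.prod_congr rfl fun k _ => ?_
      simp only [wmean, coin, f, Fintype.sum_bool, sgn, cond_true, cond_false, Real.cosh_eq]
      ring_nf
    rw [h1]
    refine le_trans ?_ (exp_sqrt_sum_le_prod_cosh _ _)
    rw [Real.exp_le_exp]
    simp only [mul_pow]
    rw [← Finset.mul_sum, ← he2]
    gcongr
    refine Real.le_sqrt_of_sq_le ?_
    rw [mul_pow]; linarith
  refine (wmean_indicator_le (pathLaw_nonneg hq) (F := fun c => Real.exp (-(s * R) + 1) *
    wmean (pathLaw coin) fun σ => Real.exp (inner ℝ (noise q y c) (w σ))) (fun c => ?_)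
    fun c hc => ?_).trans ?_
  · exact mul_nonneg (Real.exp_pos _).le
      (wmean_nonneg (pathLaw_nonneg hcoin) fun _ _ => (Real.exp_pos _).le)
  · have hlt : R < wnorm (fisher q y)⁻¹ (noise q y c) := hc
    have h1 : 1 ≤ Real.exp (-(s * R) + 1)
        * Real.exp (s * wnorm (fisher q y)⁻¹ (noise q y c) - 1) := by
      rw [← Real.exp_add]
      exact Real.one_le_exp (by nlinarith)
    exact h1.trans (mul_le_mul_of_nonneg_left (hcosh c) (Real.exp_pos _).le)
  · rw [wmean_const_mul]
    have hswap : (wmean (pathLaw q) fun c =>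
        wmean (pathLaw coin) fun σ => Real.exp (inner ℝ (noise q y c) (w σ)))
        = wmean (pathLaw coin) fun σ =>
          wmean (pathLaw q) fun c => Real.exp (inner ℝ (noise q y c) (w σ)) := by
      simp only [wmean, Finset.mul_sum]
      rw [Finset.sum_comm]
      exact Finset.sum_congr rfl fun σ _ => Finset.sum_congr rfl fun c _ => by ring
    have hbound : (wmean (pathLaw coin) fun σ =>
          wmean (pathLaw q) fun c => Real.exp (inner ℝ (noise q y c) (w σ)))
        ≤ Real.exp ((s * √(Fintype.card ι)) ^ 2) := by
      rw [← wmean_const (pathLaw_mem hcoin) (Real.exp ((s * √(Fintype.card ι)) ^ 2))]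
      exact wmean_mono (pathLaw_nonneg hcoin) fun σ _ =>
        mgf_noise_le_of_wnorm_le hq hH hb hy hs (hw σ)
    rw [hswap]
    refine (mul_le_mul_of_nonneg_left hbound (Real.exp_pos _).le).trans (le_of_eq ?_)
    rw [← Real.exp_add, mul_pow, Real.sq_sqrt (by positivity)]
    ring_nf

/-- Powers are dominated by exponentials, with the constant optimal for sub-Gaussian moments. -/
lemma pow_le_mul_exp_add_exp (x : ℝ) {k : ℕ} (hk : 1 ≤ k) :
    (x ^ 4) ^ k ≤ (64 * k ^ 2 * Real.exp (-4)) ^ k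
      * (Real.exp (√(2 * k) * x) + Real.exp (-√(2 * k) * x)) := by
  have hk0 : (0 : ℝ) < k := by exact_mod_cast hk
  set l := √(2 * k) with hl
  have hl0 : 0 < l := Real.sqrt_pos.mpr (by positivity)
  have hl2 : l ^ 2 = 2 * k := Real.sq_sqrt (by positivity)
  have h1 : l * |x| / (4 * k) ≤ Real.exp (l * |x| / (4 * k) - 1) := by
    have := Real.add_one_le_exp (l * |x| / (4 * k) - 1)
    linarith
  have h2 : (l * |x| / (4 * k)) ^ (4 * k) ≤ Real.exp (l * |x| - 4 * k) := by
    refine (pow_le_pow_left₀ (by positivity) h1 _).trans (le_of_eq ?_)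
    rw [← Real.exp_nat_mul]
    congr 1
    push_cast
    field_simp
  have h3 : (x ^ 4) ^ k = (64 * k ^ 2) ^ k * (l * |x| / (4 * k)) ^ (4 * k) := by
    rw [pow_mul, ← mul_pow]
    congr 1
    rw [div_pow, mul_pow, show |x| ^ 4 = x ^ 4 from by rw [show 4 = 2 * 2 from rfl, pow_mul, sq_abs,
      ← pow_mul], show l ^ 4 = (l ^ 2) ^ 2 from by ring, hl2]
    field_simp
    ring
  have h4 : Real.exp (l * |x|) ≤ Real.exp (l * x) + Real.exp (-l * x) := by
    rcases abs_cases x with ⟨h, -⟩ | ⟨h, -⟩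
    · rw [h]; linarith [Real.exp_pos (-l * x)]
    · rw [h]
      have : l * -x = -l * x := by ring
      rw [this]; linarith [Real.exp_pos (l * x)]
  have h5 : Real.exp (l * |x| - 4 * k) = Real.exp (-4) ^ k * Real.exp (l * |x|) := by
    rw [← Real.exp_nat_mul, ← Real.exp_add]; ring_nf
  rw [h3, mul_pow _ (Real.exp (-4)), mul_assoc]
  refine mul_le_mul_of_nonneg_left (h2.trans ?_) (by positivity)
  rw [h5]
  exact mul_le_mul_of_nonneg_left h4 (by positivity)

/-- The quartic form that controls the nonlinearity of the likelihood equations, at the one-step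
estimation error. -/
def quartic (q : T → J → ℝ) (y : T → J → EuclideanSpace ℝ ι) (c : T → J) : ℝ :=
  ∑ m, wmean (q m) fun c' =>
    inner ℝ (devVec (q m) (y m) c') (act (fisher q y)⁻¹ (noise q y c)) ^ 4

/-- Tail bound for the quartic form. A moment of order `L` is averaged, by Jensen's inequality, over
the directions `devVec`, in each of which the noise is sub-Gaussian. -/
lemma tail_quartic (hq : ∀ m, q m ∈ stdSimplex ℝ J) (hH : (fisher q y).PosDef)
    (hb : 0 ≤ b) (hy : ∀ m c, q m c ≠ 0 → wnorm (fisher q y)⁻¹ (y m c) ≤ b) {L : ℝ}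
    (hL : Real.log 2 ≤ L) (hbL : 144 ^ 2 * b ^ 2 * (Fintype.card ι * L) ≤ 1)
    (hbL' : 144 ^ 2 * b ^ 2 * L ≤ 1) :
    wmean (pathLaw q) ({c | L < quartic q y c}.indicator fun _ => 1) ≤ Real.exp (-L) / 3 := by
  have hL2 : 0.69 ≤ L := by linarith [Real.log_two_gt_d9]
  have hL0 : 0 < L := by linarith
  set M := (fisher q y)⁻¹ with hM
  set v : T → J → EuclideanSpace ℝ ι := fun m c => devVec (q m) (y m) c with hv
  set W : T × J → ℝ := fun i => q i.1 i.2 * wnorm M (v i.1 i.2) ^ 4 with hW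
  have hW0 : ∀ i, 0 ≤ W i := fun i => mul_nonneg ((hq _).1 _) (by positivity)
  set D := ∑ i, W i with hD
  have hD0 : 0 ≤ D := Finset.sum_nonneg fun i _ => hW0 i
  have hDle : D ≤ 4 * b ^ 2 * Fintype.card ι := by
    rw [← sum_wnorm_devVec_sq (fun m => (hq m).1) hH, hD, Fintype.sum_prod_type, Finset.mul_sum]
    refine Finset.sum_le_sum fun m _ => ?_
    rw [← wmean_const_mul]
    refine wmean_mono (hq m).1 (f := fun c => wnorm M (v m c) ^ 4) fun c hc => ?_
    have h1 := wnorm_devVec_le hH (hq m) hb (hy m) hc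
    have h2 := pow_le_pow_left₀ (wnorm_nonneg _ _) h1 2
    have : wnorm M (v m c) ^ 4 = wnorm M (v m c) ^ 2 * wnorm M (v m c) ^ 2 := by ring
    rw [this]
    refine mul_le_mul_of_nonneg_right (h2.trans (le_of_eq (by ring))) (sq_nonneg _)
  set X : T × J → (T → J) → ℝ :=
    fun i c => inner ℝ (v i.1 i.2) (act M (noise q y c)) / wnorm M (v i.1 i.2) with hX
  have hquart : ∀ c, quartic q y c = ∑ i, W i * X i c ^ 4 := by
    intro c
    rw [quartic, Fintype.sum_prod_type]
    refine Finset.sum_congr rfl fun m _ => Finset.sum_congr rfl fun c' _ => ?_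
    simp only [hW, hX]
    rcases (wnorm_nonneg M (v m c')).eq_or_lt with h0 | h0
    · have h1 := abs_inner_le hH (v m c') (act M (noise q y c))
      rw [← hM, ← h0, zero_mul] at h1
      have h2 : inner ℝ (v m c') (act M (noise q y c)) = 0 := abs_nonpos_iff.mp h1
      rw [h2, ← h0]; simp
    · rw [div_pow, mul_assoc, mul_div_cancel₀ _ (pow_ne_zero 4 h0.ne')]
  rcases hD0.eq_or_lt with hDz | hDpos
  · have hWz : ∀ i, W i = 0 := fun i =>
      (Finset.sum_eq_zero_iff_of_nonneg fun i _ => hW0 i).mp hDz.symm i (Finset.mem_univ i)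
    have : {c | L < quartic q y c} = ∅ := by
      ext c
      simp only [hquart, hWz, zero_mul, Finset.sum_const_zero, Set.mem_ofPred_eq,
        Set.mem_empty_iff_false, iff_false, not_lt]
      exact hL0.le
    rw [this, Set.indicator_empty]
    simp only [wmean, mul_zero, Finset.sum_const_zero]
    positivity
  -- the moment of order `k ≈ L` of the quartic form gives a tail of order `exp (-L)`
  set k := ⌈L⌉₊ with hk
  have hkL : L ≤ k := Nat.le_ceil L
  have hk1 : 1 ≤ k := Nat.ceil_pos.mpr hL0
  have hkL' : (k : ℝ) ≤ L + 1 := (Nat.ceil_lt_add_one hL0.le).le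
  have hk2 : (k : ℝ) ^ 2 ≤ 6 * L ^ 2 := by nlinarith
  -- the exponent `√(2 k)` minimizes `l ^ (-4 k) * exp (l ^ 2)`, the bound for that moment
  set l := √(2 * (k : ℝ)) with hl
  have hl2 : l ^ 2 = 2 * k := Real.sq_sqrt (by positivity)
  have hbl : 2 * b * l ≤ 1 := by
    refine abs_le_of_sq_le_sq' (b := 1) ?_ (by norm_num) |>.2
    rw [mul_pow, hl2, mul_pow, one_pow]
    nlinarith [sq_nonneg b]
  set A := 64 * (k : ℝ) ^ 2 * Real.exp (-4) with hA
  refine (wmean_indicator_le (pathLaw_nonneg hq) (F := fun c => (D / L) ^ k * A ^ k *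
    ∑ i, W i / D * (Real.exp (l * X i c) + Real.exp (-l * X i c))) (fun c => ?_)
    fun c hc => ?_).trans ?_
  · exact mul_nonneg (by positivity) (Finset.sum_nonneg fun i _ =>
      mul_nonneg (div_nonneg (hW0 i) hD0) (by positivity))
  · have hlt : L < quartic q y c := hc
    have h1 : 1 ≤ (quartic q y c / L) ^ k := one_le_pow₀ ((one_le_div hL0).mpr hlt.le)
    refine h1.trans ?_
    have h2 : quartic q y c / L = D / L * ∑ i, W i / D * X i c ^ 4 := by
      rw [hquart, Finset.mul_sum, Finset.sum_div]
      refine Finset.sum_congr rfl fun i _ => ?_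
      field_simp
    rw [h2, mul_pow, mul_assoc]
    refine mul_le_mul_of_nonneg_left ?_ (by positivity)
    refine (Real.pow_arith_mean_le_arith_mean_pow Finset.univ (fun i => W i / D) _
      (fun i _ => div_nonneg (hW0 i) hD0) ?_ (fun i _ => by positivity) k).trans ?_
    · rw [← Finset.sum_div, ← hD, div_self hDpos.ne']
    · rw [Finset.mul_sum]
      refine Finset.sum_le_sum fun i _ => ?_
      have := mul_le_mul_of_nonneg_left (pow_le_mul_exp_add_exp (X i c) hk1)
        (div_nonneg (hW0 i) hD0)
      refine this.trans (le_of_eq ?_)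
      rw [← hl, ← hA]; ring
  · rw [wmean_const_mul]
    have h1 : (wmean (pathLaw q) fun c =>
        ∑ i, W i / D * (Real.exp (l * X i c) + Real.exp (-l * X i c)))
        = ∑ i, W i / D * ((wmean (pathLaw q) fun c => Real.exp (l * X i c))
          + wmean (pathLaw q) fun c => Real.exp (-l * X i c)) := by
      simp only [← wmean_add, ← wmean_const_mul]
      simp only [wmean, Finset.mul_sum]
      exact Finset.sum_comm
    have h2 : (wmean (pathLaw q) fun c =>
        ∑ i, W i / D * (Real.exp (l * X i c) + Real.exp (-l * X i c)))
        ≤ 2 * Real.exp (2 * k) := by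
      rw [h1]
      have h3 : ∀ i, (wmean (pathLaw q) fun c => Real.exp (l * X i c)) ≤ Real.exp (2 * k) := by
        intro i
        rw [← hl2]
        exact mgf_dual_le hq hH hb hy (by rwa [abs_of_nonneg (Real.sqrt_nonneg _)]) _
      have h4 : ∀ i, (wmean (pathLaw q) fun c => Real.exp (-l * X i c)) ≤ Real.exp (2 * k) := by
        intro i
        rw [← hl2, ← neg_sq l]
        exact mgf_dual_le hq hH hb hy (by rwa [abs_neg, abs_of_nonneg (Real.sqrt_nonneg _)]) _
      calc _ ≤ ∑ i, W i / D * (2 * Real.exp (2 * k)) :=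
            Finset.sum_le_sum fun i _ => mul_le_mul_of_nonneg_left
              (by linarith [h3 i, h4 i]) (div_nonneg (hW0 i) hD0)
        _ = _ := by rw [← Finset.sum_mul, ← Finset.sum_div, ← hD, div_self hDpos.ne', one_mul]
    refine (mul_le_mul_of_nonneg_left h2 (by positivity)).trans ?_
    have h5 : (D / L) ^ k * A ^ k * (2 * Real.exp (2 * k))
        = 2 * (D / L * (64 * k ^ 2) * Real.exp (-2)) ^ k := by
      have : Real.exp (-2) = Real.exp (-4) * Real.exp 2 := by rw [← Real.exp_add]; norm_num
      rw [hA, this, mul_comm (2 : ℝ) (k : ℝ), Real.exp_nat_mul]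
      ring
    rw [h5]
    have h6 : D / L * (64 * k ^ 2) ≤ 1 / 6 := by
      rw [div_mul_eq_mul_div, div_le_iff₀ hL0]
      have h7 : D * L ≤ 4 / 144 ^ 2 := by nlinarith
      nlinarith
    have h8 : D / L * (64 * k ^ 2) * Real.exp (-2) ≤ 1 / 6 * Real.exp (-1) :=
      mul_le_mul h6 (Real.exp_le_exp.mpr (by norm_num)) (Real.exp_pos _).le (by norm_num)
    have h9 : (D / L * (64 * k ^ 2) * Real.exp (-2)) ^ k ≤ 1 / 6 * Real.exp (-L) := by
      refine (pow_le_pow_left₀ (by positivity) h8 k).trans ?_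
      rw [mul_pow]
      refine mul_le_mul (pow_le_of_le_one (by norm_num) (by norm_num) (by omega)) ?_
        (by positivity) (by norm_num)
      rw [← Real.exp_nat_mul]
      exact Real.exp_le_exp.mpr (by linarith)
    linarith

end Tails

/-! ### The log-partition function and its derivative -/

section LogPartition

variable {V J : Type*} [NormedAddCommGroup V] [InnerProductSpace ℝ V] [Fintype J]

/-- The gradient of the log-partition function is the mean feature under the tilted weights. -/
lemma hasFDerivAt_logPartition {a : J → ℝ} (ha : ∀ c, 0 ≤ a c) (ha' : 0 < ∑ c, a c) (y : J → V)
    (θ : V) : HasFDerivAt (fun θ => Real.log (wmean a fun c => Real.exp (inner ℝ (y c) θ)))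
      (∑ c, tilt a (fun c => inner ℝ (y c) θ) c • innerSL ℝ (y c)) θ := by
  have h1 : HasFDerivAt (fun θ => wmean a fun c => Real.exp (inner ℝ (y c) θ))
      (∑ c, a c • Real.exp (inner ℝ (y c) θ) • innerSL ℝ (y c)) θ := by
    unfold wmean
    refine HasFDerivAt.fun_sum fun c _ => ?_
    exact ((innerSL ℝ (y c)).hasFDerivAt (x := θ)).exp.const_mul (a c)
  convert h1.log (wmean_exp_pos ha ha' _).ne' using 1
  rw [Finset.smul_sum]
  refine Finset.sum_congr rfl fun c _ => ?_
  rw [smul_smul, smul_smul, tilt]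
  congr 1
  field_simp

/-- The log-partition function lies above its tangents. -/
lemma log_wmean_exp_tangent {q : J → ℝ} (hq : q ∈ stdSimplex ℝ J) (f h : J → ℝ) :
    Real.log (wmean q fun c => Real.exp (f c)) + wmean (tilt q f) h
      ≤ Real.log (wmean q fun c => Real.exp (f c + h c)) := by
  have h0 := wmean_exp_pos hq.1 (sum_pos_of_mem hq) f
  have h1 := wmean_exp_pos hq.1 (sum_pos_of_mem hq) fun c => f c + h c
  have h2 := wmean_le_log_wmean_exp (tilt_mem hq.1 (sum_pos_of_mem hq) f) h
  rw [wmean_tilt] at h2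
  conv_rhs at h2 => rw [wmean_tilt]
  simp only [← Real.exp_add] at h2
  rw [Real.log_div h1.ne' h0.ne', ← wmean_tilt] at h2
  linarith

lemma log_wmean_exp_smul_le {q : J → ℝ} (hq : q ∈ stdSimplex ℝ J) (f : J → ℝ) {s : ℝ}
    (hs0 : 0 ≤ s) (hs1 : s ≤ 1) :
    Real.log (wmean q fun c => Real.exp (s * f c))
      ≤ s * Real.log (wmean q fun c => Real.exp (f c)) := by
  have h1 := log_wmean_exp_tangent hq (fun c => s * f c) fun c => (1 - s) * f c
  have h2 := log_wmean_exp_tangent hq (fun c => s * f c) fun c => -s * f c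
  rw [wmean_const_mul] at h1 h2
  have e1 : ∀ c, s * f c + (1 - s) * f c = f c := fun c => by ring
  have e2 : ∀ c, s * f c + -s * f c = 0 := fun c => by ring
  simp only [e1] at h1
  simp only [e2, Real.exp_zero, wmean_const hq, Real.log_one] at h2
  nlinarith

end LogPartition

/-! ### Localization and accuracy of the maximum likelihood estimate -/

section Estimation

variable {ι T J : Type*} [Fintype ι] [DecidableEq ι] [Fintype T] [Fintype J]

/-- The increase of the negative log-likelihood of the choices `c` when the parameter moves by `Δ`
away from the parameter at which the choice probabilities are `q`. -/
def excess (q : T → J → ℝ) (y : T → J → EuclideanSpace ℝ ι) (c : T → J) (Δ : EuclideanSpace ℝ ι) :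
    ℝ :=
  ∑ m, (Real.log (wmean (q m) fun c' => Real.exp (inner ℝ (y m c') Δ)) - inner ℝ (y m (c m)) Δ)

variable {q : T → J → ℝ} {y : T → J → EuclideanSpace ℝ ι} {c : T → J} {b : ℝ}

lemma excess_zero (hq : ∀ m, q m ∈ stdSimplex ℝ J) : excess q y c 0 = 0 := by
  simp [excess, wmean, (hq _).2]

lemma inner_noise (q : T → J → ℝ) (y : T → J → EuclideanSpace ℝ ι) (c : T → J)
    (v : EuclideanSpace ℝ ι) : inner ℝ (noise q y c) v
      = ∑ m, (inner ℝ (y m (c m)) v - wmean (q m) fun c' => inner ℝ (y m c') v) := by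
  simp only [noise, sum_inner, inner_devVec, dev]

/-- Strong convexity of the negative log-likelihood near the true parameter. -/
lemma excess_lower (hq : ∀ m, q m ∈ stdSimplex ℝ J) (hH : (fisher q y).PosDef) (hb : 0 ≤ b)
    (hy : ∀ m c, q m c ≠ 0 → wnorm (fisher q y)⁻¹ (y m c) ≤ b) {Δ : EuclideanSpace ℝ ι}
    (hΔ : b * wnorm (fisher q y) Δ ≤ 1 / 8) :
    0.4 * wnorm (fisher q y) Δ ^ 2 - inner ℝ (noise q y c) Δ ≤ excess q y c Δ := by
  rw [wnorm_fisher_sq (fun m => (hq m).1), inner_noise, excess, Finset.mul_sum,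
    ← Finset.sum_sub_distrib]
  refine Finset.sum_le_sum fun m _ => ?_
  have := wmean_add_wcov_le_log (hq m) (f := fun c' => inner ℝ (y m c') Δ) fun c' hc' => by
    rw [← inner_devVec]
    refine (abs_inner_le hH _ _).trans ((mul_le_mul_of_nonneg_right
      (wnorm_devVec_le hH (hq m) hb (hy m) hc') (wnorm_nonneg _ _)).trans ?_)
    linarith
  linarith

lemma excess_smul_le (hq : ∀ m, q m ∈ stdSimplex ℝ J) (Δ : EuclideanSpace ℝ ι) {s : ℝ}
    (hs0 : 0 ≤ s) (hs1 : s ≤ 1) : excess q y c (s • Δ) ≤ s * excess q y c Δ := by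
  rw [excess, excess, Finset.mul_sum]
  refine Finset.sum_le_sum fun m _ => ?_
  simp only [inner_smul_right, mul_sub]
  exact sub_le_sub_right (log_wmean_exp_smul_le (hq m) _ hs0 hs1) _

/-- The negative log-likelihood exceeds its value at the true parameter outside a ball. -/
lemma excess_pos (hq : ∀ m, q m ∈ stdSimplex ℝ J) (hH : (fisher q y).PosDef) (hb : 0 ≤ b)
    (hy : ∀ m c, q m c ≠ 0 → wnorm (fisher q y)⁻¹ (y m c) ≤ b) {ρ : ℝ} (hρ : 0 < ρ)
    (hbρ : b * ρ ≤ 1 / 8) (hnoise : wnorm (fisher q y)⁻¹ (noise q y c) ≤ ρ / 3)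
    {Δ : EuclideanSpace ℝ ι} (hΔ : ρ ≤ wnorm (fisher q y) Δ) : 0 < excess q y c Δ := by
  set r := wnorm (fisher q y) Δ with hr
  have hr0 : 0 < r := hρ.trans_le hΔ
  have hs : wnorm (fisher q y) ((ρ / r) • Δ) = ρ := by
    rw [wnorm_smul, abs_of_pos (div_pos hρ hr0), ← hr, div_mul_cancel₀ _ hr0.ne']
  have h1 := excess_lower (c := c) hq hH hb hy (Δ := (ρ / r) • Δ) (by rw [hs]; exact hbρ)
  have h2 := abs_inner_le hH (noise q y c) ((ρ / r) • Δ)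
  rw [hs] at h1 h2
  have h3 := (abs_le.mp h2).2
  have h4 := mul_le_mul_of_nonneg_right hnoise hρ.le
  have h5 := excess_smul_le (c := c) (y := y) hq Δ (s := ρ / r) (by positivity)
    ((div_le_one hr0).mpr hΔ)
  have h6 : 0 < ρ / r * excess q y c Δ := by nlinarith
  exact pos_of_mul_pos_right h6 (by positivity)

lemma hasFDerivAt_excess (hq : ∀ m, q m ∈ stdSimplex ℝ J) (Δ : EuclideanSpace ℝ ι) :
    HasFDerivAt (excess q y c)
      (∑ m, (∑ c', tilt (q m) (fun c' => inner ℝ (y m c') Δ) c' • innerSL ℝ (y m c')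
        - innerSL ℝ (y m (c m)))) Δ := by
  unfold excess
  refine HasFDerivAt.fun_sum fun m _ => ?_
  exact (hasFDerivAt_logPartition (hq m).1 (sum_pos_of_mem (hq m)) (y m) Δ).sub
    (innerSL ℝ (y m (c m))).hasFDerivAt

/-- A minimizer exists. -/
lemma exists_excess_min (hq : ∀ m, q m ∈ stdSimplex ℝ J) (hH : (fisher q y).PosDef) (hb : 0 ≤ b)
    (hy : ∀ m c, q m c ≠ 0 → wnorm (fisher q y)⁻¹ (y m c) ≤ b) {ρ : ℝ} (hρ : 0 < ρ)
    (hbρ : b * ρ ≤ 1 / 8) (hnoise : wnorm (fisher q y)⁻¹ (noise q y c) ≤ ρ / 3) :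
    ∃ Δ, ∀ Δ', excess q y c Δ ≤ excess q y c Δ' := by
  obtain ⟨e, he1, -, he3⟩ := exists_orthonormal hH
  let F : EuclideanSpace ℝ ι → EuclideanSpace ℝ ι := fun a => ∑ k, a k • e k
  have hF : Continuous F := by
    refine continuous_finsetSum _ fun k _ => ?_
    exact (EuclideanSpace.proj k : EuclideanSpace ℝ ι →L[ℝ] ℝ).continuous.smul continuous_const
  have hcont : Continuous (excess q y c) :=
    continuous_iff_continuousAt.mpr fun Δ => (hasFDerivAt_excess hq Δ).continuousAt
  have hnorm : ∀ a, wnorm (fisher q y) (F a) ^ 2 = ‖a‖ ^ 2 := fun a => by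
    rw [he1, EuclideanSpace.real_norm_sq_eq]
  obtain ⟨a, -, ha⟩ := (isCompact_closedBall (0 : EuclideanSpace ℝ ι) ρ).exists_isMinOn
    ⟨0, Metric.mem_closedBall_self hρ.le⟩ (hcont.comp hF).continuousOn
  have ha0 : excess q y c (F a) ≤ 0 := by
    have := ha (Metric.mem_closedBall_self hρ.le)
    have h0 : F 0 = 0 := by simp [F]
    simpa [h0, excess_zero hq] using this
  refine ⟨F a, fun Δ' => ?_⟩
  by_cases hΔ : wnorm (fisher q y) Δ' ≤ ρ
  · have hrep : Δ' = F (WithLp.toLp 2 fun k => inner ℝ (act (fisher q y) Δ') (e k)) := by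
      simp only [F]
      rw [← he3, act_inv_act hH]
    rw [hrep] at hΔ ⊢
    refine ha ?_
    rw [mem_closedBall_zero_iff]
    refine le_trans (le_of_eq ?_) hΔ
    exact (pow_left_inj₀ (norm_nonneg _) (wnorm_nonneg _ _) two_ne_zero).mp (hnorm _).symm
  · exact ha0.trans (excess_pos hq hH hb hy hρ hbρ hnoise (not_le.mp hΔ).le).le

/-- At a minimizer the fitted mean features match the observed ones. -/
lemma score_eq_zero (hq : ∀ m, q m ∈ stdSimplex ℝ J) {Δ : EuclideanSpace ℝ ι}
    (hmin : ∀ Δ', excess q y c Δ ≤ excess q y c Δ') (v : EuclideanSpace ℝ ι) :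
    ∑ m, ((wmean (tilt (q m) fun c' => inner ℝ (y m c') Δ) fun c' => inner ℝ (y m c') v)
      - inner ℝ (y m (c m)) v) = 0 := by
  have h1 : IsLocalMin (excess q y c) Δ := Filter.Eventually.of_forall hmin
  have h2 := h1.hasFDerivAt_eq_zero (hasFDerivAt_excess hq Δ)
  have h3 := congrArg (fun f : EuclideanSpace ℝ ι →L[ℝ] ℝ => f v) h2
  simpa [wmean] using h3

/-- The estimation error is close to that of a single Newton step from the true parameter. The
nonlinearity of the likelihood equations is measured by fourth moments of the error along the
features; the error of the Newton step enters through `quartic`, and the rest is absorbed since the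
error is already known to be confined to a small ball. -/
lemma newton_error_le [DecidableEq T] (hq : ∀ m, q m ∈ stdSimplex ℝ J) (hH : (fisher q y).PosDef)
    (hb : 0 ≤ b) (hy : ∀ m c, q m c ≠ 0 → wnorm (fisher q y)⁻¹ (y m c) ≤ b) {ρ L : ℝ}
    (hbρ : b * ρ ≤ 15 / 144) {Δ : EuclideanSpace ℝ ι} (hΔ : wnorm (fisher q y) Δ ≤ ρ)
    (hmin : ∀ Δ', excess q y c Δ ≤ excess q y c Δ') (hquart : quartic q y c ≤ L)
    (x : EuclideanSpace ℝ ι) :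
    |inner ℝ x Δ - inner ℝ x (act (fisher q y)⁻¹ (noise q y c))|
      ≤ 9 * √L * wnorm (fisher q y)⁻¹ x := by
  set H := fisher q y with hHdef
  set z := noise q y c with hz
  set r := act H Δ - z with hr
  set Q : EuclideanSpace ℝ ι → ℝ :=
    fun v => ∑ m, wmean (q m) fun c' => inner ℝ (devVec (q m) (y m) c') v ^ 4 with hQ
  have hQ0 : ∀ v, 0 ≤ Q v := fun v =>
    Finset.sum_nonneg fun m _ => wmean_nonneg (hq m).1 fun c' _ => by positivity
  have hsmall : ∀ m c' v, q m c' ≠ 0 → |inner ℝ (devVec (q m) (y m) c') v| ≤ 2 * b * wnorm H v :=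
    fun m c' v hc' => (abs_inner_le hH _ _).trans
      (mul_le_mul_of_nonneg_right (wnorm_devVec_le hH (hq m) hb (hy m) hc') (wnorm_nonneg _ _))
  have hbΔ : b * wnorm H Δ ≤ 15 / 144 := (mul_le_mul_of_nonneg_left hΔ hb).trans hbρ
  -- the residual of the linearized likelihood equations is small
  have hres : ∀ v, inner ℝ r v ^ 2 ≤ wnorm H v ^ 2 * (5.125 * Q Δ) := by
    intro v
    have h1 : -inner ℝ r v = ∑ m, ((wmean (tilt (q m) fun c' => inner ℝ (y m c') Δ)
        fun c' => inner ℝ (y m c') v) - (wmean (q m) fun c' => inner ℝ (y m c') v)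
        - wcov (q m) (fun c' => inner ℝ (y m c') v) fun c' => inner ℝ (y m c') Δ) := by
      have h2 := score_eq_zero hq hmin v
      rw [Finset.sum_sub_distrib] at h2
      rw [Finset.sum_sub_distrib, Finset.sum_sub_distrib, ← inner_act_fisher, hr, inner_sub_left,
        hz, inner_noise, Finset.sum_sub_distrib, ← hHdef, real_inner_comm]
      linarith
    rw [← neg_sq, h1, hHdef, wnorm_fisher_sq (fun m => (hq m).1), hQ, Finset.mul_sum]
    refine Finset.sum_sq_le_sum_mul_sum_of_sq_le_mul _ (fun m _ => wcov_self_nonneg (hq m).1 _)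
      (fun m _ => ?_) fun m _ => ?_
    · exact mul_nonneg (by norm_num) (wmean_nonneg (hq m).1 fun c' _ => by positivity)
    · have := sq_tilt_expansion_error_le (hq m) (f := fun c' => inner ℝ (y m c') Δ)
        (fun c' hc' => ?_) fun c' => inner ℝ (y m c') v
      · simpa only [inner_devVec] using this
      · rw [← inner_devVec]
        exact (hsmall m c' Δ hc').trans (by linarith)
  set n := wnorm H⁻¹ r with hn
  have hn2 : n ^ 2 ≤ 5.125 * Q Δ := by
    have h1 : n ≤ √(5.125 * Q Δ) := wnorm_inv_le hH (Real.sqrt_nonneg _) fun v => by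
      have := Real.abs_le_sqrt (hres v)
      rwa [Real.sqrt_mul (sq_nonneg _), Real.sqrt_sq (wnorm_nonneg _ _), mul_comm] at this
    refine (pow_le_pow_left₀ (wnorm_nonneg _ _) h1 2).trans ?_
    rw [Real.sq_sqrt (mul_nonneg (by norm_num) (hQ0 Δ))]
  have hn0 : 0 ≤ n := wnorm_nonneg _ _
  have hQle : ∀ v, Q v ≤ 4 * b ^ 2 * wnorm H v ^ 4 := by
    intro v
    have h1 : 4 * b ^ 2 * wnorm H v ^ 4 = 4 * b ^ 2 * wnorm H v ^ 2 * wnorm H v ^ 2 := by ring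
    have h0 : wnorm H v ^ 2 = _ := wnorm_fisher_sq (fun m => (hq m).1) y v
    rw [h1]
    refine le_of_le_of_eq ?_ (congrArg (4 * b ^ 2 * wnorm H v ^ 2 * ·) h0.symm)
    rw [hQ, Finset.mul_sum]
    refine Finset.sum_le_sum fun m _ => ?_
    rw [wcov_eq_devVec, ← wmean_const_mul]
    refine wmean_mono (hq m).1 fun c' hc' => ?_
    have h2 := pow_le_pow_left₀ (abs_nonneg _) (hsmall m c' v hc') 2
    rw [sq_abs] at h2
    have h3 := mul_le_mul_of_nonneg_right h2 (sq_nonneg (inner ℝ (devVec (q m) (y m) c') v))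
    nlinarith
  have hdecomp : Δ = act H⁻¹ r + act H⁻¹ z := by
    rw [act, act, ← map_add, hr, sub_add_cancel, ← act, act_inv_act hH]
  have hsplit : Q Δ ≤ 8 * L + 32 * (b ^ 2 * n ^ 2) * n ^ 2 := by
    have h1 : Q Δ ≤ 8 * Q (act H⁻¹ r) + 8 * Q (act H⁻¹ z) := by
      simp only [hQ]
      rw [Finset.mul_sum, Finset.mul_sum, ← Finset.sum_add_distrib]
      refine Finset.sum_le_sum fun m _ => ?_
      rw [← wmean_const_mul, ← wmean_const_mul, ← wmean_add]
      refine wmean_mono (hq m).1 fun c' _ => ?_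
      conv_lhs => rw [hdecomp, inner_add_right]
      generalize (inner ℝ (devVec (q m) (y m) c') (act H⁻¹ r) : ℝ) = s
      generalize (inner ℝ (devVec (q m) (y m) c') (act H⁻¹ z) : ℝ) = t
      nlinarith [sq_nonneg (s ^ 2 - t ^ 2), sq_nonneg (s - t), sq_nonneg (s * t),
        mul_nonneg (sq_nonneg (s - t)) (sq_nonneg (s + t)),
        mul_nonneg (sq_nonneg (s - t)) (sq_nonneg (s - t)),
        mul_nonneg (sq_nonneg (s - t)) (add_nonneg (sq_nonneg s) (sq_nonneg t))]
    have h2 := hQle (act H⁻¹ r)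
    rw [wnorm_act_inv hH, ← hn] at h2
    have h3 : Q (act H⁻¹ z) ≤ L := hquart
    nlinarith
  -- a crude bound on the residual, enough to absorb its own contribution to the fourth moments
  have hbn : b ^ 2 * n ^ 2 ≤ 20.5 * (15 / 144) ^ 4 := by
    have h1 := hQle Δ
    have h2 : (b * wnorm H Δ) ^ 4 ≤ (15 / 144) ^ 4 :=
      pow_le_pow_left₀ (mul_nonneg hb (wnorm_nonneg _ _)) hbΔ 4
    have h3 : b ^ 2 * n ^ 2 ≤ b ^ 2 * (5.125 * (4 * b ^ 2 * wnorm H Δ ^ 4)) :=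
      mul_le_mul_of_nonneg_left (hn2.trans (by linarith)) (sq_nonneg b)
    nlinarith
  have hnL : n ^ 2 ≤ 81 * L := by
    have h1 := mul_le_mul_of_nonneg_right hbn (sq_nonneg n)
    norm_num at h1 hn2 ⊢
    have hL : 0 ≤ L := (hQ0 (act H⁻¹ z)).trans hquart
    nlinarith
  have hnL' : n ≤ 9 * √L := by
    rw [show (9 : ℝ) = √81 from by rw [show (81 : ℝ) = 9 ^ 2 from by norm_num,
      Real.sqrt_sq (by norm_num)], ← Real.sqrt_mul (by norm_num)]
    exact Real.le_sqrt_of_sq_le hnL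
  have hfin : inner ℝ x Δ - inner ℝ x (act H⁻¹ z) = inner ℝ x (act H⁻¹ r) := by
    conv_lhs => rw [hdecomp, inner_add_right]
    ring
  rw [hfin]
  refine (abs_inner_le hH _ _).trans ?_
  rw [wnorm_act_inv hH, mul_comm]
  exact mul_le_mul_of_nonneg_right hnL' (wnorm_nonneg _ _)

lemma exp_small_le {t : ℝ} (ht : t ≤ 15 / 144) : Real.exp (2 * t) ≤ 5 / 4 := by
  refine (Real.exp_le_exp.mpr (show 2 * t ≤ 5 / 24 by linarith)).trans ?_
  have h := Real.exp_bound (x := 5 / 24) (by norm_num [abs_of_pos]) (n := 3) (by norm_num)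
  have h2 := (abs_le.mp h).2
  simp only [Finset.sum_range_succ, Finset.sum_range_zero, Nat.factorial] at h2
  norm_num [abs_of_pos] at h2
  linarith

/-- The Fisher information varies little over the ball to which the estimate is confined. -/
lemma fisher_tilt_comparable (hq : ∀ m, q m ∈ stdSimplex ℝ J) (hH : (fisher q y).PosDef)
    (hy : ∀ m c, q m c ≠ 0 → wnorm (fisher q y)⁻¹ (y m c) ≤ b)
    {Δ : EuclideanSpace ℝ ι} (hΔ : b * wnorm (fisher q y) Δ ≤ 15 / 144) {H' : Matrix ι ι ℝ}
    (hH' : H' = fisher (fun m => tilt (q m) fun c' => inner ℝ (y m c') Δ) y) :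
    H'.PosDef ∧ ∀ x, wnorm (fisher q y)⁻¹ x ^ 2 ≤ 5 / 4 * wnorm H'⁻¹ x ^ 2 ∧
      wnorm H'⁻¹ x ^ 2 ≤ 5 / 4 * wnorm (fisher q y)⁻¹ x ^ 2 := by
  have ht : ∀ m, (tilt (q m) fun c' => inner ℝ (y m c') Δ) ∈ stdSimplex ℝ J := fun m =>
    tilt_mem (hq m).1 (sum_pos_of_mem (hq m)) _
  have hcmp : ∀ m c', tilt (q m) (fun c' => inner ℝ (y m c') Δ) c' ≤ 5 / 4 * q m c' ∧
      q m c' ≤ 5 / 4 * tilt (q m) (fun c' => inner ℝ (y m c') Δ) c' := fun m c' =>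
    tilt_le (hq m) (fun c'' hc'' => (abs_inner_le hH _ _).trans
      (mul_le_mul_of_nonneg_right (hy m c'' hc'') (wnorm_nonneg _ _))) (exp_small_le hΔ) c'
  have h1 : ∀ v, wnorm (fisher q y) v ^ 2 ≤ 5 / 4 * wnorm H' v ^ 2 := fun v => by
    rw [hH', wnorm_fisher_sq (fun m => (hq m).1), wnorm_fisher_sq (fun m => (ht m).1),
      Finset.mul_sum]
    exact Finset.sum_le_sum fun m _ => wcov_self_le_mul (hq m) (fun c' => (hcmp m c').2) _
  have h2 : ∀ v, wnorm H' v ^ 2 ≤ 5 / 4 * wnorm (fisher q y) v ^ 2 := fun v => by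
    rw [hH', wnorm_fisher_sq (fun m => (hq m).1), wnorm_fisher_sq (fun m => (ht m).1),
      Finset.mul_sum]
    exact Finset.sum_le_sum fun m _ => wcov_self_le_mul (ht m) (fun c' => (hcmp m c').1) _
  have hpsd : H'.PosSemidef := hH' ▸ fisher_posSemidef (fun m => (ht m).1) y
  have hpd : H'.PosDef := by
    refine Matrix.PosDef.of_dotProduct_mulVec_pos hpsd.1 fun x hx => ?_
    have hx' : WithLp.toLp 2 x ≠ 0 := fun h => hx (by simpa using congrArg WithLp.ofLp h)
    have h3 := pow_pos (wnorm_pos hH hx') 2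
    have h4 := h1 (WithLp.toLp 2 x)
    rw [wnorm_sq hpsd, act, Matrix.inner_toEuclideanCLM] at h4
    simp only [star_trivial]
    linarith
  exact ⟨hpd, fun x => ⟨wnorm_inv_sq_le hpd hH h2 x, wnorm_inv_sq_le hH hpd h1 x⟩⟩

end Estimation

/-! ### The likelihood of the choice model -/

section Hessian

variable {ι T J : Type*} [Fintype ι] [DecidableEq ι] [Fintype T] [Fintype J]

lemma tilt_eq_exp {a : J → ℝ} (ha : ∀ c, 0 ≤ a c) (ha' : 0 < ∑ c, a c) (f : J → ℝ) (c : J) :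
    tilt a f c = a c * Real.exp (f c - Real.log (wmean a fun c => Real.exp (f c))) := by
  rw [Real.exp_sub, Real.exp_log (wmean_exp_pos ha ha' f), tilt, mul_div_assoc]

lemma hasFDerivAt_tilt {V : Type*} [NormedAddCommGroup V] [InnerProductSpace ℝ V] {a : J → ℝ}
    (ha : ∀ c, 0 ≤ a c) (ha' : 0 < ∑ c, a c) (y : J → V) (c : J) (θ : V) :
    HasFDerivAt (fun θ => tilt a (fun c => inner ℝ (y c) θ) c)
      (tilt a (fun c => inner ℝ (y c) θ) c • (innerSL ℝ (y c)
        - ∑ c', tilt a (fun c => inner ℝ (y c) θ) c' • innerSL ℝ (y c'))) θ := by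
  have h := ((((innerSL ℝ (y c)).hasFDerivAt (x := θ)).sub
    (hasFDerivAt_logPartition ha ha' y θ)).exp.const_mul (a c))
  rw [smul_smul] at h
  simp only [tilt_eq_exp ha ha'] at h ⊢
  exact h

/-- The Hessian of a sum of log-partition functions, minus linear terms, is the Fisher
information. -/
lemma iteratedFDeriv_two_logPartition {a : T → J → ℝ} (ha : ∀ m c, 0 ≤ a m c)
    (ha' : ∀ m, 0 < ∑ c, a m c) (y : T → J → EuclideanSpace ℝ ι) (z : T → EuclideanSpace ℝ ι)
    (θ : EuclideanSpace ℝ ι) (i j : ι) :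
    iteratedFDeriv ℝ 2 (fun θ => ∑ m,
      (Real.log (wmean (a m) fun c => Real.exp (inner ℝ (y m c) θ)) - inner ℝ (z m) θ)) θ
      ![EuclideanSpace.single i 1, EuclideanSpace.single j 1]
      = fisher (fun m => tilt (a m) fun c => inner ℝ (y m c) θ) y i j := by
  set f : EuclideanSpace ℝ ι → ℝ := fun θ => ∑ m,
      (Real.log (wmean (a m) fun c => Real.exp (inner ℝ (y m c) θ)) - inner ℝ (z m) θ) with hf
  have h1 : fderiv ℝ f = fun θ => ∑ m, (∑ c, tilt (a m) (fun c => inner ℝ (y m c) θ) c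
      • innerSL ℝ (y m c) - innerSL ℝ (z m)) := by
    funext θ
    refine HasFDerivAt.fderiv (HasFDerivAt.fun_sum fun m _ => ?_)
    exact (hasFDerivAt_logPartition (ha m) (ha' m) (y m) θ).sub (innerSL ℝ (z m)).hasFDerivAt
  have h2 : HasFDerivAt (fderiv ℝ f) (∑ m, ∑ c, (tilt (a m) (fun c => inner ℝ (y m c) θ) c
      • (innerSL ℝ (y m c) - ∑ c', tilt (a m) (fun c => inner ℝ (y m c) θ) c'
        • innerSL ℝ (y m c'))).smulRight (innerSL ℝ (y m c))) θ := by
    rw [h1]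
    refine HasFDerivAt.fun_sum fun m _ => ?_
    refine HasFDerivAt.sub_const _ ?_
    refine HasFDerivAt.fun_sum fun c _ => ?_
    exact (hasFDerivAt_tilt (ha m) (ha' m) (y m) c θ).smul_const (innerSL ℝ (y m c))
  rw [iteratedFDeriv_two_apply, h2.fderiv, fisher, Matrix.of_apply]
  simp only [_root_.sum_apply, ContinuousLinearMap.smulRight_apply,
    _root_.smul_apply, _root_.sub_apply, innerSL_apply_apply,
    Matrix.cons_val_zero, Matrix.cons_val_one, EuclideanSpace.inner_single_right, smul_eq_mul,
    RCLike.conj_to_real, one_mul]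
  refine Finset.sum_congr rfl fun m _ => ?_
  rw [wcov_eq (tilt_mem (ha m) (ha' m) _)]
  refine Finset.sum_congr rfl fun c _ => ?_
  simp only [dev, wmean]
  ring

end Hessian

section Model

variable {n N d : ℕ}

/-- The augmented feature of an option in the situation of an observation; the no-purchase option
has the feature `0`. -/
def Observation.optVec (o : Observation N d) : Option (Fin N) → Aug d
  | none => 0
  | some j => augment (o.feature j) (o.price j)

/-- The indicator of the options available when the assortment `S` is offered. -/
def avail (S : Finset (Fin N)) : Option (Fin N) → ℝ
  | none => 1
  | some j => if j ∈ S then 1 else 0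

lemma avail_nonneg (S : Finset (Fin N)) (c : Option (Fin N)) : 0 ≤ avail S c := by
  cases c with
  | none => exact zero_le_one
  | some j => simp only [avail]; split_ifs <;> norm_num

lemma sum_avail_pos (S : Finset (Fin N)) : 0 < ∑ c, avail S c :=
  Finset.sum_pos' (fun c _ => avail_nonneg S c) ⟨none, Finset.mem_univ _, one_pos⟩

lemma prob_eq_tilt (o : Observation N d) (θ : Aug d) :
    o.prob θ = tilt (avail o.assortment) fun c => inner ℝ (o.optVec c) θ := by
  have hZ : (wmean (avail o.assortment) fun c => Real.exp (inner ℝ (o.optVec c) θ))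
      = 1 + ∑ j ∈ o.assortment, Real.exp (utility o.feature θ j (o.price j)) := by
    simp [wmean, Fintype.sum_option, avail, Observation.optVec, utility]
  funext c
  rw [tilt, hZ, Observation.prob, modelProb]
  cases c with
  | none => simp [choiceProb, avail, Observation.optVec]
  | some j =>
    simp only [choiceProb, avail, Observation.optVec, utility]
    split_ifs <;> simp

lemma prob_mem (o : Observation N d) (θ : Aug d) :
    o.prob θ ∈ stdSimplex ℝ (Option (Fin N)) := by
  rw [prob_eq_tilt]
  exact tilt_mem (avail_nonneg _) (sum_avail_pos _) _

lemma prob_ne_zero (o : Observation N d) (θ : Aug d) {c : Option (Fin N)} :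
    o.prob θ c ≠ 0 ↔ avail o.assortment c ≠ 0 := by
  rw [prob_eq_tilt]
  exact tilt_ne_zero (avail_nonneg _) (sum_avail_pos _) _

/-- The choice probabilities at a shifted parameter are tilts of those at the original one. -/
lemma prob_add (o : Observation N d) (θ Δ : Aug d) :
    o.prob (θ + Δ) = tilt (o.prob θ) fun c => inner ℝ (o.optVec c) Δ := by
  rw [prob_eq_tilt, prob_eq_tilt, tilt_tilt (avail_nonneg _) (sum_avail_pos _)]
  simp only [inner_add_right]

/-- All the choices in the dataset are available options. -/
def ValidChoices (D : Fin n → Observation N d) : Prop :=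
  ∀ m, avail (D m).assortment (D m).choice ≠ 0

/-- The Fisher information of a dataset. -/
def fisherInfo (D : Fin n → Observation N d) (θ : Aug d) :
    Matrix (Fin d ⊕ Fin d) (Fin d ⊕ Fin d) ℝ :=
  fisher (fun m => (D m).prob θ) fun m => (D m).optVec

lemma negLogLik_eq {D : Fin n → Observation N d} (hD : ValidChoices D) (θ : Aug d) :
    negLogLik D θ = ∑ m, (Real.log (wmean (avail (D m).assortment)
      fun c => Real.exp (inner ℝ ((D m).optVec c) θ)) - inner ℝ ((D m).optVec (D m).choice) θ) := by
  rw [negLogLik, ← Finset.sum_neg_distrib]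
  refine Finset.sum_congr rfl fun m _ => ?_
  have h1 : avail (D m).assortment (D m).choice = 1 := by
    have := hD m
    cases hc : (D m).choice with
    | none => rfl
    | some j =>
      rw [hc] at this
      simp only [avail] at this ⊢
      split_ifs at this ⊢ <;> simp_all
  rw [prob_eq_tilt, tilt_eq_exp (avail_nonneg _) (sum_avail_pos _), h1, one_mul, Real.log_exp]
  ring

lemma hessian_eq {D : Fin n → Observation N d} (hD : ValidChoices D) (θ : Aug d) :
    hessian D θ = fisherInfo D θ := by
  have h1 : negLogLik D = _ := funext fun θ => negLogLik_eq hD θ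
  ext i j
  rw [hessian, Matrix.of_apply, h1, iteratedFDeriv_two_logPartition
    (fun m => avail_nonneg (D m).assortment) (fun m => sum_avail_pos _), fisherInfo]
  simp only [prob_eq_tilt]

lemma negLogLik_add {D : Fin n → Observation N d} (hD : ValidChoices D) (θ Δ : Aug d) :
    negLogLik D (θ + Δ) = negLogLik D θ + excess (fun m => (D m).prob θ) (fun m => (D m).optVec)
      (fun m => (D m).choice) Δ := by
  rw [negLogLik_eq hD, negLogLik_eq hD, excess, ← Finset.sum_add_distrib]
  refine Finset.sum_congr rfl fun m _ => ?_
  set a := avail (D m).assortment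
  have h0 := wmean_exp_pos (avail_nonneg (D m).assortment) (sum_avail_pos _)
    fun c => inner ℝ ((D m).optVec c) θ
  have h1 := wmean_exp_pos (avail_nonneg (D m).assortment) (sum_avail_pos _)
    fun c => inner ℝ ((D m).optVec c) (θ + Δ)
  rw [prob_eq_tilt, wmean_tilt]
  simp only [← Real.exp_add, ← inner_add_right]
  rw [Real.log_div h1.ne' h0.ne', inner_add_right]
  ring

end Model

/-! ### Revenue maximization -/

section Revenue

variable {N : ℕ} {u u' : Fin N → ℝ} {S : Finset (Fin N)} {p : Fin N → ℝ}

lemma denom_pos (u : Fin N → ℝ) (S : Finset (Fin N)) : 0 < 1 + ∑ j ∈ S, Real.exp (u j) :=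
  add_pos_of_pos_of_nonneg one_pos (Finset.sum_nonneg fun _ _ => (Real.exp_pos _).le)

lemma revenue_eq (u : Fin N → ℝ) (S : Finset (Fin N)) (p : Fin N → ℝ) :
    revenue u S p = (∑ i ∈ S, p i * Real.exp (u i)) / (1 + ∑ j ∈ S, Real.exp (u j)) := by
  rw [revenue, Finset.sum_div]
  refine Finset.sum_congr rfl fun i hi => ?_
  rw [choiceProb, if_pos hi, mul_div_assoc]

lemma le_revenue_iff {r : ℝ} :
    r ≤ revenue u S p ↔ r ≤ ∑ i ∈ S, (p i - r) * Real.exp (u i) := by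
  rw [revenue_eq, le_div_iff₀ (denom_pos u S)]
  simp only [sub_mul, Finset.sum_sub_distrib, ← Finset.mul_sum]
  constructor <;> intro h <;> linarith

lemma sum_margin_eq (u : Fin N → ℝ) (S : Finset (Fin N)) (p : Fin N → ℝ) :
    ∑ i ∈ S, (p i - revenue u S p) * Real.exp (u i) = revenue u S p := by
  have h : revenue u S p * (1 + ∑ j ∈ S, Real.exp (u j)) = ∑ i ∈ S, p i * Real.exp (u i) := by
    rw [revenue_eq, div_mul_cancel₀ _ (denom_pos u S).ne']
  simp only [sub_mul, Finset.sum_sub_distrib, ← Finset.mul_sum]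
  linarith

lemma revenue_nonneg (hp : ∀ i ∈ S, 0 ≤ p i) : 0 ≤ revenue u S p := by
  rw [revenue_eq]
  exact div_nonneg (Finset.sum_nonneg fun i hi => mul_nonneg (hp i hi) (Real.exp_pos _).le)
    (denom_pos u S).le

/-- Raising the utilities of items priced above the revenue raises the revenue. -/
lemma revenue_mono (hp : ∀ i ∈ S, revenue u S p ≤ p i) (huu' : ∀ i ∈ S, u i ≤ u' i) :
    revenue u S p ≤ revenue u' S p := by
  rw [le_revenue_iff]
  conv_lhs => rw [← sum_margin_eq u S p]
  exact Finset.sum_le_sum fun i hi => mul_le_mul_of_nonneg_left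
    (Real.exp_le_exp.mpr (huu' i hi)) (sub_nonneg.mpr (hp i hi))

variable {w : Fin N → ℝ → ℝ} {K : ℕ} {I : Set ℝ}

lemma IsOptimalPair.revenue_nonneg (h : IsOptimalPair w K I S p) :
    0 ≤ revenue (fun i => w i (p i)) S p := by
  have := h.2 ∅ p (by simp) h.1.2
  simpa [revenue] using this

/-- An optimal assortment contains no item priced below the revenue, as dropping such an item would
raise the revenue. -/
lemma IsOptimalPair.revenue_le_price (h : IsOptimalPair w K I S p) {i : Fin N} (hi : i ∈ S) :
    revenue (fun i => w i (p i)) S p ≤ p i := by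
  set v : Fin N → ℝ := fun i => w i (p i) with hv
  set r := revenue v S p with hr
  by_contra! hlt
  have h1 := h.2 (S.erase i) p ((Finset.card_erase_le).trans h.1.1) h.1.2
  rw [← hv, ← hr] at h1
  have h2 := sum_margin_eq v S p
  rw [← hr, ← Finset.add_sum_erase S _ hi] at h2
  have h3 : (p i - r) * Real.exp (v i) < 0 := mul_neg_of_neg_of_pos (by linarith) (Real.exp_pos _)
  -- the margins `p j - r` of the remaining items add up to more than `r`
  set s := ∑ j ∈ S.erase i, (p j - r) * Real.exp (v j)
  have h4 : r < revenue v (S.erase i) p := by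
    rw [revenue_eq, lt_div_iff₀ (denom_pos v _)]
    have h5 : s = ∑ j ∈ S.erase i, p j * Real.exp (v j) - r * ∑ j ∈ S.erase i, Real.exp (v j) := by
      simp only [s, sub_mul, Finset.sum_sub_distrib, ← Finset.mul_sum]
    linarith
  linarith

/-- A maximizer over a compact price range exists. -/
lemma exists_isOptimalPair (hw : ∀ i, Continuous (w i)) (K : ℕ) {P : ℝ} (hP : 0 ≤ P) :
    ∃ S p, IsOptimalPair w K (Set.Icc 0 P) S p := by
  have hcompact : IsCompact (Set.univ.pi fun _ : Fin N => Set.Icc 0 P) :=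
    isCompact_univ_pi fun _ => isCompact_Icc
  have hne : (Set.univ.pi fun _ : Fin N => Set.Icc 0 P).Nonempty :=
    ⟨fun _ => 0, fun _ _ => ⟨le_rfl, hP⟩⟩
  have hcont : ∀ S : Finset (Fin N),
      Continuous fun p : Fin N → ℝ => revenue (fun i => w i (p i)) S p := by
    intro S
    simp only [revenue_eq]
    refine Continuous.div ?_ ?_ fun p => (denom_pos _ S).ne'
    · exact continuous_finsetSum _ fun i _ => (continuous_apply i).mul
        (Real.continuous_exp.comp ((hw i).comp (continuous_apply i)))
    · exact continuous_const.add (continuous_finsetSum _ fun i _ =>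
        Real.continuous_exp.comp ((hw i).comp (continuous_apply i)))
  choose p hpmem hp using fun S => hcompact.exists_isMaxOn hne (hcont S).continuousOn
  obtain ⟨S, hS, hmax⟩ := (Finset.univ.filter fun S : Finset (Fin N) => S.card ≤ K).exists_max_image
    (fun S => revenue (fun i => w i (p S i)) S (p S)) ⟨∅, by simp⟩
  refine ⟨S, p S, ⟨(Finset.mem_filter.mp hS).2, fun i => hpmem S i trivial⟩,
    fun S' p' hS' hp' => ?_⟩
  exact (hp S' (fun i _ => hp' i)).trans (hmax S' (by simp [hS']))

/-- Capping the prices loses no revenue: with utilities decreasing in the price at rates at least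
`L₀`, no item of an optimal pair gains from a price above `P`. -/
lemma exists_capped_prices {α β : Fin N → ℝ} {W L₀ P : ℝ} (hK : 1 ≤ K) (hW : 0 < W) (hL₀ : 0 < L₀)
    (hα : ∀ i, α i ≤ W) (hβ : ∀ i, L₀ ≤ β i) (hP : (3 + W + Real.log K) / L₀ ≤ P)
    (h : IsOptimalPair (fun i p => α i - β i * p) K Set.univ S p) :
    ∃ p' : Fin N → ℝ, (∀ i, p' i ∈ Set.Icc 0 P) ∧
      revenue (fun i => α i - β i * p i) S p ≤ revenue (fun i => α i - β i * p' i) S p' := by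
  set r := revenue (fun i => α i - β i * p i) S p with hr
  have hr0 : 0 ≤ r := h.revenue_nonneg
  have hpr : ∀ i ∈ S, r ≤ p i := fun i hi => h.revenue_le_price hi
  have hK0 : (0 : ℝ) < K := by exact_mod_cast hK
  have hlogK : 0 ≤ Real.log K := Real.log_nonneg (by exact_mod_cast hK)
  -- the optimal revenue is at most `(1 + W + log K) / L₀`
  have hrle : L₀ * r ≤ 1 + W + Real.log K := by
    by_contra! hlt
    have hterm : ∀ i ∈ S, (p i - r) * Real.exp (α i - β i * p i)
        ≤ Real.exp (W - L₀ * r) / L₀ := by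
      intro i hi
      have ht : 0 ≤ p i - r := sub_nonneg.mpr (hpr i hi)
      have h1 : L₀ * (p i - r) ≤ Real.exp (L₀ * (p i - r)) := by
        linarith [Real.add_one_le_exp (L₀ * (p i - r))]
      have h2 : α i - β i * p i ≤ (W - L₀ * r) - L₀ * (p i - r) := by
        nlinarith [hα i, hβ i, mul_le_mul_of_nonneg_right (hβ i) (hr0.trans (hpr i hi))]
      rw [le_div_iff₀ hL₀]
      calc (p i - r) * Real.exp (α i - β i * p i) * L₀
          ≤ (p i - r) * Real.exp ((W - L₀ * r) - L₀ * (p i - r)) * L₀ := by gcongr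
        _ = L₀ * (p i - r) * Real.exp (-(L₀ * (p i - r))) * Real.exp (W - L₀ * r) := by
            rw [sub_eq_add_neg (W - L₀ * r), Real.exp_add]; ring
        _ ≤ Real.exp (L₀ * (p i - r)) * Real.exp (-(L₀ * (p i - r))) * Real.exp (W - L₀ * r) := by
            gcongr
        _ = Real.exp (W - L₀ * r) := by rw [← Real.exp_add]; simp
    have hsum := Finset.sum_le_sum hterm
    rw [hr, sum_margin_eq, ← hr, Finset.sum_const, nsmul_eq_mul] at hsum
    have hcard : (S.card : ℝ) ≤ K := by exact_mod_cast h.1.1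
    have h3 : L₀ * r ≤ K * Real.exp (W - L₀ * r) := by
      have h4 : (S.card : ℝ) * (Real.exp (W - L₀ * r) / L₀) ≤ K * (Real.exp (W - L₀ * r) / L₀) := by
        gcongr
      have h5 := mul_le_mul_of_nonneg_left (hsum.trans h4) hL₀.le
      refine h5.trans (le_of_eq ?_)
      field_simp
    have h6 : K * Real.exp (W - L₀ * r) ≤ 1 := by
      have : (K : ℝ) = Real.exp (Real.log K) := (Real.exp_log hK0).symm
      rw [this, ← Real.exp_add]
      exact Real.exp_le_one_iff.mpr (by linarith)
    linarith
  have hPr : 1 ≤ L₀ * (P - r) := by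
    rw [div_le_iff₀ hL₀] at hP
    nlinarith
  have hP0 : 0 < P - r := by
    by_contra! hneg
    nlinarith
  refine ⟨fun i => if p i ∈ Set.Icc 0 P then p i else P, fun i => ?_, ?_⟩
  · dsimp only
    split_ifs with hi
    · exact hi
    · exact ⟨by linarith, le_rfl⟩
  · rw [le_revenue_iff]
    conv_lhs => rw [hr, ← sum_margin_eq]
    rw [← hr]
    refine Finset.sum_le_sum fun i hi => ?_
    dsimp only
    split_ifs with hmem
    · exact le_rfl
    -- beyond `P` the margin times the attraction value is decreasing
    have hpP : P < p i := by
      by_contra! hle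
      exact hmem ⟨hr0.trans (hpr i hi), hle⟩
    have hb : 0 < β i := hL₀.trans_le (hβ i)
    have h1 : (p i - r) ≤ (P - r) * Real.exp (β i * (p i - P)) := by
      have h2 : 1 ≤ β i * (P - r) := hPr.trans (mul_le_mul_of_nonneg_right (hβ i) hP0.le)
      have h3 := Real.add_one_le_exp (β i * (p i - P))
      have h4 := mul_le_mul_of_nonneg_left h3 hP0.le
      nlinarith
    have h5 : α i - β i * P = (α i - β i * p i) + β i * (p i - P) := by ring
    rw [h5, Real.exp_add]
    have := mul_le_mul_of_nonneg_right h1 (Real.exp_pos (α i - β i * p i)).le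
    linarith

/-- The loss of revenue caused by lowering the utilities by at most `w`. The first-order term
carries the factor `q_j q_0` since the margins, weighted by the attraction values, add up to the
revenue. -/
lemma revenue_sub_le {w : Fin N → ℝ} {P B : ℝ} (hw0 : ∀ i ∈ S, 0 ≤ w i)
    (hu' : ∀ i ∈ S, u i - w i ≤ u' i)
    (hpr : ∀ i ∈ S, revenue u S p ≤ p i) (hp0 : ∀ i ∈ S, 0 ≤ p i) (hpP : ∀ i ∈ S, p i ≤ P)
    (hP : 0 ≤ P) (hB0 : 0 ≤ B) (hB : ∀ i ∈ S, w i ^ 2 ≤ B) :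
    revenue u S p - revenue u' S p ≤ P * (3 *
      √(∑ j ∈ S, choiceProb u S (some j) * choiceProb u S none * w j ^ 2) + B) := by
  set r := revenue u S p with hr
  set r' := revenue u' S p with hr'
  have hr0 : 0 ≤ r := revenue_nonneg hp0
  have hr'0 : 0 ≤ r' := revenue_nonneg hp0
  have hrP : r ≤ P := by
    rcases S.eq_empty_or_nonempty with hS | ⟨i, hi⟩
    · simpa [hr, hS, revenue] using hP
    · exact (hpr i hi).trans (hpP i hi)
  set A := ∑ j ∈ S, choiceProb u S (some j) * choiceProb u S none * w j ^ 2 with hA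
  by_cases hbig : ∃ i ∈ S, 1 < w i
  · obtain ⟨i, hi, hwi⟩ := hbig
    have h1 : 1 ≤ B := by nlinarith [hB i hi]
    have h2 : P * 1 ≤ P * (3 * √A + B) :=
      mul_le_mul_of_nonneg_left (by linarith [Real.sqrt_nonneg A]) hP
    linarith
  · push Not at hbig
    set Z := 1 + ∑ j ∈ S, Real.exp (u j) with hZ
    set Z' := 1 + ∑ j ∈ S, Real.exp (u' j) with hZ'
    have hZ0 : 0 < Z := denom_pos u S
    have hZ'0 : 0 < Z' := denom_pos u' S
    set E := ∑ j ∈ S, (p j - r) * (Real.exp (u j) * w j) with hE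
    have ht : ∀ j ∈ S, 0 ≤ p j - r := fun j hj => sub_nonneg.mpr (hpr j hj)
    have hE0 : 0 ≤ E := Finset.sum_nonneg fun j hj =>
      mul_nonneg (ht j hj) (mul_nonneg (Real.exp_pos _).le (hw0 j hj))
    have hdiff : (r - r') * Z' ≤ E := by
      have h1 : r' * Z' = ∑ i ∈ S, p i * Real.exp (u' i) := by
        rw [hr', revenue_eq, div_mul_cancel₀ _ hZ'0.ne']
      have h2 : (r - r') * Z' = ∑ j ∈ S, (p j - r) * (Real.exp (u j) - Real.exp (u' j)) := by
        have h3 := sum_margin_eq u S p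
        rw [← hr] at h3
        simp only [mul_sub, Finset.sum_sub_distrib]
        rw [h3, sub_mul, h1, hZ', mul_add]
        simp only [sub_mul, Finset.sum_sub_distrib, ← Finset.mul_sum]
        ring
      rw [h2]
      refine Finset.sum_le_sum fun j hj => mul_le_mul_of_nonneg_left ?_ (ht j hj)
      have h4 : Real.exp (u j) * Real.exp (-w j) ≤ Real.exp (u' j) := by
        rw [← Real.exp_add]
        exact Real.exp_le_exp.mpr (by linarith [hu' j hj])
      have h5 := Real.add_one_le_exp (-w j)
      have h6 := mul_le_mul_of_nonneg_left h5 (Real.exp_pos (u j)).le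
      linarith
    have hZZ' : Z ≤ 3 * Z' := by
      rw [hZ, hZ', mul_add, Finset.mul_sum]
      refine add_le_add (by norm_num) (Finset.sum_le_sum fun j hj => ?_)
      have h1 : Real.exp (u j) ≤ Real.exp 1 * Real.exp (u' j) := by
        rw [← Real.exp_add]
        exact Real.exp_le_exp.mpr (by linarith [hu' j hj, hbig j hj])
      have h2 : Real.exp 1 ≤ 3 := by linarith [Real.exp_one_lt_d9]
      exact h1.trans (mul_le_mul_of_nonneg_right h2 (Real.exp_pos _).le)
    have hAeq : A * Z ^ 2 = ∑ j ∈ S, Real.exp (u j) * w j ^ 2 := by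
      rw [hA, Finset.sum_mul]
      refine Finset.sum_congr rfl fun j hj => ?_
      simp only [choiceProb, if_pos hj]
      rw [← hZ]
      field_simp
    have hA0 : 0 ≤ A := by
      have : 0 ≤ A * Z ^ 2 := by
        rw [hAeq]
        exact Finset.sum_nonneg fun j _ => by positivity
      exact nonneg_of_mul_nonneg_left this (by positivity)
    have hEsq : E ^ 2 ≤ P ^ 2 * (A * Z ^ 2) := by
      have h1 : ∀ j ∈ S, ((p j - r) * (Real.exp (u j) * w j)) ^ 2
          ≤ ((p j - r) ^ 2 * Real.exp (u j)) * (Real.exp (u j) * w j ^ 2) := fun j _ => by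
        nlinarith
      refine (Finset.sum_sq_le_sum_mul_sum_of_sq_le_mul S (fun j _ => by positivity)
        (fun j _ => by positivity) h1).trans ?_
      rw [hAeq]
      refine mul_le_mul_of_nonneg_right ?_ (Finset.sum_nonneg fun j _ => by positivity)
      have h2 : ∑ j ∈ S, (p j - r) ^ 2 * Real.exp (u j)
          ≤ ∑ j ∈ S, P * ((p j - r) * Real.exp (u j)) := by
        refine Finset.sum_le_sum fun j hj => ?_
        rw [sq, mul_assoc]
        exact mul_le_mul_of_nonneg_right (by linarith [hpP j hj])
          (mul_nonneg (ht j hj) (Real.exp_pos _).le)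
      rw [← Finset.mul_sum, hr, sum_margin_eq, ← hr] at h2
      nlinarith
    have hEle : E ≤ P * √A * Z := by
      refine abs_le_of_sq_le_sq' ?_ (by positivity) |>.2
      rw [mul_pow, mul_pow, Real.sq_sqrt hA0]
      linarith
    have hmain : r - r' ≤ P * (3 * √A) := by
      have h1 : (r - r') * Z' ≤ P * (3 * √A) * Z' := by
        refine hdiff.trans (hEle.trans ?_)
        have := mul_le_mul_of_nonneg_left hZZ' (mul_nonneg hP (Real.sqrt_nonneg A))
        linarith
      exact le_of_mul_le_mul_right h1 hZ'0
    have := mul_nonneg hP hB0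
    linarith

end Revenue

/-! ### The favourable choices -/

section Good

variable {ι T J κ : Type*} [Fintype ι] [DecidableEq ι] [Fintype T] [DecidableEq T] [Fintype J]
  [Fintype κ]

/-- For each `k`, two vectors spanning the same plane as `x k` and `x' k` that are orthogonal with
respect to `M` (Gram–Schmidt; the division by zero for `x k = 0` is harmless). -/
def orthoPair (M : Matrix ι ι ℝ) (x x' : κ → EuclideanSpace ℝ ι) : κ × Bool → EuclideanSpace ℝ ι
  | (k, false) => x k
  | (k, true) => x' k - (inner ℝ (x' k) (act M (x k)) / inner ℝ (x k) (act M (x k))) • x k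

/-- The choices on which the estimate is accurate: they are available, the noise is bounded in the
dual norm of the Fisher information and in the directions `orthoPair`, and the quartic form is
bounded. -/
def goodChoices (q : T → J → ℝ) (y : T → J → EuclideanSpace ℝ ι) (x x' : κ → EuclideanSpace ℝ ι)
    (L : ℝ) : Set (T → J) :=
  {c | (∀ m, q m (c m) ≠ 0) ∧
    wnorm (fisher q y)⁻¹ (noise q y c) ≤ 5 * √(Fintype.card ι * L) ∧
    (∀ k, |inner ℝ (orthoPair (fisher q y)⁻¹ x x' k) (act (fisher q y)⁻¹ (noise q y c))|
      ≤ 5 * √L * wnorm (fisher q y)⁻¹ (orthoPair (fisher q y)⁻¹ x x' k)) ∧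
    quartic q y c ≤ L}

variable {q : T → J → ℝ} {y : T → J → EuclideanSpace ℝ ι} {b L δ : ℝ}

lemma wmean_unavailable (q : T → J → ℝ) :
    wmean (pathLaw q) ({c | ∀ m, q m (c m) ≠ 0}ᶜ.indicator fun _ => 1) ≤ 0 := by
  refine le_of_eq (Finset.sum_eq_zero fun c _ => ?_)
  by_cases hc : ∀ m, q m (c m) ≠ 0
  · rw [Set.indicator_of_notMem (by simpa using hc), mul_zero]
  · push Not at hc
    obtain ⟨m, hm⟩ := hc
    rw [pathLaw, Finset.prod_eq_zero (Finset.mem_univ m) hm, zero_mul]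

/-- Choices are favourable except with small probability. -/
lemma wmean_bad_le (x x' : κ → EuclideanSpace ℝ ι) (hq : ∀ m, q m ∈ stdSimplex ℝ J)
    (hH : (fisher q y).PosDef)
    (hb : 0 ≤ b) (hy : ∀ m c, q m c ≠ 0 → wnorm (fisher q y)⁻¹ (y m c) ≤ b)
    (hL : Real.log 2 ≤ L) (hι : 1 ≤ Fintype.card ι) (hκ : 1 ≤ Fintype.card κ)
    (hbL : 144 ^ 2 * b ^ 2 * (Fintype.card ι * L) ≤ 1)
    (hδ : Fintype.card κ * Real.exp (-L) ≤ δ) :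
    wmean (pathLaw q) ((goodChoices q y x x' L)ᶜ.indicator fun _ => 1) ≤ δ := by
  have hL2 : 0.69 ≤ L := by linarith [Real.log_two_gt_d9]
  have hL0 : 0 < L := by linarith
  have hι' : (1 : ℝ) ≤ Fintype.card ι := by exact_mod_cast hι
  have hκ' : (1 : ℝ) ≤ Fintype.card κ := by exact_mod_cast hκ
  have hbL' : 144 ^ 2 * b ^ 2 * L ≤ 1 := by
    refine le_trans ?_ hbL
    exact mul_le_mul_of_nonneg_left (by nlinarith) (by positivity)
  have hbs : b * √L ≤ 1 / 144 := by
    refine abs_le_of_sq_le_sq' ?_ (by norm_num) |>.2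
    rw [mul_pow, Real.sq_sqrt hL0.le]
    linarith
  set M := (fisher q y)⁻¹ with hM
  set s1 : Set (T → J) := {c | ∀ m, q m (c m) ≠ 0}ᶜ with hs1
  set s2 : Set (T → J) := {c | 5 * √(Fintype.card ι * L) < wnorm M (noise q y c)} with hs2
  set s3 : κ × Bool → Set (T → J) := fun k => {c | 5 * √L * wnorm M (orthoPair M x x' k)
    < |inner ℝ (orthoPair M x x' k) (act M (noise q y c))|} with hs3
  set s4 : Set (T → J) := {c | L < quartic q y c} with hs4
  set F : Set (T → J) → ℝ := fun s => wmean (pathLaw q) (s.indicator fun _ => 1) with hF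
  have hunion : F (goodChoices q y x x' L)ᶜ ≤ F s1 + F s2 + ∑ k, F (s3 k) + F s4 := by
    have h0 : ∀ (s : Set (T → J)) c, 0 ≤ s.indicator (fun _ => (1 : ℝ)) c := fun s c =>
      Set.indicator_nonneg (fun _ _ => zero_le_one) c
    have h1 : F s1 + F s2 + ∑ k, F (s3 k) + F s4 = wmean (pathLaw q) fun c =>
        s1.indicator (fun _ => 1) c + s2.indicator (fun _ => 1) c
          + ∑ k, (s3 k).indicator (fun _ => 1) c + s4.indicator (fun _ => 1) c := by
      have : ∑ k, F (s3 k)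
          = wmean (pathLaw q) fun c => ∑ k, (s3 k).indicator (fun _ => (1 : ℝ)) c := by
        simp only [hF, wmean, Finset.mul_sum]
        exact Finset.sum_comm
      rw [this, wmean_add, wmean_add, wmean_add]
    rw [h1]
    refine wmean_indicator_le (pathLaw_nonneg hq) (fun c => ?_) fun c hc => ?_
    · exact add_nonneg (add_nonneg (add_nonneg (h0 _ _) (h0 _ _))
        (Finset.sum_nonneg fun k _ => h0 _ _)) (h0 _ _)
    · have hsum : 0 ≤ ∑ k, (s3 k).indicator (fun _ => (1 : ℝ)) c :=
        Finset.sum_nonneg fun k _ => h0 _ _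
      have h4 := h0 s4 c
      have h2 := h0 s2 c
      have h1 := h0 s1 c
      by_cases c1 : c ∈ s1
      · have := Set.indicator_of_mem c1 fun _ => (1 : ℝ)
        linarith
      by_cases c2 : c ∈ s2
      · have := Set.indicator_of_mem c2 fun _ => (1 : ℝ)
        linarith
      by_cases c4 : c ∈ s4
      · have := Set.indicator_of_mem c4 fun _ => (1 : ℝ)
        linarith
      by_cases c3 : ∃ k, c ∈ s3 k
      · obtain ⟨k, hk⟩ := c3
        have h5 := Set.indicator_of_mem hk fun _ => (1 : ℝ)
        have h6 := Finset.single_le_sum (f := fun k => (s3 k).indicator (fun _ => (1 : ℝ)) c)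
          (fun k _ => h0 _ _) (Finset.mem_univ k)
        linarith
      · exfalso
        refine hc ⟨by simpa [hs1] using c1, not_lt.mp c2, fun k => not_lt.mp fun h => c3 ⟨k, h⟩,
          not_lt.mp c4⟩
  have hexp : Real.exp (-(5 * L)) ≤ 1 / 32 := by
    have h1 : Real.exp (-(5 * L)) ≤ Real.exp (-(5 * Real.log 2)) :=
      Real.exp_le_exp.mpr (by linarith)
    have h2 : Real.exp (-(5 * Real.log 2)) = 1 / 32 := by
      rw [Real.exp_neg, show 5 * Real.log 2 = ((5 : ℕ) : ℝ) * Real.log 2 by norm_num,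
        Real.exp_nat_mul, Real.exp_log (by norm_num)]
      norm_num
    exact h1.trans h2.le
  have hb1 : F s1 ≤ 0 := wmean_unavailable q
  have hb2 : F s2 ≤ Real.exp (-L) / 3 := by
    have hc0 : 0 < √(Fintype.card ι : ℝ) := Real.sqrt_pos.mpr (by linarith)
    -- this exponent makes `s ^ 2 * card ι - s * R` equal to `4 L - 10 L`
    have h1 := tail_norm hq hH hb hy (s := 2 * √L / √(Fintype.card ι)) (by positivity) (by
      rw [div_mul_cancel₀ _ hc0.ne']; linarith) (5 * √(Fintype.card ι * L))
    refine h1.trans ?_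
    have e : (2 * √L / √(Fintype.card ι)) ^ 2 * Fintype.card ι
        - 2 * √L / √(Fintype.card ι) * (5 * √(Fintype.card ι * L)) + 1
        = -L + (-(5 * L)) + 1 := by
      rw [div_pow, mul_pow, Real.sq_sqrt hL0.le, Real.sq_sqrt (by linarith),
        Real.sqrt_mul (by linarith)]
      have : 2 * √L / √(Fintype.card ι : ℝ) * (5 * (√(Fintype.card ι : ℝ) * √L))
          = 10 * (√L * √L) := by
        field_simp; ring
      rw [this, Real.mul_self_sqrt hL0.le]
      field_simp
      ring
    rw [e, Real.exp_add, Real.exp_add]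
    have h2 : Real.exp 1 ≤ 3 := by linarith [Real.exp_one_lt_d9]
    have h3 : Real.exp (-(5 * L)) * Real.exp 1 ≤ 1 / 32 * 3 :=
      mul_le_mul hexp h2 (Real.exp_pos _).le (by norm_num)
    nlinarith [Real.exp_pos (-L)]
  have hb3 : ∀ k, F (s3 k) ≤ Real.exp (-L) / 16 := by
    intro k
    refine (tail_direction hq hH hb hy (s := 5 * √L) (by positivity) (by linarith) _).trans ?_
    have h1 : Real.exp (-((5 * √L) ^ 2 / 4)) ≤ Real.exp (-L + -(5 * L)) := by
      rw [mul_pow, Real.sq_sqrt hL0.le]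
      exact Real.exp_le_exp.mpr (by linarith)
    rw [Real.exp_add] at h1
    nlinarith [Real.exp_pos (-L)]
  have hb4 : F s4 ≤ Real.exp (-L) / 3 := tail_quartic hq hH hb hy hL hbL hbL'
  have hb3' : ∑ k, F (s3 k) ≤ (Fintype.card κ * 2) * (Real.exp (-L) / 16) := by
    refine (Finset.sum_le_sum fun k _ => hb3 k).trans (le_of_eq ?_)
    simp [Finset.sum_const, Finset.card_univ, Fintype.card_prod]
  have hE := Real.exp_pos (-L)
  refine hunion.trans (le_trans ?_ hδ)
  nlinarith

/-- On favourable choices the one-step error is bounded along the whole affine family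
`x k - t x' k`. -/
lemma abs_inner_plane_le (hH : (fisher q y).PosDef) {x x' : κ → EuclideanSpace ℝ ι} {c : T → J}
    (hc : c ∈ goodChoices q y x x' L) (hL : 0 ≤ L) (k : κ) (t : ℝ) :
    |inner ℝ (x k - t • x' k) (act (fisher q y)⁻¹ (noise q y c))|
      ≤ √50 * √L * wnorm (fisher q y)⁻¹ (x k - t • x' k) := by
  set M := (fisher q y)⁻¹ with hM
  have hMp : M.PosDef := hH.inv
  set z := act M (noise q y c) with hz
  obtain ⟨-, -, hdir, -⟩ := hc
  have h0 : |inner ℝ (x k) z| ≤ 5 * √L * wnorm M (x k) := hdir (k, false)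
  set s := inner ℝ (x' k) (act M (x k)) / inner ℝ (x k) (act M (x k)) with hs
  set e := x' k - s • x k with he
  have h1 : |inner ℝ e z| ≤ 5 * √L * wnorm M e := hdir (k, true)
  have horth : inner ℝ e (act M (x k)) = 0 := by
    rw [he, inner_sub_left, real_inner_smul_left, hs]
    by_cases hx : x k = 0
    · simp [hx]
    · have : inner ℝ (x k) (act M (x k)) ≠ 0 := by
        rw [← wnorm_sq hMp.posSemidef]
        exact (pow_pos (wnorm_pos hMp hx) 2).ne'
      rw [div_mul_cancel₀ _ this, sub_self]
  have hdecomp : x k - t • x' k = (1 - t * s) • x k - t • e := by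
    rw [he]; module
  have hnorm : wnorm M (x k - t • x' k) ^ 2
      = (1 - t * s) ^ 2 * wnorm M (x k) ^ 2 + t ^ 2 * wnorm M e ^ 2 := by
    rw [wnorm_sq hMp.posSemidef, wnorm_sq hMp.posSemidef, wnorm_sq hMp.posSemidef, hdecomp]
    have horth' : inner ℝ (x k) (act M e) = 0 := by
      rw [← inner_act_comm hMp.1, real_inner_comm, horth]
    rw [act, map_sub, map_smul, map_smul]
    simp only [inner_sub_left, inner_sub_right, real_inner_smul_left, real_inner_smul_right]
    rw [horth, horth']
    ring
  refine abs_le_of_sq_le_sq' ?_ (by positivity [wnorm_nonneg M (x k - t • x' k)]) |> abs_le.mpr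
  rw [mul_pow, mul_pow, Real.sq_sqrt (by norm_num), Real.sq_sqrt hL, hnorm, hdecomp,
    inner_sub_left, real_inner_smul_left, real_inner_smul_left]
  have h0' : inner ℝ (x k) z ^ 2 ≤ 25 * L * wnorm M (x k) ^ 2 := by
    have := pow_le_pow_left₀ (abs_nonneg _) h0 2
    rw [sq_abs, mul_pow, mul_pow, Real.sq_sqrt hL] at this
    linarith
  have h1' : inner ℝ e z ^ 2 ≤ 25 * L * wnorm M e ^ 2 := by
    have := pow_le_pow_left₀ (abs_nonneg _) h1 2
    rw [sq_abs, mul_pow, mul_pow, Real.sq_sqrt hL] at this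
    linarith
  have h2 := mul_le_mul_of_nonneg_left h0' (sq_nonneg (1 - t * s))
  have h3 := mul_le_mul_of_nonneg_left h1' (sq_nonneg t)
  nlinarith [sq_nonneg ((1 - t * s) * inner ℝ (x k) z + t * inner ℝ e z)]

end Good

/-! ### Measurability -/

section Measurability

variable {ι T J κ Ω : Type*} [Fintype ι] [DecidableEq ι] [Fintype T] [DecidableEq T] [Fintype J]
  [Fintype κ] [MeasurableSpace Ω]

/-- Measurability of a random vector, coordinate by coordinate. -/
def MeasurableCoord (v : Ω → EuclideanSpace ℝ ι) : Prop := ∀ i, Measurable fun ω => v ω i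

/-- Measurability of a random matrix, entry by entry. -/
def MeasurableEntry (A : Ω → Matrix ι ι ℝ) : Prop := ∀ i j, Measurable fun ω => A ω i j

lemma measurable_det {A : Ω → Matrix ι ι ℝ} (hA : MeasurableEntry A) :
    Measurable fun ω => (A ω).det := by
  simp only [Matrix.det_apply]
  refine Finset.measurable_fun_sum _ fun σ _ => Measurable.const_smul ?_ _
  exact Finset.measurable_fun_prod _ fun i _ => hA _ _

lemma MeasurableEntry.inv {A : Ω → Matrix ι ι ℝ} (hA : MeasurableEntry A) :
    MeasurableEntry fun ω => (A ω)⁻¹ := by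
  intro i j
  simp only [Matrix.inv_def, Matrix.smul_apply, Ring.inverse_eq_inv', smul_eq_mul,
    Matrix.adjugate_apply]
  refine (measurable_det hA).inv.mul (measurable_det fun a b => ?_)
  by_cases h : a = j
  · simp [h]
  · simpa [h] using hA a b

lemma measurable_inner {u v : Ω → EuclideanSpace ℝ ι} (hu : MeasurableCoord u)
    (hv : MeasurableCoord v) : Measurable fun ω => inner ℝ (u ω) (v ω) := by
  simp only [PiLp.inner_apply, RCLike.inner_apply, RCLike.conj_to_real]
  exact Finset.measurable_fun_sum _ fun i _ => (hv i).mul (hu i)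

lemma measurableCoord_act {A : Ω → Matrix ι ι ℝ} {v : Ω → EuclideanSpace ℝ ι}
    (hA : MeasurableEntry A) (hv : MeasurableCoord v) :
    MeasurableCoord fun ω => act (A ω) (v ω) := by
  intro i
  simp only [act, Matrix.ofLp_toEuclideanCLM, Matrix.mulVec, dotProduct]
  exact Finset.measurable_fun_sum _ fun j _ => (hA i j).mul (hv j)

lemma measurable_wnorm {A : Ω → Matrix ι ι ℝ} {v : Ω → EuclideanSpace ℝ ι}
    (hA : MeasurableEntry A) (hv : MeasurableCoord v) :
    Measurable fun ω => wnorm (A ω) (v ω) := by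
  simp only [wnorm_eq]
  exact (measurable_inner hv (measurableCoord_act hA hv)).sqrt

lemma measurable_wmean {q f : Ω → J → ℝ} (hq : ∀ c, Measurable fun ω => q ω c)
    (hf : ∀ c, Measurable fun ω => f ω c) : Measurable fun ω => wmean (q ω) (f ω) := by
  simp only [wmean]
  exact Finset.measurable_fun_sum _ fun c _ => (hq c).mul (hf c)

lemma measurable_dev {q f : Ω → J → ℝ} (hq : ∀ c, Measurable fun ω => q ω c)
    (hf : ∀ c, Measurable fun ω => f ω c) (c : J) : Measurable fun ω => dev (q ω) (f ω) c :=
  (hf c).sub (measurable_wmean hq hf)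

variable {q : Ω → T → J → ℝ} {y : Ω → T → J → EuclideanSpace ℝ ι}

lemma measurableEntry_fisher (hq : ∀ m c, Measurable fun ω => q ω m c)
    (hy : ∀ m c, MeasurableCoord fun ω => y ω m c) :
    MeasurableEntry fun ω => fisher (q ω) (y ω) := by
  intro i j
  simp only [fisher, Matrix.of_apply, wcov]
  refine Finset.measurable_fun_sum _ fun m _ => measurable_wmean (hq m) fun c => ?_
  exact (measurable_dev (hq m) (fun c => hy m c i) c).mul
    (measurable_dev (hq m) (fun c => hy m c j) c)

lemma measurableCoord_devVec (hq : ∀ m c, Measurable fun ω => q ω m c)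
    (hy : ∀ m c, MeasurableCoord fun ω => y ω m c) (m : T) (c : J) :
    MeasurableCoord fun ω => devVec (q ω m) (y ω m) c := by
  intro i
  simp only [devVec, PiLp.sub_apply, WithLp.ofLp_sum, Finset.sum_apply, PiLp.smul_apply,
    smul_eq_mul]
  exact (hy m c i).sub (Finset.measurable_fun_sum _ fun c' _ => (hq m c').mul (hy m c' i))

lemma measurableCoord_noise (hq : ∀ m c, Measurable fun ω => q ω m c)
    (hy : ∀ m c, MeasurableCoord fun ω => y ω m c) (c : T → J) :
    MeasurableCoord fun ω => noise (q ω) (y ω) c := by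
  intro i
  simp only [noise, WithLp.ofLp_sum, Finset.sum_apply]
  exact Finset.measurable_fun_sum _ fun m _ => measurableCoord_devVec hq hy m (c m) i

lemma measurableSet_goodChoices (hq : ∀ m c, Measurable fun ω => q ω m c)
    (hy : ∀ m c, MeasurableCoord fun ω => y ω m c) (x x' : κ → EuclideanSpace ℝ ι) (L : ℝ)
    (c : T → J) : MeasurableSet {ω | c ∈ goodChoices (q ω) (y ω) x x' L} := by
  have hM := (measurableEntry_fisher hq hy).inv
  have hz := measurableCoord_noise hq hy c
  have hMz := measurableCoord_act hM hz
  have hconst : ∀ v : EuclideanSpace ℝ ι, MeasurableCoord fun _ : Ω => v := fun v i =>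
    measurable_const
  have hdir : ∀ k, MeasurableCoord fun ω => orthoPair (fisher (q ω) (y ω))⁻¹ x x' k := by
    rintro ⟨k, _ | _⟩
    · exact hconst _
    · intro i
      simp only [orthoPair, PiLp.sub_apply, PiLp.smul_apply, smul_eq_mul]
      have hMx := measurableCoord_act hM (hconst (x k))
      exact measurable_const.sub (((measurable_inner (hconst _) hMx).div
        (measurable_inner (hconst _) hMx)).mul measurable_const)
  have hquart : Measurable fun ω => quartic (q ω) (y ω) c := by
    simp only [quartic]
    refine Finset.measurable_fun_sum _ fun m _ => measurable_wmean (hq m) fun c' => ?_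
    exact (measurable_inner (measurableCoord_devVec hq hy m c') hMz).pow_const 4
  have h1 : MeasurableSet {ω | ∀ m, q ω m (c m) ≠ 0} := by
    rw [Set.ofPred_forall]
    exact MeasurableSet.iInter fun m => (measurableSet_eq_fun (hq m _) measurable_const).compl
  have h3 : MeasurableSet {ω | ∀ k, |inner ℝ (orthoPair (fisher (q ω) (y ω))⁻¹ x x' k)
      (act (fisher (q ω) (y ω))⁻¹ (noise (q ω) (y ω) c))|
      ≤ 5 * √L * wnorm (fisher (q ω) (y ω))⁻¹ (orthoPair (fisher (q ω) (y ω))⁻¹ x x' k)} := by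
    rw [Set.ofPred_forall]
    refine MeasurableSet.iInter fun k => ?_
    refine measurableSet_le ?_ ((measurable_wnorm hM (hdir k)).const_mul _)
    have := measurable_inner (hdir k) hMz
    exact continuous_abs.measurable.comp this
  exact h1.inter ((measurableSet_le (measurable_wnorm hM hz) measurable_const).inter
    (h3.inter (measurableSet_le hquart measurable_const)))

end Measurability

/-! ### The random dataset -/

section Design

variable {Ω : Type*} {n N d : ℕ}

lemma measurable_avail (D : Ω → Fin n → Observation N d) (m : Fin n) (c : Option (Fin N)) :
    Measurable[designSigma D] fun ω => avail (D ω m).assortment c := by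
  have h1 : Measurable[MeasurableSpace.comap (fun ω => (D ω m).assortment) ⊤]
      fun ω => avail (D ω m).assortment c := by
    have h2 : @Measurable (Finset (Fin N)) ℝ ⊤ _ fun S => avail S c := measurable_from_top
    exact h2.comp (comap_measurable _)
  refine h1.mono ?_ le_rfl
  exact le_sup_left.trans (le_iSup (fun m : Fin n =>
    (MeasurableSpace.comap (fun ω => (D ω m).assortment) ⊤ ⊔
      ⨆ j : Fin N, MeasurableSpace.comap
        (fun ω => augment ((D ω m).feature j) ((D ω m).price j)) (borel (Aug d)))) m)

lemma measurableCoord_optVec (D : Ω → Fin n → Observation N d) (m : Fin n) (c : Option (Fin N)) :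
    @MeasurableCoord _ Ω (designSigma D) fun ω => (D ω m).optVec c := by
  intro i
  cases c with
  | none => exact @measurable_const _ _ _ (designSigma D) _
  | some j =>
    have h1 : Measurable[MeasurableSpace.comap
        (fun ω => augment ((D ω m).feature j) ((D ω m).price j)) (borel (Aug d))]
        fun ω => augment ((D ω m).feature j) ((D ω m).price j) i := by
      have h2 : @Measurable (Aug d) ℝ (borel (Aug d)) _ fun v => v i :=
        ((EuclideanSpace.proj i : Aug d →L[ℝ] ℝ).continuous).borel_measurable
      exact h2.comp (comap_measurable _)
    refine h1.mono ?_ le_rfl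
    exact (le_iSup (fun j : Fin N => MeasurableSpace.comap
        (fun ω => augment ((D ω m).feature j) ((D ω m).price j)) (borel (Aug d))) j).trans
      (le_sup_right.trans (le_iSup (fun m : Fin n =>
        (MeasurableSpace.comap (fun ω => (D ω m).assortment) ⊤ ⊔
          ⨆ j : Fin N, MeasurableSpace.comap
            (fun ω => augment ((D ω m).feature j) ((D ω m).price j)) (borel (Aug d)))) m))

lemma measurable_prob (D : Ω → Fin n → Observation N d) (θ : Aug d) (m : Fin n)
    (c : Option (Fin N)) : Measurable[designSigma D] fun ω => (D ω m).prob θ c := by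
  let _ : MeasurableSpace Ω := designSigma D
  have hexp : ∀ c, Measurable fun ω => Real.exp (inner ℝ ((D ω m).optVec c) θ) := fun c =>
    (measurable_inner (measurableCoord_optVec D m c) (v := fun _ => θ)
      fun i => measurable_const).exp
  simp only [prob_eq_tilt, tilt]
  exact ((measurable_avail D m c).mul (hexp c)).div
    (measurable_wmean (fun c => measurable_avail D m c) hexp)

/-- If, for almost every design, the choices fall outside `G` with conditional probability at most
`δ`, then they do so with probability at most `δ`. -/
lemma IsMNLSample.measure_compl_le [mΩ : MeasurableSpace Ω] {μ : Measure Ω}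
    [IsProbabilityMeasure μ] {D : Ω → Fin n → Observation N d} {θ : Aug d} (h : IsMNLSample μ D θ)
    {G : Ω → Set (Fin n → Option (Fin N))}
    (hG : ∀ c, MeasurableSet[designSigma D] {ω | c ∈ G ω}) {δ : ℝ}
    (hδ : ∀ᵐ ω ∂μ,
      wmean (pathLaw fun m => (D ω m).prob θ) ((G ω)ᶜ.indicator fun _ => 1) ≤ δ) :
    MeasurableSet {ω | (fun m => (D ω m).choice) ∈ G ω} ∧
      μ.real {ω | (fun m => (D ω m).choice) ∈ G ω}ᶜ ≤ δ := by
  have hch : ∀ c : Fin n → Option (Fin N), MeasurableSet {ω | ∀ m, (D ω m).choice = c m} := by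
    intro c
    rw [Set.ofPred_forall]
    exact MeasurableSet.iInter fun m => h.measurableSet_choice m (c m)
  have hGm : ∀ c, MeasurableSet {ω | c ∈ G ω} := fun c => h.designSigma_le _ (hG c)
  have hE : {ω | (fun m => (D ω m).choice) ∈ G ω}ᶜ
      = ⋃ c ∈ (Finset.univ : Finset (Fin n → Option (Fin N))),
        {ω | ∀ m, (D ω m).choice = c m} ∩ {ω | c ∈ G ω}ᶜ := by
    ext ω
    simp only [Set.mem_compl_iff, Set.mem_ofPred_eq, Finset.mem_univ, Set.iUnion_true,
      Set.mem_iUnion, Set.mem_inter_iff]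
    constructor
    · intro hω
      exact ⟨fun m => (D ω m).choice, fun m => rfl, hω⟩
    · rintro ⟨c, hc, hω⟩
      rwa [show (fun m => (D ω m).choice) = c from funext hc]
  have hmeas : MeasurableSet {ω | (fun m => (D ω m).choice) ∈ G ω}ᶜ := by
    rw [hE]
    exact Finset.measurableSet_biUnion _ fun c _ => (hch c).inter (hGm c).compl
  refine ⟨hmeas.of_compl, ?_⟩
  rw [hE]
  refine (measureReal_biUnion_finset_le _ _).trans ?_
  have hint : ∀ c : Fin n → Option (Fin N),
      Integrable (fun ω => ∏ m, (D ω m).prob θ (c m)) μ := fun c =>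
    integrable_condExp.congr (h.condLaw c)
  have hterm : ∀ c : Fin n → Option (Fin N),
      μ.real ({ω | ∀ m, (D ω m).choice = c m} ∩ {ω | c ∈ G ω}ᶜ)
        = ∫ ω, ({ω | c ∈ G ω}ᶜ).indicator (fun ω => ∏ m, (D ω m).prob θ (c m)) ω ∂μ := by
    intro c
    rw [integral_indicator (hGm c).compl]
    have h1 := setIntegral_condExp (μ := μ) h.designSigma_le
      (f := {ω | ∀ m, (D ω m).choice = c m}.indicator fun _ => (1 : ℝ))
      ((integrable_const (1 : ℝ)).indicator (hch c)) (hG c).compl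
    rw [setIntegral_indicator (hch c), setIntegral_const, smul_eq_mul, mul_one] at h1
    rw [Set.inter_comm, ← h1]
    exact integral_congr_ae (ae_restrict_of_ae (h.condLaw c))
  simp only [hterm]
  rw [← integral_finsetSum _ fun c _ => (hint c).indicator (hGm c).compl]
  have hsum : ∀ ω, ∑ c, ({ω | c ∈ G ω}ᶜ).indicator (fun ω => ∏ m, (D ω m).prob θ (c m)) ω
      = wmean (pathLaw fun m => (D ω m).prob θ) ((G ω)ᶜ.indicator fun _ => 1) := by
    intro ω
    refine Finset.sum_congr rfl fun c _ => ?_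
    by_cases hc : c ∈ G ω
    · rw [Set.indicator_of_notMem (by simpa using hc), Set.indicator_of_notMem (by simpa using hc),
        mul_zero]
    · rw [Set.indicator_of_mem (by simpa using hc), Set.indicator_of_mem (by simpa using hc),
        mul_one, pathLaw]
  have hmono := integral_mono_ae (μ := μ)
    (integrable_finsetSum Finset.univ fun c _ => (hint c).indicator (hGm c).compl)
    (integrable_const δ) (by
      filter_upwards [hδ] with ω hω
      rw [hsum]
      exact hω)
  simpa using hmono

/-- Almost surely all choices are available options. -/
lemma IsMNLSample.ae_valid [mΩ : MeasurableSpace Ω] {μ : Measure Ω}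
    [IsProbabilityMeasure μ] {D : Ω → Fin n → Observation N d} {θ : Aug d}
    (h : IsMNLSample μ D θ) : ∀ᵐ ω ∂μ, ValidChoices (D ω) := by
  have h1 := (h.measure_compl_le (G := fun ω => {c | ∀ m, (D ω m).prob θ (c m) ≠ 0}) (fun c => ?_)
    (δ := 0) (Filter.Eventually.of_forall fun ω => wmean_unavailable _)).2
  · have h2 := le_antisymm h1 measureReal_nonneg
    rw [measureReal_eq_zero_iff] at h2
    filter_upwards [compl_mem_ae_iff.mpr h2] with ω hω m
    rw [Set.mem_compl_iff, Set.notMem_compl_iff] at hω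
    exact (prob_ne_zero _ θ).mp (hω m)
  · let _ : MeasurableSpace Ω := designSigma D
    simp only [Set.mem_ofPred_eq]
    rw [Set.ofPred_forall]
    exact MeasurableSet.iInter fun m =>
      (measurableSet_eq_fun (measurable_prob D θ m (c m)) measurable_const).compl

end Design

/-! ### Accuracy of the pessimistic utilities -/

section Accuracy

variable {n N d : ℕ}

lemma augment_eq (x : Feat d) (p : ℝ) : augment x p = stack x 0 - p • stack 0 x := by
  ext i
  cases i <;> simp [augment, stack]

lemma inner_stack (a b a' b' : Feat d) :
    inner ℝ (stack a b) (stack a' b') = inner ℝ a a' + inner ℝ b b' := by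
  simp [stack, PiLp.inner_apply, Fintype.sum_sum_type]

lemma utility_stack (X : Fin N → Feat d) (ψ φ : Feat d) :
    utility X (stack ψ φ) = fun i p => inner ℝ (X i) ψ - inner ℝ φ (X i) * p := by
  funext i p
  rw [utility, augment_eq, inner_sub_left, real_inner_smul_left, inner_stack, inner_stack,
    real_inner_comm φ]
  simp only [inner_zero_left, inner_zero_right, add_zero, zero_add]
  rw [real_inner_comm φ, mul_comm p]

lemma norm_le_norm_stack (ψ φ : Feat d) : ‖ψ‖ ≤ ‖stack ψ φ‖ := by
  refine abs_le_of_sq_le_sq' ?_ (norm_nonneg _) |>.2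
  rw [← real_inner_self_eq_norm_sq, ← real_inner_self_eq_norm_sq, inner_stack]
  linarith [real_inner_self_nonneg (x := φ)]

lemma continuous_augment (x : Feat d) : Continuous fun p => augment x p := by
  simp only [augment_eq]
  fun_prop

lemma continuous_lcbUtility (D : Fin n → Observation N d) (X : Fin N → Feat d) (δ : ℝ)
    (θ : Aug d) (i : Fin N) : Continuous (lcbUtility D X δ θ i) := by
  have h1 := continuous_augment (X i)
  have h2 : Continuous fun p => wnorm (hessian D θ)⁻¹ (augment (X i) p) := by
    simp only [wnorm_eq]
    exact (h1.inner ((ContinuousLinearMap.continuous _).comp h1)).sqrt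
  unfold lcbUtility
  exact (h1.inner continuous_const).sub ((continuous_const.mul h2).mul continuous_const)

variable {D : Fin n → Observation N d} {X : Fin N → Feat d} {θ : Aug d} {b L : ℝ}

/-- The dataset is favourable: its choices are, in the directions of the target items, and the
features offered are short in the dual norm of the Fisher information. -/
structure Favourable (D : Fin n → Observation N d) (X : Fin N → Feat d) (θ : Aug d) (b L : ℝ) :
    Prop where
  valid : ValidChoices D
  posDef : (fisherInfo D θ).PosDef
  short : ∀ m c, (D m).prob θ c ≠ 0 → wnorm (fisherInfo D θ)⁻¹ ((D m).optVec c) ≤ b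
  good : (fun m => (D m).choice) ∈ goodChoices (fun m => (D m).prob θ) (fun m => (D m).optVec)
    (fun i => stack (X i) 0) (fun i => stack 0 (X i)) L

lemma isMLE_iff (hD : ValidChoices D) {Δ : Aug d} : IsMLE D (θ + Δ) ↔
    ∀ Δ', excess (fun m => (D m).prob θ) (fun m => (D m).optVec) (fun m => (D m).choice) Δ
      ≤ excess (fun m => (D m).prob θ) (fun m => (D m).optVec) (fun m => (D m).choice) Δ' := by
  constructor
  · intro h Δ'
    have := h (θ + Δ')
    rwa [negLogLik_add hD, negLogLik_add hD, add_le_add_iff_left] at this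
  · intro h θ'
    rw [← add_sub_cancel θ θ', negLogLik_add hD, negLogLik_add hD, add_le_add_iff_left]
    exact h (θ' - θ)

lemma Favourable.noise_le (h : Favourable D X θ b L) : wnorm (fisherInfo D θ)⁻¹
    (noise (fun m => (D m).prob θ) (fun m => (D m).optVec) fun m => (D m).choice)
      ≤ 15 * √((2 * d : ℝ) * L) / 3 := by
  have := h.good.2.1
  simp only [Fintype.card_sum, Fintype.card_fin, ← two_mul, Nat.cast_mul, Nat.cast_ofNat] at this
  exact this.trans (le_of_eq (by ring))

lemma Favourable.exists_isMLE (h : Favourable D X θ b L) (hb : 0 ≤ b)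
    (hκ : 0 < (2 * d : ℝ) * L) (hbκ : b * √((2 * d : ℝ) * L) ≤ 1 / 144) : ∃ θ', IsMLE D θ' := by
  obtain ⟨Δ, hΔ⟩ := exists_excess_min (fun m => prob_mem (D m) θ) h.posDef hb h.short
    (ρ := 15 * √((2 * d : ℝ) * L)) (mul_pos (by norm_num) (Real.sqrt_pos.mpr hκ)) (by linarith)
    h.noise_le
  exact ⟨θ + Δ, (isMLE_iff h.valid).mpr hΔ⟩

/-- On a favourable dataset, the utilities are estimated with an accuracy that depends on the
direction but not on the dimension, and the Hessian at the estimate is comparable to that at the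
true parameter. -/
lemma Favourable.estimate_accuracy (h : Favourable D X θ b L) (hb : 0 ≤ b) (hL : 0 ≤ L)
    (hκ : 0 < (2 * d : ℝ) * L) (hbκ : b * √((2 * d : ℝ) * L) ≤ 1 / 144) {θ' : Aug d}
    (hθ' : IsMLE D θ') :
    (∀ i p, |inner ℝ (augment (X i) p) (θ' - θ)|
      ≤ 16.1 * √L * wnorm (fisherInfo D θ)⁻¹ (augment (X i) p)) ∧
    ∀ x, wnorm (fisherInfo D θ)⁻¹ x ≤ 1.12 * wnorm (hessian D θ')⁻¹ x ∧
      wnorm (hessian D θ')⁻¹ x ≤ 1.12 * wnorm (fisherInfo D θ)⁻¹ x := by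
  set ρ := 15 * √((2 * d : ℝ) * L) with hρdef
  have hρ : 0 < ρ := mul_pos (by norm_num) (Real.sqrt_pos.mpr hκ)
  have hbρ : b * ρ ≤ 15 / 144 := by rw [hρdef]; linarith
  obtain ⟨Δ, rfl⟩ : ∃ Δ, θ' = θ + Δ := ⟨θ' - θ, (add_sub_cancel θ θ').symm⟩
  have hq : ∀ m, (D m).prob θ ∈ stdSimplex ℝ (Option (Fin N)) := fun m => prob_mem (D m) θ
  have hmin := (isMLE_iff h.valid).mp hθ'
  have hΔ : wnorm (fisherInfo D θ) Δ ≤ ρ := by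
    by_contra! hlt
    have h1 := excess_pos hq h.posDef hb h.short hρ (by linarith) h.noise_le hlt.le
    have h2 := hmin 0
    rw [excess_zero hq] at h2
    linarith
  have hbΔ : b * wnorm (fisherInfo D θ) Δ ≤ 15 / 144 :=
    (mul_le_mul_of_nonneg_left hΔ hb).trans hbρ
  have hhess : hessian D (θ + Δ) = fisher
      (fun m => tilt ((D m).prob θ) fun c => inner ℝ ((D m).optVec c) Δ) fun m => (D m).optVec := by
    rw [hessian_eq h.valid, fisherInfo]
    simp only [prob_add]
  have hcmp := (fisher_tilt_comparable hq h.posDef h.short hbΔ hhess).2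
  refine ⟨fun i p => ?_, fun x => ?_⟩
  · have h1 := newton_error_le hq h.posDef hb h.short hbρ hΔ hmin h.good.2.2.2
      (augment (X i) p)
    have h2 := abs_inner_plane_le h.posDef h.good hL i p
    rw [← augment_eq] at h2
    rw [add_sub_cancel_left]
    have h50 : √50 ≤ 7.1 := Real.sqrt_le_iff.mpr ⟨by norm_num, by norm_num⟩
    set M := wnorm (fisherInfo D θ)⁻¹ (augment (X i) p) with hM
    have h3 : √50 * √L * M ≤ 7.1 * √L * M := by
      have : 0 ≤ √L * M := mul_nonneg (Real.sqrt_nonneg _) (wnorm_nonneg _ _)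
      nlinarith
    have h4 := abs_sub_abs_le_abs_sub (inner ℝ (augment (X i) p) Δ)
      (inner ℝ (augment (X i) p) (act (fisherInfo D θ)⁻¹
        (noise (fun m => (D m).prob θ) (fun m => (D m).optVec) fun m => (D m).choice)))
    have h1' := h4.trans h1
    have h2' := h2.trans h3
    change _ - _ ≤ 9 * √L * M at h1'
    simp only [fisherInfo] at h1' h2' ⊢
    linarith
  · obtain ⟨h1, h2⟩ := hcmp x
    constructor
    · refine abs_le_of_sq_le_sq' ?_ (mul_nonneg (by norm_num) (wnorm_nonneg _ _)) |>.2
      rw [mul_pow]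
      refine h1.trans (mul_le_mul_of_nonneg_right (by norm_num) (sq_nonneg _))
    · refine abs_le_of_sq_le_sq' ?_ (mul_nonneg (by norm_num) (wnorm_nonneg _ _)) |>.2
      rw [mul_pow]
      refine h2.trans (mul_le_mul_of_nonneg_right (by norm_num) (sq_nonneg _))

/-- On a favourable dataset the pessimistic utilities lie below the true ones, but not by much. -/
lemma Favourable.lcbUtility_mem {δ : ℝ} (h : Favourable D X θ b (Real.log (N / δ))) (hb : 0 ≤ b)
    (hL : 0 ≤ Real.log (N / δ)) (hκ : 0 < (2 * d : ℝ) * Real.log (N / δ))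
    (hbκ : b * √((2 * d : ℝ) * Real.log (N / δ)) ≤ 1 / 144) {θ' : Aug d}
    (hθ' : IsMLE D θ') (i : Fin N) (p : ℝ) :
    lcbUtility D X δ θ' i p ≤ utility X θ i p ∧
      utility X θ i p - 50 * √(Real.log (N / δ)) * wnorm (fisherInfo D θ)⁻¹ (augment (X i) p)
        ≤ lcbUtility D X δ θ' i p := by
  obtain ⟨h1, h2⟩ := h.estimate_accuracy hb hL hκ hbκ hθ'
  have h3 := abs_le.mp (h1 i p)
  obtain ⟨h4, h5⟩ := h2 (augment (X i) p)
  have h6 : (1.73 : ℝ) ≤ √3 := Real.le_sqrt_of_sq_le (by norm_num)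
  have h7 : √3 ≤ 1.74 := Real.sqrt_le_iff.mpr ⟨by norm_num, by norm_num⟩
  rw [inner_sub_right] at h3
  rw [lcbUtility, utility]
  set l := √(Real.log (N / δ))
  set M := wnorm (fisherInfo D θ)⁻¹ (augment (X i) p)
  set M' := wnorm (hessian D θ')⁻¹ (augment (X i) p)
  have hl : 0 ≤ l := Real.sqrt_nonneg _
  have hM' : 0 ≤ M' := wnorm_nonneg _ _
  have hlM' : 0 ≤ l * M' := mul_nonneg hl hM'
  have h8 : l * M ≤ 1.12 * (l * M') := by nlinarith
  have h9 : l * M' ≤ 1.12 * (l * M) := by nlinarith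
  have h10 : 16 * √3 * M' * l = 16 * √3 * (l * M') := by ring
  have h11 : 1.73 * (l * M') ≤ √3 * (l * M') := mul_le_mul_of_nonneg_right h6 hlM'
  have h12 : √3 * (l * M') ≤ 1.74 * (l * M') := mul_le_mul_of_nonneg_right h7 hlM'
  rw [h10]
  constructor
  · linarith [h3.2]
  · linarith [h3.1]

/-- The suboptimality bound on a favourable dataset. -/
lemma Favourable.subopt_le {δ W L₀ : ℝ} {K : ℕ} {ψ φ : Feat d}
    (h : Favourable D X (stack ψ φ) b (Real.log (N / δ))) (hb : 0 ≤ b)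
    (hL : Real.log 2 ≤ Real.log (N / δ)) (hd : 1 ≤ d)
    (hbκ : b * √((2 * d : ℝ) * Real.log (N / δ)) ≤ 1 / 144) (hK : 1 ≤ K) (hW : 0 < W)
    (hL₀ : 0 < L₀) (hθ : ‖stack ψ φ‖ ≤ W) (hX : ∀ i, ‖X i‖ ≤ 1)
    (hφ : ∀ i, L₀ ≤ inner ℝ φ (X i)) {Sstar Soff S : Finset (Fin N)}
    {pstar poff p : Fin N → ℝ}
    (hstar : IsOptimalPair (utility X (stack ψ φ)) K (Set.Icc 0 (priceBound W L₀ K)) Sstar pstar)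
    (hoff : IsOptimalPair (utility X (stack ψ φ)) K Set.univ Soff poff)
    (hout : IsLCBOutput D X δ K (priceBound W L₀ K) S p) :
    trueRevenue X (stack ψ φ) Soff poff - trueRevenue X (stack ψ φ) S p
      ≤ 10000 * (1 + Real.log K) * Real.log (N / δ) *
        (max 1 W / L₀ * √(∑ j ∈ Sstar, modelProb X (stack ψ φ) Sstar pstar (some j) *
            modelProb X (stack ψ φ) Sstar pstar none *
            wnorm (fisherInfo D (stack ψ φ))⁻¹ (augment (X j) (pstar j)) ^ 2)
          + max 1 W / L₀ * ⨆ j : {j // j ∈ Sstar},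
            wnorm (fisherInfo D (stack ψ φ))⁻¹ (augment (X j) (pstar j)) ^ 2) := by
  set θ := stack ψ φ with hθdef
  set L := Real.log (N / δ) with hLdef
  have hL2 : 0.69 ≤ L := by linarith [Real.log_two_gt_d9]
  have hL0 : 0 < L := by linarith
  have hd' : (1 : ℝ) ≤ d := by exact_mod_cast hd
  have hκ : 0 < (2 * d : ℝ) * L := by positivity
  have hlogK : 0 ≤ Real.log K := Real.log_nonneg (by exact_mod_cast hK)
  set P := priceBound W L₀ K with hPdef
  have hP0 : 0 ≤ P := by
    rw [hPdef, priceBound]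
    positivity
  obtain ⟨θ', hθ', hopt⟩ := hout
  have hmem := h.lcbUtility_mem hb hL0.le hκ hbκ hθ'
  set M : Fin N → ℝ := fun j => wnorm (fisherInfo D θ)⁻¹ (augment (X j) (pstar j)) with hM
  set A := ∑ j ∈ Sstar, modelProb X θ Sstar pstar (some j) * modelProb X θ Sstar pstar none *
    M j ^ 2 with hA
  set B := ⨆ j : {j // j ∈ Sstar}, M j ^ 2 with hB
  have hB0 : 0 ≤ B := Real.iSup_nonneg fun j => sq_nonneg _
  -- the price range `[0, P]` contains the unconstrained optimum
  have hcap : trueRevenue X θ Soff poff ≤ trueRevenue X θ Sstar pstar := by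
    rw [hθdef, utility_stack] at hoff
    have hα : ∀ i, inner ℝ (X i) ψ ≤ W := fun i =>
      calc inner ℝ (X i) ψ ≤ ‖X i‖ * ‖ψ‖ := real_inner_le_norm _ _
        _ ≤ 1 * W := mul_le_mul (hX i) ((norm_le_norm_stack ψ φ).trans hθ) (norm_nonneg _)
            zero_le_one
        _ = W := one_mul W
    obtain ⟨p', hp', hrev⟩ := exists_capped_prices (P := P) hK hW hL₀ hα hφ le_rfl hoff
    have h1 := hstar.2 Soff p' hoff.1.1 hp'
    simp only [trueRevenue, hθdef, utility_stack] at h1 ⊢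
    exact hrev.trans h1
  -- pessimism: the revenue of the output is at least its pessimistic revenue
  have hpess : revenue (fun i => lcbUtility D X δ θ' i (p i)) S p ≤ trueRevenue X θ S p :=
    revenue_mono (fun i hi => hopt.revenue_le_price hi) fun i _ => (hmem i (p i)).1
  have hbest : revenue (fun i => lcbUtility D X δ θ' i (pstar i)) Sstar pstar
      ≤ revenue (fun i => lcbUtility D X δ θ' i (p i)) S p := hopt.2 _ _ hstar.1.1 hstar.1.2
  have hloss : trueRevenue X θ Sstar pstar
      - revenue (fun i => lcbUtility D X δ θ' i (pstar i)) Sstar pstar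
      ≤ P * (3 * √(∑ j ∈ Sstar, modelProb X θ Sstar pstar (some j) *
          modelProb X θ Sstar pstar none * (50 * √L * M j) ^ 2) + 2500 * L * B) := by
    refine revenue_sub_le (w := fun j => 50 * √L * M j)
      (fun j _ => mul_nonneg (by positivity) (wnorm_nonneg _ _))
      (fun j _ => (hmem j (pstar j)).2)
      (fun j hj => hstar.revenue_le_price hj) (fun j _ => (hstar.1.2 j).1)
      (fun j _ => (hstar.1.2 j).2) hP0 (by positivity) fun j hj => ?_
    rw [mul_pow, mul_pow, Real.sq_sqrt hL0.le]
    have : M j ^ 2 ≤ B :=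
      le_ciSup (f := fun j : {j // j ∈ Sstar} => M j ^ 2) (Set.finite_range _).bddAbove ⟨j, hj⟩
    nlinarith
  have hsqrt : √(∑ j ∈ Sstar, modelProb X θ Sstar pstar (some j) *
      modelProb X θ Sstar pstar none * (50 * √L * M j) ^ 2) = 50 * √L * √A := by
    have : ∑ j ∈ Sstar, modelProb X θ Sstar pstar (some j) *
        modelProb X θ Sstar pstar none * (50 * √L * M j) ^ 2 = (50 * √L) ^ 2 * A := by
      rw [hA, Finset.mul_sum]
      exact Finset.sum_congr rfl fun j _ => by ring
    rw [this, Real.sqrt_mul (sq_nonneg _), Real.sqrt_sq (by positivity)]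
  rw [hsqrt] at hloss
  have hPle : P ≤ 4 * (1 + Real.log K) * (max 1 W / L₀) := by
    rw [hPdef, priceBound, ← mul_div_assoc]
    refine div_le_div_of_nonneg_right ?_ hL₀.le
    have h1 : 1 ≤ max 1 W := le_max_left _ _
    have h2 : W ≤ max 1 W := le_max_right _ _
    nlinarith [mul_nonneg (sub_nonneg.mpr h1) hlogK]
  have hsL : √L ≤ 1.3 * L := by
    refine Real.sqrt_le_iff.mpr ⟨by linarith, ?_⟩
    nlinarith
  have hsA := Real.sqrt_nonneg A
  have hin : 3 * (50 * √L * √A) + 2500 * L * B ≤ 2500 * L * (√A + B) := by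
    have := mul_le_mul_of_nonneg_right hsL hsA
    nlinarith [mul_nonneg hL0.le hsA]
  calc trueRevenue X θ Soff poff - trueRevenue X θ S p
      ≤ P * (3 * (50 * √L * √A) + 2500 * L * B) := by linarith
    _ ≤ P * (2500 * L * (√A + B)) := mul_le_mul_of_nonneg_left hin hP0
    _ ≤ 4 * (1 + Real.log K) * (max 1 W / L₀) * (2500 * L * (√A + B)) :=
        mul_le_mul_of_nonneg_right hPle (by positivity)
    _ = _ := by ring

end Accuracy

end MNLPricing

end

open MNLPricing in
theorem mainTheorem2 :
    ∃ C : ℝ, 0 < C ∧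
      ∀ (n N d K : ℕ) (W L₀ δ : ℝ) (ψ φ : MNLPricing.Feat d)
        (X : Fin N → MNLPricing.Feat d)
        (Ω : Type*) [MeasurableSpace Ω] (μ : Measure Ω) [IsProbabilityMeasure μ]
        (D : Ω → Fin n → MNLPricing.Observation N d)
        (Sstar Soff : Finset (Fin N)) (pstar poff : Fin N → ℝ),
        1 ≤ K → 0 < δ → δ < 1 → 2 ≤ (N : ℝ) / δ → 0 < W → 0 < L₀ →
        -- boundedness
        ‖MNLPricing.stack ψ φ‖ ≤ W → (∀ i, ‖X i‖ ≤ 1) →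
        -- minimum price sensitivity
        (∀ i, L₀ ≤ inner ℝ φ (X i)) →
        -- the dataset is drawn from the model
        MNLPricing.IsMNLSample μ D (MNLPricing.stack ψ φ) →
        -- the Hessian at the true parameter is invertible
        (∀ᵐ ω ∂μ, IsUnit (MNLPricing.hessian (D ω) (MNLPricing.stack ψ φ))) →
        -- burn-in condition
        (∀ᵐ ω ∂μ, ∀ m, ∀ j ∈ (D ω m).assortment,
          144 * MNLPricing.wnorm (MNLPricing.hessian (D ω) (MNLPricing.stack ψ φ))⁻¹
              (MNLPricing.augment ((D ω m).feature j) ((D ω m).price j))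
            ≤ (2 * (d : ℝ) * Real.log (N / δ)) ^ (-(1 / 2) : ℝ)) →
        -- an optimal pair with prices in `[0, P]`, and one among all price vectors
        MNLPricing.IsOptimalPair (MNLPricing.utility X (MNLPricing.stack ψ φ)) K
          (Set.Icc 0 (MNLPricing.priceBound W L₀ K)) Sstar pstar →
        MNLPricing.IsOptimalPair (MNLPricing.utility X (MNLPricing.stack ψ φ)) K
          Set.univ Soff poff →
        ∃ E : Set Ω, MeasurableSet E ∧ ENNReal.ofReal (1 - δ) ≤ μ E ∧ ∀ ω ∈ E,
          (∃ S p, MNLPricing.IsLCBOutput (D ω) X δ K (MNLPricing.priceBound W L₀ K) S p) ∧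
          ∀ S p, MNLPricing.IsLCBOutput (D ω) X δ K (MNLPricing.priceBound W L₀ K) S p →
            MNLPricing.trueRevenue X (MNLPricing.stack ψ φ) Soff poff
                - MNLPricing.trueRevenue X (MNLPricing.stack ψ φ) S p
              ≤ C * (1 + Real.log K) * Real.log (N / δ) *
                (max 1 W / L₀ *
                    Real.sqrt (∑ j ∈ Sstar,
                      MNLPricing.modelProb X (MNLPricing.stack ψ φ) Sstar pstar (some j) *
                        MNLPricing.modelProb X (MNLPricing.stack ψ φ) Sstar pstar none *
                        MNLPricing.wnorm
                          (MNLPricing.hessian (D ω) (MNLPricing.stack ψ φ))⁻¹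
                          (MNLPricing.augment (X j) (pstar j)) ^ 2)
                  + max 1 W / L₀ *
                    ⨆ j : {j // j ∈ Sstar},
                      MNLPricing.wnorm
                        (MNLPricing.hessian (D ω) (MNLPricing.stack ψ φ))⁻¹
                        (MNLPricing.augment (X j) (pstar j)) ^ 2) := by
  refine ⟨10000, by norm_num, ?_⟩
  intro n N d K W L₀ δ ψ φ X Ω _ μ _ D Sstar Soff pstar poff hK hδ0 hδ1 hNδ hW hL₀ hθ hX hφ hsample
    hunit hburn hstar hoff
  set θ := stack ψ φ with hθdef
  set L := Real.log (N / δ) with hLdef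
  have hL : Real.log 2 ≤ L := Real.log_le_log (by norm_num) hNδ
  have hL0 : 0 < L := (Real.log_pos one_lt_two).trans_le hL
  have hN0 : N ≠ 0 := by
    rintro rfl
    norm_num at hNδ
  have hd : 1 ≤ d := by
    by_contra! hd0
    obtain rfl : d = 0 := by omega
    have := hφ ⟨0, Nat.pos_of_ne_zero hN0⟩
    simp [PiLp.inner_apply] at this
    linarith
  have hd' : (1 : ℝ) ≤ d := by exact_mod_cast hd
  have hκ : 0 < (2 * d : ℝ) * L := by positivity
  -- the bound on the dual norms of the offered features
  set b : ℝ := (√((2 * d : ℝ) * L))⁻¹ / 144 with hbdef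
  have hb : 0 ≤ b := by positivity
  have hs0 : 0 < √((2 * d : ℝ) * L) := Real.sqrt_pos.mpr hκ
  have hbκ : b * √((2 * d : ℝ) * L) = 1 / 144 := by
    rw [hbdef]
    field_simp
  have hpow : (2 * (d : ℝ) * L) ^ (-(1 / 2) : ℝ) = 144 * b := by
    rw [Real.rpow_neg hκ.le, ← Real.sqrt_eq_rpow, hbdef]
    ring
  rw [hpow] at hburn
  have hδL : (Fintype.card (Fin N) : ℝ) * Real.exp (-L) ≤ δ := by
    rw [Fintype.card_fin, hLdef, Real.exp_neg, Real.exp_log (by linarith)]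
    have : (N : ℝ) ≠ 0 := by exact_mod_cast hN0
    exact le_of_eq (by field_simp)
  have hbL : 144 ^ 2 * b ^ 2 * ((Fintype.card (Fin d ⊕ Fin d) : ℝ) * L) ≤ 1 := by
    have h1 : (Fintype.card (Fin d ⊕ Fin d) : ℝ) * L = √((2 * d : ℝ) * L) ^ 2 := by
      rw [Real.sq_sqrt hκ.le, Fintype.card_sum, Fintype.card_fin]
      push_cast
      ring
    have h2 : 144 ^ 2 * b ^ 2 * √((2 * d : ℝ) * L) ^ 2
        = 144 ^ 2 * (b * √((2 * d : ℝ) * L)) ^ 2 := by ring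
    rw [h1, h2, hbκ]
    norm_num
  -- the almost sure properties of the design
  have hae : ∀ᵐ ω ∂μ, ValidChoices (D ω) ∧ (fisherInfo (D ω) θ).PosDef ∧
      ∀ m c, (D ω m).prob θ c ≠ 0 → wnorm (fisherInfo (D ω) θ)⁻¹ ((D ω m).optVec c) ≤ b := by
    filter_upwards [hsample.ae_valid, hunit, hburn] with ω hv hu hbu
    rw [hessian_eq hv] at hu hbu
    refine ⟨hv, fisher_posDef (fun m => (prob_mem _ _).1) hu, fun m c hc => ?_⟩
    rw [prob_ne_zero] at hc
    cases c with
    | none => simpa [Observation.optVec, wnorm_zero] using hb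
    | some j =>
      have hj : j ∈ (D ω m).assortment := by
        by_contra hj
        simp [avail, hj] at hc
      have := hbu m j hj
      simp only [Observation.optVec]
      linarith
  let G : Ω → Set (Fin n → Option (Fin N)) := fun ω => goodChoices (fun m => (D ω m).prob θ)
    (fun m => (D ω m).optVec) (fun i => stack (X i) 0) (fun i => stack 0 (X i)) L
  obtain ⟨hE0, hE0δ⟩ := hsample.measure_compl_le (G := G) (δ := δ)
    (fun c => @measurableSet_goodChoices _ _ _ _ Ω _ _ _ _ _ _ (designSigma D)
      (fun ω m => (D ω m).prob θ) (fun ω m => (D ω m).optVec)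
      (fun m c => measurable_prob D θ m c) (fun m c => measurableCoord_optVec D m c) _ _ L c) (by
    filter_upwards [hae] with ω hω
    exact wmean_bad_le _ _ (fun m => prob_mem _ _) hω.2.1 hb hω.2.2 hL
      (by simp; omega) (by simp; omega) hbL hδL)
  set E0 : Set Ω := {ω | (fun m => (D ω m).choice) ∈ G ω} with hE0def
  obtain ⟨F, hFsub, hF, hF0⟩ := exists_measurable_superset_of_null (ae_iff.mp hae)
  refine ⟨E0 \ F, hE0.diff hF, ?_, fun ω hω => ?_⟩
  · rw [measure_sdiff_null hF0, ← ofReal_measureReal]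
    refine ENNReal.ofReal_le_ofReal ?_
    rw [probReal_compl_eq_one_sub hE0] at hE0δ
    linarith
  · have hprop : ValidChoices (D ω) ∧ (fisherInfo (D ω) θ).PosDef ∧
        ∀ m c, (D ω m).prob θ c ≠ 0 → wnorm (fisherInfo (D ω) θ)⁻¹ ((D ω m).optVec c) ≤ b := by
      by_contra hcon
      exact hω.2 (hFsub hcon)
    have hfav : Favourable (D ω) X θ b L := ⟨hprop.1, hprop.2.1, hprop.2.2, hω.1⟩
    refine ⟨?_, fun S p hout => ?_⟩
    · obtain ⟨θ', hθ'⟩ := hfav.exists_isMLE hb hκ hbκ.le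
      have hlogK : 0 ≤ Real.log K := Real.log_nonneg (by exact_mod_cast hK)
      obtain ⟨S, p, hSp⟩ := exists_isOptimalPair (continuous_lcbUtility (D ω) X δ θ') K
        (show 0 ≤ priceBound W L₀ K by rw [priceBound]; positivity)
      exact ⟨S, p, θ', hθ', hSp⟩
    · rw [hessian_eq hprop.1]
      exact hfav.subopt_le hb hL hd hbκ.le hK hW hL₀ hθ hX hφ hstar hoff hout
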